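/- **Model.** In the cell probe model with word size $w$, the memory consists of $2^w$ cells with addresses $0,\dots,2^w-1$, each holding $w$ bits. A data structure for Dynamic Reachability maintains a directed graph on $n$ given nodes, initially without edges, under insertions of new edges that keep the graph acyclic, and answers queries "can node $s$ reach node $t$?". Each update and each query is processed by adaptively probing cells (a probe during an update may also change the contents of the probed cell); the next address, the new contents and the answer may be arbitrary functions of the operation, of the contents read so far during the operation and of the random coins of the data structure. Only probes are counted. The answers are always correct. The worst-case update time is at most $t_u$ if every insertion uses at most $t_u$ probes (with probability $1$ over the coins), and the expected query time is at most $t_q$ if for every sequence of insertions and every following query the expected number of probes of the query, over the random coins, is at most $t_q$. **Theorem 1.** Any such data structure for Dynamic Reachability in $n$-node directed acyclic graphs under edge insertions with $w=\Omega(\lg n)$, worst-case update time $t_u$ and expected query time $t_q$ satisfies $$t_q=\Omega\!\left(\frac{\lg^{3/2} n}{\lg^2(t_u w)}\right).$$ That is: for every constant $c>0$ there are constants $C>0$ and $n_0$ such that for all $n\ge n_0$, all $w\ge c\lg n$ and all $t_u,t_q$, every data structure as above satisfies $t_q\ge C\,\lg^{3/2}n/\lg^2(t_u w)$. Here $\lg=\log_2$.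 -/

import Mathlib

open MeasureTheory
open scoped NNReal ENNReal

namespace CellProbe

/-- Cell addresses: the integers `0, …, 2 ^ w - 1`. -/
abbrev Addr (w : ℕ) : Type := Fin (2 ^ w)

/-- The contents of a memory cell: `w` bits. -/
abbrev Cell (w : ℕ) : Type := Fin w → Bool

/-- A memory state: the contents of all cells. -/
abbrev Memory (w : ℕ) : Type := Addr w → Cell w

/-- A query algorithm in the cell probe model: a decision tree. An inner node is labelled with the
address of the cell to probe and has one child for each possible contents of that cell; a leaf is
labelled with the answer. Computation between the probes is free. -/
inductive QueryTree (w : ℕ) (A : Type) : Type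
  | answer (a : A) : QueryTree w A
  | probe (addr : Addr w) (next : Cell w → QueryTree w A) : QueryTree w A

/-- The answer that a query algorithm announces on the memory `M`. -/
def QueryTree.eval {w : ℕ} {A : Type} (M : Memory w) : QueryTree w A → A
  | .answer a => a
  | .probe addr next => QueryTree.eval M (next (M addr))

/-- The number of cell probes of a query algorithm on the memory `M`. -/
def QueryTree.probes {w : ℕ} {A : Type} (M : Memory w) : QueryTree w A → ℕ
  | .answer _ => 0
  | .probe addr next => QueryTree.probes M (next (M addr)) + 1

/-- An update algorithm in the cell probe model: a decision tree in which every probe reads a cell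
and may also change its contents (if the cell contains `x`, it contains `write x` after the probe).
The next step may depend on everything that was read so far. -/
inductive UpdateTree (w : ℕ) : Type
  | halt : UpdateTree w
  | probe (addr : Addr w) (write : Cell w → Cell w) (next : Cell w → UpdateTree w) : UpdateTree w

/-- The memory after an update algorithm was executed on the memory `M`. -/
def UpdateTree.run {w : ℕ} : UpdateTree w → Memory w → Memory w
  | .halt, M => M
  | .probe addr write next, M =>
      UpdateTree.run (next (M addr)) (Function.update M addr (write (M addr)))

/-- The number of cell probes of an update algorithm executed on the memory `M`. -/
def UpdateTree.probes {w : ℕ} : UpdateTree w → Memory w → ℕ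
  | .halt, _ => 0
  | .probe addr write next, M =>
      UpdateTree.probes (next (M addr)) (Function.update M addr (write (M addr))) + 1

/-- A deterministic dynamic data structure with `w`-bit cells, updates from `U`, queries from `Q`
and answers in `A`. The algorithms know the update (or the query) and what they read from the
memory, nothing else. -/
structure DataStructure (w : ℕ) (U Q A : Type) where
  /-- the memory before the first update -/
  init : Memory w
  /-- the update algorithm for each update -/
  update : U → UpdateTree w
  /-- the query algorithm for each query -/
  query : Q → QueryTree w A

/-- The memory after the given updates (in chronological order) were processed. -/
def DataStructure.memory {w : ℕ} {U Q A : Type} (D : DataStructure w U Q A) (l : List U) :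
    Memory w :=
  l.foldl (fun M u => (D.update u).run M) D.init

/-- The edge relation of the directed graph on the nodes `0, …, n - 1` whose edges are the listed
ordered pairs. -/
def Edge {n : ℕ} (l : List (Fin n × Fin n)) (u v : Fin n) : Prop := (u, v) ∈ l

/-- A legal sequence of edge insertions into the initially empty graph: no edge is inserted twice,
and the graph is acyclic after all insertions (hence at all times). -/
def ValidInsertions {n : ℕ} (l : List (Fin n × Fin n)) : Prop :=
  l.Nodup ∧ ∀ v, ¬ Relation.TransGen (Edge l) v v

/-- There is a directed path (possibly of length zero) from `s` to `t`. -/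
def Reaches {n : ℕ} (l : List (Fin n × Fin n)) (s t : Fin n) : Prop :=
  Relation.ReflTransGen (Edge l) s t

/-- Data structures with the interface of Dynamic Reachability in `n`-node graphs: an update
inserts the edge given by an ordered pair of nodes, a query is an ordered pair `(s, t)` of nodes
and asks whether `s` reaches `t`. -/
abbrev ReachabilityDS (n w : ℕ) : Type :=
  DataStructure w (Fin n × Fin n) (Fin n × Fin n) Bool

/-- After every legal sequence of insertions, every query is answered correctly. -/
def ReachabilityDS.Correct {n w : ℕ} (D : ReachabilityDS n w) : Prop :=
  ∀ l : List (Fin n × Fin n), ValidInsertions l → ∀ s t : Fin n,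
    (D.query (s, t)).eval (D.memory l) = true ↔ Reaches l s t

/-- The worst-case update time is at most `tu`: every insertion of every legal sequence is
processed with at most `tu` cell probes. -/
def ReachabilityDS.UpdateTimeLE {n w : ℕ} (D : ReachabilityDS n w) (tu : ℕ) : Prop :=
  ∀ (l : List (Fin n × Fin n)) (e : Fin n × Fin n), ValidInsertions (l ++ [e]) →
    (D.update e).probes (D.memory l) ≤ tu

/-- The number of probes for the query `q` after the insertions `l`. -/
def ReachabilityDS.queryTime {n w : ℕ} (D : ReachabilityDS n w) (l : List (Fin n × Fin n))
    (q : Fin n × Fin n) : ℕ :=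
  (D.query q).probes (D.memory l)

/-- `D` is a randomized data structure (a deterministic one for each outcome `ω` of the random
coins) for Dynamic Reachability in `n`-node directed acyclic graphs under edge insertions that
never errs, with worst-case update time at most `tu` and expected query time at most `tq`; the
expectation is over the random coins, for every legal sequence of insertions and every query. -/
structure IsDynamicReachabilityDS {n w : ℕ} {Ω : Type*} [MeasurableSpace Ω] (μ : Measure Ω)
    (D : Ω → ReachabilityDS n w) (tu : ℕ) (tq : ℝ≥0) : Prop where
  correct : ∀ᵐ ω ∂μ, (D ω).Correct
  updateTime : ∀ᵐ ω ∂μ, (D ω).UpdateTimeLE tu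
  aemeasurable_queryTime : ∀ l, ValidInsertions l → ∀ q,
    AEMeasurable (fun ω => ((D ω).queryTime l q : ℝ≥0∞)) μ
  queryTime : ∀ l, ValidInsertions l → ∀ q,
    ∫⁻ ω, ((D ω).queryTime l q : ℝ≥0∞) ∂μ ≤ (tq : ℝ≥0∞)

end CellProbe

/-! The hard instance is a union of `ℓ` butterflies of degree `B = a ^ 64` with `a = tu * w`,
inserted one epoch after another. Their depths fall by two per epoch, so later epochs are smaller by
powers of `B`. Every butterfly edge has a random weight in `ZMod M` with `M = 4 * ℓ`, and the graph
nodes carry partial path weights. A source reaches a sink iff in some butterfly the unique path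
between their prefixes has weight zero (`reaches_history_iff`), so at most a quarter of the queries
are positive.

A cell belongs to the epoch of its last change. If an average query makes `T` probes, some epoch of
the first half receives at most `2T/ℓ` of them (`exists_epoch_sum_askHits_le`). Everything but the
input of this epoch is then fixed. Queries are asked in batches: permutations at the switches of the
butterfly route all its `N` sources to sinks along edge-disjoint paths. If `T` is small, then in
some context a quarter of the batches are good: half of the queries are negative, and this is found
with `N * K` probes in total and `N * u` probes to the cells of the epoch (`exists_many_goodBatch`).

Good batches are in fact rare (`sum_card_batch_le`, `sum_card_goodBatch_le`). The product `Ψ` of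
mean-zero functions of the path weights equals `1` whenever the answers in question are all
negative. In the `L`-th moment of a fixed combination of these products, only tuples of batches
survive in which every edge on a path is used by at least two batches; there are few of them
(`sum_pow_sum_batchProd_le`). Because of the `L`-th root, even a combination chosen by a message of
`O(L * N)` bits about the input cannot correlate with `Ψ` (`sum_abs_le_of_messages`).

Such a message can simulate a batch, however. The cells of later epochs fit into it, and the `j`
probed cells of the epoch itself are guessed. Guesses that miss `b > 0` probed cells number at most
`(j + b).choose j` (`card_selfVisited_le`) and get a damping weight `f b`, where `f` is a polynomial
with `f 0 = 1`. The Newton expansion of `f` turns this weight into counts of at most `deg f` further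
cells, which fit into the message too (`guessWeight_eq_sum`). Interpolation at all of `1, …, k`
would need degree `k`; Chebyshev polynomials need only `O(√(k * ρ))` for decay below `exp (-3ρ)`
(`exists_decaying_newton_series`).

With `k = N * K` and `ρ = N * z` the argument works while `√(K * z)` is a small multiple of `ℓ`.
Since `z` is of order `√ℓ` and `K` of order `T`, it refutes every `T` up to a constant times `ℓ ^
(3/2)`. The graph fits into `n` nodes for `ℓ` of order `lg n / lg a`. -/

namespace CellProbe

/-! ### Decision trees on partly revealed memories, and counting memory states. -/

section Trees
variable {w : ℕ}

/-- The set of cells that a query algorithm probes on the memory `M`. -/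
def QueryTree.visited {A : Type} (M : Memory w) : QueryTree w A → Finset (Addr w)
  | .answer _ => ∅
  | .probe addr next => insert addr (QueryTree.visited M (next (M addr)))

theorem QueryTree.card_visited_le {A : Type} (M : Memory w) (t : QueryTree w A) :
    (t.visited M).card ≤ t.probes M := by
  induction t with
  | answer a => simp [QueryTree.visited]
  | probe addr next ih =>
    exact (Finset.card_insert_le _ _).trans (Nat.add_le_add_right (ih _) 1)

theorem QueryTree.visited_congr {A : Type} {M M' : Memory w} (t : QueryTree w A)
    (h : ∀ a ∈ t.visited M, M' a = M a) : t.visited M' = t.visited M := by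
  induction t with
  | answer a => rfl
  | probe addr next ih =>
    have h0 : M' addr = M addr := h addr (Finset.mem_insert_self _ _)
    simp only [QueryTree.visited, h0]
    rw [ih (M addr) fun a ha => h a (Finset.mem_insert_of_mem ha)]

theorem QueryTree.eval_congr {A : Type} {M M' : Memory w} (t : QueryTree w A)
    (h : ∀ a ∈ t.visited M, M' a = M a) : t.eval M' = t.eval M := by
  induction t with
  | answer a => rfl
  | probe addr next ih =>
    have h0 : M' addr = M addr := h addr (Finset.mem_insert_self _ _)
    simp only [QueryTree.eval, h0]
    rw [ih (M addr) fun a ha => h a (Finset.mem_insert_of_mem ha)]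

/-- Run the first algorithm, and the second one if the first one answers `false`. -/
def QueryTree.orElse : QueryTree w Bool → QueryTree w Bool → QueryTree w Bool
  | .answer true, _ => .answer true
  | .answer false, u => u
  | .probe addr next, u => .probe addr fun x => (next x).orElse u

theorem QueryTree.eval_orElse (M : Memory w) (t u : QueryTree w Bool) :
    (t.orElse u).eval M = (t.eval M || u.eval M) := by
  induction t with
  | answer a => cases a <;> simp [QueryTree.orElse, QueryTree.eval]
  | probe addr next ih => simpa [QueryTree.orElse, QueryTree.eval] using ih _

theorem QueryTree.visited_orElse_subset (M : Memory w) (t u : QueryTree w Bool) :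
    (t.orElse u).visited M ⊆ t.visited M ∪ u.visited M := by
  induction t with
  | answer a => cases a <;> simp [QueryTree.orElse, QueryTree.visited]
  | probe addr next ih =>
    simp only [QueryTree.orElse, QueryTree.visited, Finset.insert_union]
    exact Finset.insert_subset_insert _ (ih _)

/-- Run the listed algorithms one after another until one of them answers `true`. -/
def QueryTree.any (l : List (QueryTree w Bool)) : QueryTree w Bool :=
  l.foldr QueryTree.orElse (.answer false)

theorem QueryTree.eval_any_eq_false (M : Memory w) (l : List (QueryTree w Bool)) :
    (QueryTree.any l).eval M = false ↔ ∀ t ∈ l, t.eval M = false := by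
  induction l with
  | nil => simp [QueryTree.any, QueryTree.eval]
  | cons t l ih =>
    have : QueryTree.any (t :: l) = t.orElse (QueryTree.any l) := rfl
    rw [this, QueryTree.eval_orElse, Bool.or_eq_false_iff, ih]
    simp

theorem QueryTree.exists_of_mem_visited_any (M : Memory w) (l : List (QueryTree w Bool))
    {a : Addr w} (ha : a ∈ (QueryTree.any l).visited M) : ∃ t ∈ l, a ∈ t.visited M := by
  induction l with
  | nil => simp [QueryTree.any, QueryTree.visited] at ha
  | cons t l ih =>
    have h := QueryTree.visited_orElse_subset M t (QueryTree.any l) ha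
    rcases Finset.mem_union.1 h with h | h
    · exact ⟨t, by simp, h⟩
    · obtain ⟨u, hu, hu'⟩ := ih h
      exact ⟨u, by simp [hu], hu'⟩

/-- The memory `m₀` with the contents of the cells in `G` replaced by those of `m₁`. -/
def patch (m₀ m₁ : Memory w) (G : Finset (Addr w)) : Memory w :=
  fun a => if a ∈ G then m₁ a else m₀ a

/-- The number of sets `G` of `j` cells in `C` such that a query algorithm sees all of `G` and
exactly `b` other cells of `C` if `G` is the set of the updated cells. -/
theorem card_selfVisited_le {A : Type} (t : QueryTree w A) (m₀ m₁ : Memory w)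
    (C G₀ H₀ : Finset (Addr w)) (j b : ℕ) :
    (C.powerset.filter fun G => G₀ ⊆ G ∧ Disjoint G H₀ ∧
      G ⊆ G₀ ∪ t.visited (patch m₀ m₁ G) ∧ (G \ G₀).card = j ∧
      ((t.visited (patch m₀ m₁ G) ∩ C) \ (G ∪ H₀)).card = b).card ≤ (j + b).choose j := by
  -- `G₀` and `H₀` hold the cells of `C` already probed and known to lie inside and outside `G`. A
  -- new cell of `C` branches on membership in `G`, and either branch fixes the contents read. One
  -- branch lowers `j`, the other lowers `b`, which is Pascal's recursion.
  induction t generalizing G₀ H₀ j b with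
  | answer a =>
    have h1 : 1 ≤ (j + b).choose j := Nat.choose_pos (Nat.le_add_right j b)
    refine le_trans ?_ h1
    refine (Finset.card_le_card (t := {G₀}) fun G hG => ?_).trans (by simp)
    simp only [Finset.mem_filter, QueryTree.visited, Finset.union_empty] at hG
    simp [Finset.Subset.antisymm hG.2.2.2.1 hG.2.1]
  | probe a next ih =>
    by_cases h1 : a ∈ G₀
    · refine (Finset.card_le_card fun G hG => ?_).trans (ih (m₁ a) G₀ H₀ j b)
      simp only [Finset.mem_filter, Finset.mem_powerset] at hG ⊢
      obtain ⟨hGC, hG0, hH, hsub, hj, hb⟩ := hG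
      have haG : a ∈ G := hG0 h1
      have hp : patch m₀ m₁ G a = m₁ a := by simp [patch, haG]
      simp only [QueryTree.visited, hp] at hsub hb
      refine ⟨hGC, hG0, hH, ?_, hj, ?_⟩
      · intro y hy
        have := hsub hy
        grind
      · rw [← hb]; congr 1; grind
    by_cases h2 : a ∈ C ∧ a ∉ H₀
    · obtain ⟨haC, haH⟩ := h2
      rw [← Finset.card_filter_add_card_filter_not (fun G => a ∈ G)]
      have hfirst : ∀ j', j = j' + 1 → ((C.powerset.filter fun G => G₀ ⊆ G ∧ Disjoint G H₀ ∧
          G ⊆ G₀ ∪ (QueryTree.probe a next).visited (patch m₀ m₁ G) ∧ (G \ G₀).card = j ∧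
          (((QueryTree.probe a next).visited (patch m₀ m₁ G) ∩ C) \ (G ∪ H₀)).card = b).filter
          fun G => a ∈ G).card ≤ (j' + b).choose j' := by
        intro j' hj'
        refine (Finset.card_le_card fun G hG => ?_).trans (ih (m₁ a) (insert a G₀) H₀ j' b)
        simp only [Finset.mem_filter, Finset.mem_powerset] at hG ⊢
        obtain ⟨⟨hGC, hG0, hH, hsub, hj, hb⟩, haG⟩ := hG
        have hp : patch m₀ m₁ G a = m₁ a := by simp [patch, haG]
        simp only [QueryTree.visited, hp] at hsub hb
        refine ⟨hGC, Finset.insert_subset haG hG0, hH, ?_, ?_, ?_⟩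
        · intro y hy
          have := hsub hy
          grind
        · have : G \ G₀ = insert a (G \ insert a G₀) := by grind
          rw [this, Finset.card_insert_of_notMem (by grind)] at hj
          omega
        · rw [← hb]; congr 1; grind
      have hfirst0 : j = 0 → ((C.powerset.filter fun G => G₀ ⊆ G ∧ Disjoint G H₀ ∧
          G ⊆ G₀ ∪ (QueryTree.probe a next).visited (patch m₀ m₁ G) ∧ (G \ G₀).card = j ∧
          (((QueryTree.probe a next).visited (patch m₀ m₁ G) ∩ C) \ (G ∪ H₀)).card = b).filter
          fun G => a ∈ G).card = 0 := by
        intro hj0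
        rw [Finset.card_eq_zero, Finset.filter_eq_empty_iff]
        intro G hG haG
        simp only [Finset.mem_filter, hj0, Finset.card_eq_zero] at hG
        have : a ∈ G \ G₀ := by grind
        simp [hG.2.2.2.2.1] at this
      have hsecond : ∀ b', b = b' + 1 → ((C.powerset.filter fun G => G₀ ⊆ G ∧ Disjoint G H₀ ∧
          G ⊆ G₀ ∪ (QueryTree.probe a next).visited (patch m₀ m₁ G) ∧ (G \ G₀).card = j ∧
          (((QueryTree.probe a next).visited (patch m₀ m₁ G) ∩ C) \ (G ∪ H₀)).card = b).filter
          fun G => ¬ a ∈ G).card ≤ (j + b').choose j := by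
        intro b' hb'
        refine (Finset.card_le_card fun G hG => ?_).trans (ih (m₀ a) G₀ (insert a H₀) j b')
        simp only [Finset.mem_filter, Finset.mem_powerset] at hG ⊢
        obtain ⟨⟨hGC, hG0, hH, hsub, hj, hb⟩, haG⟩ := hG
        have hp : patch m₀ m₁ G a = m₀ a := by simp [patch, haG]
        simp only [QueryTree.visited, hp] at hsub hb
        refine ⟨hGC, hG0, ?_, ?_, hj, ?_⟩
        · simp [haG, hH]
        · intro y hy
          have := hsub hy
          grind
        · have : (insert a ((next (m₀ a)).visited (patch m₀ m₁ G)) ∩ C) \ (G ∪ H₀) =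
              insert a (((next (m₀ a)).visited (patch m₀ m₁ G) ∩ C) \ (G ∪ insert a H₀)) := by
            grind
          rw [this, Finset.card_insert_of_notMem (by grind)] at hb
          omega
      have hsecond0 : b = 0 → ((C.powerset.filter fun G => G₀ ⊆ G ∧ Disjoint G H₀ ∧
          G ⊆ G₀ ∪ (QueryTree.probe a next).visited (patch m₀ m₁ G) ∧ (G \ G₀).card = j ∧
          (((QueryTree.probe a next).visited (patch m₀ m₁ G) ∩ C) \ (G ∪ H₀)).card = b).filter
          fun G => ¬ a ∈ G).card = 0 := by
        intro hb0
        rw [Finset.card_eq_zero, Finset.filter_eq_empty_iff]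
        intro G hG haG
        simp only [Finset.mem_filter, hb0, Finset.card_eq_zero] at hG
        have : a ∈ ((QueryTree.probe a next).visited (patch m₀ m₁ G) ∩ C) \ (G ∪ H₀) := by
          simp [QueryTree.visited, haC, haG, haH]
        simp [hG.2.2.2.2.2] at this
      rcases j with _ | j'
      · rw [hfirst0 rfl]
        rcases b with _ | b'
        · rw [hsecond0 rfl]; simp
        · simpa using hsecond b' rfl
      · rcases b with _ | b'
        · rw [hsecond0 rfl]
          simpa using hfirst j' rfl
        · refine (add_le_add (hfirst j' rfl) (hsecond b' rfl)).trans (le_of_eq ?_)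
          have h3 : j' + 1 + (b' + 1) = (j' + (b' + 1)) + 1 := by ring
          have h4 : j' + 1 + b' = j' + (b' + 1) := by ring
          rw [h3, Nat.choose_succ_succ, h4]
    · refine (Finset.card_le_card fun G hG => ?_).trans (ih (m₀ a) G₀ H₀ j b)
      simp only [Finset.mem_filter, Finset.mem_powerset] at hG ⊢
      obtain ⟨hGC, hG0, hH, hsub, hj, hb⟩ := hG
      have haG : a ∉ G := by
        intro haG
        exact h2 ⟨hGC haG, Finset.disjoint_left.1 hH haG⟩
      have hp : patch m₀ m₁ G a = m₀ a := by simp [patch, haG]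
      simp only [QueryTree.visited, hp] at hsub hb
      refine ⟨hGC, hG0, hH, ?_, hj, ?_⟩
      · intro y hy
        have := hsub hy
        grind
      · rw [← hb]; congr 1; grind

/-- The cells in which two memory states differ. -/
def diffCells (m m' : Memory w) : Finset (Addr w) :=
  Finset.univ.filter fun a => m' a ≠ m a

theorem mem_diffCells {m m' : Memory w} {a : Addr w} : a ∈ diffCells m m' ↔ m' a ≠ m a := by
  simp [diffCells]

/-- The memory states that differ from `m` in at most `K` cells. -/
def memoryBall (m : Memory w) (K : ℕ) : Finset (Memory w) :=
  Finset.univ.filter fun m' => (diffCells m m').card ≤ K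

/-- Restoring one changed cell decreases the radius by one, and the way back is described by an
address and a contents, with `2 ^ w` choices each. -/
theorem card_memoryBall_le (m : Memory w) (K : ℕ) :
    (memoryBall m K).card ≤ (2 ^ w * 2 ^ w) ^ K := by
  induction K with
  | zero =>
    have : memoryBall m 0 ⊆ {m} := by
      intro m' hm'
      simp only [memoryBall, diffCells, Finset.mem_filter, Finset.mem_univ, true_and,
        Nat.le_zero, Finset.card_eq_zero, Finset.filter_eq_empty_iff, not_not] at hm'
      simp only [Finset.mem_singleton]
      funext a
      exact hm' trivial
    simpa using Finset.card_le_card this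
  | succ K ih =>
    have hpos : 0 < 2 ^ w := by positivity
    have hsub : memoryBall m (K + 1) ⊆
        ((memoryBall m K) ×ˢ (Finset.univ : Finset (Addr w × Cell w))).image
          fun p => Function.update p.1 p.2.1 p.2.2 := by
      intro m' hm'
      simp only [memoryBall, Finset.mem_filter, Finset.mem_univ, true_and] at hm'
      simp only [Finset.mem_image, Finset.mem_product, Finset.mem_univ, and_true]
      rcases (diffCells m m').eq_empty_or_nonempty with h | ⟨a, ha⟩
      · refine ⟨(m', (⟨0, hpos⟩, m' ⟨0, hpos⟩)), ?_, by simp⟩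
        simp [memoryBall, h]
      · refine ⟨(Function.update m' a (m a), (a, m' a)), ?_, by simp⟩
        simp only [memoryBall, Finset.mem_filter, Finset.mem_univ, true_and]
        have h2 : diffCells m (Function.update m' a (m a)) ⊆ (diffCells m m').erase a := by
          intro y hy
          rw [mem_diffCells] at hy
          rw [Finset.mem_erase, mem_diffCells]
          by_cases hya : y = a
          · subst hya; simp at hy
          · rw [Function.update_of_ne hya] at hy
            exact ⟨hya, hy⟩
        have h3 := Finset.card_le_card h2
        rw [Finset.card_erase_of_mem ha] at h3
        omega
    calc _ ≤ _ := Finset.card_le_card hsub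
      _ ≤ _ := Finset.card_image_le
      _ = (memoryBall m K).card * (2 ^ w * 2 ^ w) := by
          rw [Finset.card_product, Finset.card_univ, Fintype.card_prod]
          simp
      _ ≤ (2 ^ w * 2 ^ w) ^ K * (2 ^ w * 2 ^ w) := Nat.mul_le_mul_right _ ih
      _ = _ := (pow_succ _ _).symm

theorem UpdateTree.card_diffCells_run_le (u : UpdateTree w) (m : Memory w) :
    (diffCells m (u.run m)).card ≤ u.probes m := by
  induction u generalizing m with
  | halt => simp [UpdateTree.run, UpdateTree.probes, diffCells]
  | probe addr write next ih =>
    simp only [UpdateTree.run, UpdateTree.probes]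
    refine le_trans ?_ (Nat.add_le_add_right (ih (m addr) _) 1)
    refine (Finset.card_le_card ?_).trans (Finset.card_insert_le addr _)
    intro a ha
    rw [mem_diffCells] at ha
    rw [Finset.mem_insert, mem_diffCells]
    by_cases h : a = addr
    · exact Or.inl h
    · right
      rwa [Function.update_of_ne h]

end Trees

/-! ### Simulating the queries of one epoch from short messages. -/

section Epoch
variable {w : ℕ} {X S : Type} [Fintype X] [Fintype S]

/-- The algorithm answers `false` after probing at most `k` different cells, including those of
`E`. -/
def Certifies (t : QueryTree w Bool) (k : ℕ) (m : Memory w) (E : Finset (Addr w)) : Prop :=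
  t.eval m = false ∧ (t.visited m).card ≤ k ∧ E ⊆ t.visited m

/-- The power mean inequality without division, so that the empty sum is included. -/
theorem sum_pow_le_card_pow_mul {ι : Type*} (s : Finset ι) (f : ι → ℝ) (hf : ∀ i ∈ s, 0 ≤ f i)
    {L : ℕ} (hL : L ≠ 0) : (∑ i ∈ s, f i) ^ L ≤ (s.card : ℝ) ^ (L - 1) * ∑ i ∈ s, f i ^ L := by
  obtain ⟨n, rfl⟩ := Nat.exists_eq_succ_of_ne_zero hL
  rcases s.eq_empty_or_nonempty with rfl | hs
  · simp
  have h := pow_sum_div_card_le_sum_pow hf n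
  have hc : (0 : ℝ) < (s.card : ℝ) ^ n := by
    have : 0 < s.card := hs.card_pos
    positivity
  rw [div_le_iff₀ hc] at h
  simpa [mul_comm] using h

open Classical in
/-- If a bounded number of messages is consistent with every input, then messages cannot help to
predict `Ψ` when all fixed predictors fail. -/
theorem sum_abs_le_of_messages {μ : Type} (msgs : Finset μ) (h : μ → S → ℝ) (Ψ : S → X → ℝ)
    (L : ℕ) (hL : L ≠ 0) (hev : Even L) (Q Y : ℝ) (hY0 : 0 ≤ Y)
    (hQ : ∀ m ∈ msgs, ∑ x, (∑ s, h m s * Ψ s x) ^ L ≤ Q)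
    (hY : (Fintype.card X : ℝ) ^ (L - 1) * (msgs.card * Q) ≤ Y ^ L)
    {ι : X → Type} (I : ∀ x, Finset (ι x)) (msg : ∀ x, ι x → μ) (hmsg : ∀ x, ∀ i ∈ I x, msg x i ∈ msgs)
    (W : ℝ) (hW0 : 0 ≤ W) (hW : ∀ x, ((I x).card : ℝ) ≤ W) :
    |∑ x, ∑ i ∈ I x, ∑ s, h (msg x i) s * Ψ s x| ≤ W * Y := by
  -- `Z x` is an `L`-norm over all messages. It dominates the correlation for each of them, so the
  -- message may depend on `x`; the number of messages enters only through its `L`-th root.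
  set Z : X → ℝ := fun x => (∑ m ∈ msgs, (∑ s, h m s * Ψ s x) ^ L) ^ ((L : ℝ)⁻¹) with hZ
  have hsum0 : ∀ x, 0 ≤ ∑ m ∈ msgs, (∑ s, h m s * Ψ s x) ^ L := fun x =>
    Finset.sum_nonneg fun m _ => hev.pow_nonneg _
  have hZ0 : ∀ x, 0 ≤ Z x := fun x => Real.rpow_nonneg (hsum0 x) _
  have hZL : ∀ x, Z x ^ L = ∑ m ∈ msgs, (∑ s, h m s * Ψ s x) ^ L := fun x =>
    Real.rpow_inv_natCast_pow (hsum0 x) hL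
  have hle : ∀ x, ∀ m ∈ msgs, |∑ s, h m s * Ψ s x| ≤ Z x := by
    intro x m hm
    refine le_of_pow_le_pow_left₀ hL (hZ0 x) ?_
    rw [hZL, hev.pow_abs]
    exact Finset.single_le_sum (f := fun m => (∑ s, h m s * Ψ s x) ^ L)
      (fun m _ => hev.pow_nonneg _) hm
  have hZY : ∑ x, Z x ≤ Y := by
    refine le_of_pow_le_pow_left₀ hL hY0 ?_
    refine (sum_pow_le_card_pow_mul _ _ (fun x _ => hZ0 x) hL).trans (le_trans ?_ hY)
    rw [Finset.card_univ]
    gcongr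
    simp_rw [hZL]
    rw [Finset.sum_comm]
    refine (Finset.sum_le_sum hQ).trans ?_
    simp
  calc |∑ x, ∑ i ∈ I x, ∑ s, h (msg x i) s * Ψ s x|
      ≤ ∑ x, W * Z x := by
        refine (Finset.abs_sum_le_sum_abs _ _).trans (Finset.sum_le_sum fun x _ => ?_)
        refine (Finset.abs_sum_le_sum_abs _ _).trans ?_
        calc _ ≤ ∑ i ∈ I x, Z x := Finset.sum_le_sum fun i hi => hle x _ (hmsg x i hi)
          _ = (I x).card * Z x := by simp
          _ ≤ W * Z x := mul_le_mul_of_nonneg_right (hW x) (hZ0 x)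
    _ = W * ∑ x, Z x := by rw [Finset.mul_sum]
    _ ≤ W * Y := mul_le_mul_of_nonneg_left hZY hW0

open Classical in
/-- The weighted number of guesses `G` of the updated cells that lead to a certificate. -/
noncomputable def guessWeight (t : QueryTree w Bool) (k j : ℕ) (f : ℕ → ℝ) (m₀ m₁ : Memory w)
    (C : Finset (Addr w)) : ℝ :=
  ∑ G ∈ C.powersetCard j, if Certifies t k (patch m₀ m₁ G) G then
    f ((t.visited (patch m₀ m₁ G) ∩ C) \ G).card else 0

open Classical in
theorem card_certifying_le (t : QueryTree w Bool) (k j b : ℕ) (m₀ m₁ : Memory w)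
    (C : Finset (Addr w)) :
    ((C.powersetCard j).filter fun G => Certifies t k (patch m₀ m₁ G) G ∧
      ((t.visited (patch m₀ m₁ G) ∩ C) \ G).card = b).card ≤ (j + b).choose j := by
  refine (Finset.card_le_card fun G hG => ?_).trans (card_selfVisited_le t m₀ m₁ C ∅ ∅ j b)
  simp only [Finset.mem_filter, Finset.mem_powersetCard, Finset.mem_powerset] at hG ⊢
  obtain ⟨⟨hGC, hj⟩, ⟨-, -, hsub⟩, hb⟩ := hG
  exact ⟨hGC, by simp, by simp, by simpa using hsub, by simpa using hj, by simpa using hb⟩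

-- A guess that misses no probed cell of `C` reproduces the true run, so `ψ = 1` and its
-- contribution is `f 0 = 1`; the true set `t.visited m₁ ∩ C` is such a guess if the indicator is
-- `1`. Guesses that miss `b ≥ 1` cells may contribute with the wrong sign, but `card_certifying_le`
-- bounds their number and `f b` damps them.
open Classical in
theorem le_mul_guessWeight (t : QueryTree w Bool) (k j : ℕ) (f : ℕ → ℝ) (hf : f 0 = 1)
    (m₀ m₁ : Memory w) (C : Finset (Addr w)) (hC : ∀ a ∉ C, m₁ a = m₀ a) (ψ Mx : ℝ)
    (hψ : |ψ| ≤ Mx) (hψ1 : t.eval m₁ = false → ψ = 1) :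
    (if t.eval m₁ = false ∧ (t.visited m₁).card ≤ k ∧ (t.visited m₁ ∩ C).card = j
      then (1 : ℝ) else 0) - Mx * ∑ b ∈ Finset.Icc 1 k, ((j + b).choose j : ℝ) * |f b| ≤
    ψ * guessWeight t k j f m₀ m₁ C := by
  set B : Finset (Addr w) → ℕ := fun G => ((t.visited (patch m₀ m₁ G) ∩ C) \ G).card with hB
  set F := (C.powersetCard j).filter fun G => Certifies t k (patch m₀ m₁ G) G with hF
  have hMx : 0 ≤ Mx := (abs_nonneg _).trans hψ
  have hagree : ∀ G, B G = 0 → ∀ a ∈ t.visited (patch m₀ m₁ G), m₁ a = patch m₀ m₁ G a := by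
    intro G hG a ha
    by_cases haG : a ∈ G
    · simp [patch, haG]
    · simp only [patch, haG, if_false]
      refine hC a fun haC => ?_
      have : a ∈ (t.visited (patch m₀ m₁ G) ∩ C) \ G := by simp [ha, haC, haG]
      rw [Finset.card_eq_zero.1 hG] at this
      simp at this
  have hweight : guessWeight t k j f m₀ m₁ C = ∑ G ∈ F, f (B G) := by
    rw [guessWeight, hF, Finset.sum_filter]
  have hterm : ∀ G ∈ F, (if B G = 0 then (1 : ℝ) else 0) -
      Mx * (if B G = 0 then 0 else |f (B G)|) ≤ ψ * f (B G) := by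
    intro G hG
    by_cases h0 : B G = 0
    · have h1 : t.eval m₁ = false := by
        rw [QueryTree.eval_congr t (hagree G h0)]
        exact (Finset.mem_filter.1 hG).2.1
      simp [h0, hψ1 h1, hf]
    · simp only [h0, if_false]
      have h1 : |ψ * f (B G)| ≤ Mx * |f (B G)| := by
        rw [abs_mul]; gcongr
      linarith [neg_abs_le (ψ * f (B G))]
  have hone : (if t.eval m₁ = false ∧ (t.visited m₁).card ≤ k ∧ (t.visited m₁ ∩ C).card = j
      then (1 : ℝ) else 0) ≤ ∑ G ∈ F, (if B G = 0 then (1 : ℝ) else 0) := by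
    split_ifs with h
    · obtain ⟨h1, h2, h3⟩ := h
      set G := t.visited m₁ ∩ C with hG
      have hp : ∀ a ∈ t.visited m₁, patch m₀ m₁ G a = m₁ a := by
        intro a ha
        by_cases haC : a ∈ C
        · simp [patch, hG, ha, haC]
        · simp [patch, hG, haC, hC a haC]
      have hv := QueryTree.visited_congr t hp
      have he := QueryTree.eval_congr t hp
      have hGF : G ∈ F := by
        rw [hF, Finset.mem_filter, Finset.mem_powersetCard]
        refine ⟨⟨Finset.inter_subset_right, h3⟩, by rw [he]; exact h1, by rw [hv]; exact h2, ?_⟩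
        rw [hv]
        exact Finset.inter_subset_left
      have hBG : B G = 0 := by
        change ((t.visited (patch m₀ m₁ G) ∩ C) \ G).card = 0
        rw [hv, ← hG, sdiff_self]
        rfl
      have := Finset.single_le_sum (f := fun G => (if B G = 0 then (1 : ℝ) else 0))
        (fun G _ => by split_ifs <;> norm_num) hGF
      simpa [hBG] using this
    · exact Finset.sum_nonneg fun G _ => by split_ifs <;> norm_num
  have herr : ∑ G ∈ F, (if B G = 0 then 0 else |f (B G)|) ≤
      ∑ b ∈ Finset.Icc 1 k, ((j + b).choose j : ℝ) * |f b| := by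
    have hmaps : ∀ G ∈ F.filter (fun G => B G ≠ 0), B G ∈ Finset.Icc 1 k := by
      intro G hG
      rw [Finset.mem_filter] at hG
      rw [Finset.mem_Icc]
      refine ⟨Nat.one_le_iff_ne_zero.2 hG.2, ?_⟩
      refine le_trans (Finset.card_le_card ?_) (Finset.mem_filter.1 hG.1).2.2.1
      exact Finset.sdiff_subset.trans Finset.inter_subset_left
    calc ∑ G ∈ F, (if B G = 0 then 0 else |f (B G)|)
        = ∑ G ∈ F.filter (fun G => B G ≠ 0), |f (B G)| := by
          rw [Finset.sum_filter (fun G => B G ≠ 0)]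
          exact Finset.sum_congr rfl fun G _ => by by_cases h : B G = 0 <;> simp [h]
      _ = ∑ b ∈ Finset.Icc 1 k, ∑ G ∈ (F.filter (fun G => B G ≠ 0)).filter (fun G => B G = b),
            |f (B G)| := (Finset.sum_fiberwise_of_maps_to hmaps _).symm
      _ ≤ _ := by
          refine Finset.sum_le_sum fun b _ => ?_
          have h1 : ∑ G ∈ (F.filter (fun G => B G ≠ 0)).filter (fun G => B G = b), |f (B G)| =
              ((F.filter (fun G => B G ≠ 0)).filter (fun G => B G = b)).card * |f b| := by
            rw [Finset.sum_congr rfl (g := fun _ => |f b|)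
              (fun G hG => by rw [(Finset.mem_filter.1 hG).2])]
            simp
          rw [h1]
          gcongr
          refine (Finset.card_le_card fun G hG => ?_).trans (card_certifying_le t k j b m₀ m₁ C)
          simp only [hF, Finset.mem_filter] at hG ⊢
          exact ⟨hG.1.1.1, hG.1.1.2, hG.2⟩
  have hsum := Finset.sum_le_sum hterm
  rw [Finset.sum_sub_distrib, ← Finset.mul_sum, ← Finset.mul_sum] at hsum
  rw [hweight]
  have := mul_le_mul_of_nonneg_left herr hMx
  linarith

-- Here `b.choose δ` counts the sets `T` of `δ` missed cells. The number `b` itself depends on all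
-- of `C`, whereas each summand on the right is determined by a patched memory and the set `p.1 ∪
-- p.2`, and these fit into a message.
open Classical in
theorem guessWeight_eq_sum (t : QueryTree w Bool) (k j D : ℕ) (c : ℕ → ℝ) (m₀ m₁ : Memory w)
    (C : Finset (Addr w)) :
    guessWeight t k j (fun b => ∑ δ ∈ Finset.range (D + 1), c δ * (b.choose δ : ℝ)) m₀ m₁ C =
    ∑ δ ∈ Finset.range (D + 1), c δ *
      ∑ p ∈ (C.powersetCard j).sigma fun G => (C \ G).powersetCard δ,
        if Certifies t k (patch m₀ m₁ p.1) (p.1 ∪ p.2) then (1 : ℝ) else 0 := by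
  simp_rw [guessWeight, Finset.sum_sigma, Finset.mul_sum]
  rw [Finset.sum_comm]
  refine Finset.sum_congr rfl fun G _ => ?_
  by_cases h : Certifies t k (patch m₀ m₁ G) G
  · rw [if_pos h]
    refine Finset.sum_congr rfl fun δ _ => ?_
    rw [← Finset.mul_sum, Finset.sum_boole]
    congr 2
    rw [← Finset.card_powersetCard]
    congr 1
    ext T
    simp only [Finset.mem_filter, Finset.mem_powersetCard]
    obtain ⟨h1, h2, h3⟩ := h
    constructor
    · rintro ⟨hT, hc⟩
      refine ⟨⟨fun a ha => ?_, hc⟩, h1, h2, Finset.union_subset h3 fun a ha => ?_⟩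
      · have := hT ha
        simp only [Finset.mem_sdiff, Finset.mem_inter] at this ⊢
        exact ⟨this.1.2, this.2⟩
      · have := hT ha
        simp only [Finset.mem_sdiff, Finset.mem_inter] at this
        exact this.1.1
    · rintro ⟨⟨hT, hc⟩, -, -, hu⟩
      refine ⟨fun a ha => ?_, hc⟩
      have := hT ha
      simp only [Finset.mem_sdiff, Finset.mem_inter] at this ⊢
      exact ⟨⟨hu (Finset.mem_union_right _ ha), this.1⟩, this.2⟩
  · rw [if_neg h]
    symm
    refine Finset.sum_eq_zero fun δ _ => Finset.sum_eq_zero fun T _ => ?_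
    rw [if_neg, mul_zero]
    rintro ⟨h1, h2, h3⟩
    exact h ⟨h1, h2, Finset.union_subset_left h3⟩

open Classical in
/-- If no fixed combination of the functions `Ψ s` has a large moment, then few query algorithms
`t s` answer `false` with few probes to the cells `C x` that hold the information on `x`. -/
theorem sum_card_certified_le (t : S → QueryTree w Bool) (pre : Memory w) (fin : X → Memory w)
    (later C : X → Finset (Addr w)) (hpre : ∀ x, ∀ a, a ∉ later x → a ∉ C x → fin x a = pre a)
    (K₀ Ct : ℕ) (hK₀ : ∀ x, (later x).card ≤ K₀) (hCt : ∀ x, (C x).card ≤ Ct)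
    (Ψ : S → X → ℝ) (Mx : ℝ) (hΨ : ∀ s x, |Ψ s x| ≤ Mx)
    (hΨ1 : ∀ s x, (t s).eval (fin x) = false → Ψ s x = 1)
    (L : ℕ) (hL : L ≠ 0) (hev : Even L) (Q Y : ℝ) (hY0 : 0 ≤ Y)
    (hmoment : ∀ h : S → ℝ, (∀ s, |h s| ≤ 1) → ∑ x, (∑ s, h s * Ψ s x) ^ L ≤ Q)
    (k j D : ℕ) (c : ℕ → ℝ) (hc : ∑ δ ∈ Finset.range (D + 1), c δ * (Nat.choose 0 δ : ℝ) = 1)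
    (hY : (Fintype.card X : ℝ) ^ (L - 1) * (2 ^ (w * (2 * K₀ + 3 * j + D)) * Q) ≤ Y ^ L) :
    ((∑ s, (Finset.univ.filter fun x => (t s).eval (fin x) = false ∧
      ((t s).visited (fin x)).card ≤ k ∧ ((t s).visited (fin x) ∩ C x).card = j).card : ℕ) : ℝ) ≤
    Fintype.card S * Fintype.card X * (Mx * ∑ b ∈ Finset.Icc 1 k, ((j + b).choose j : ℝ) *
      |∑ δ ∈ Finset.range (D + 1), c δ * (b.choose δ : ℝ)|) +
    (∑ δ ∈ Finset.range (D + 1), |c δ| * (Ct.choose j * Ct.choose δ)) * Y := by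
  set f : ℕ → ℝ := fun b => ∑ δ ∈ Finset.range (D + 1), c δ * (b.choose δ : ℝ) with hf
  -- What is known without the cells of `C x`: the memory before the epoch, corrected in the cells
  -- that change later.
  set m₀ : X → Memory w := fun x => patch pre (fin x) (later x) with hm₀
  set err := Mx * ∑ b ∈ Finset.Icc 1 k, ((j + b).choose j : ℝ) * |f b| with herr
  have hQ0 : 0 ≤ Q := by
    have := hmoment (fun _ => 0) (by simp)
    simpa [hL] using this
  have hlow : ∀ s x, (if (t s).eval (fin x) = false ∧ ((t s).visited (fin x)).card ≤ k ∧
      ((t s).visited (fin x) ∩ C x).card = j then (1 : ℝ) else 0) - err ≤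
      Ψ s x * guessWeight (t s) k j f (m₀ x) (fin x) (C x) := by
    intro s x
    refine le_mul_guessWeight (t s) k j f hc (m₀ x) (fin x) (C x) (fun a ha => ?_) _ _ (hΨ s x)
      (hΨ1 s x)
    by_cases h : a ∈ later x
    · simp [hm₀, patch, h]
    · simp [hm₀, patch, h, hpre x a h ha]
  have hup : ∀ δ ∈ Finset.range (D + 1),
      |∑ x, ∑ p ∈ ((C x).powersetCard j).sigma fun G => (C x \ G).powersetCard δ,
        ∑ s, (if Certifies (t s) k (patch (m₀ x) (fin x) p.1) (p.1 ∪ p.2) then (1 : ℝ) else 0) *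
          Ψ s x| ≤ (Ct.choose j * Ct.choose δ) * Y := by
    intro δ hδ
    have hδD : δ ≤ D := by have := Finset.mem_range.1 hδ; omega
    refine sum_abs_le_of_messages
      (memoryBall pre (K₀ + j) ×ˢ (Finset.univ : Finset (Addr w)).powersetCard (j + δ))
      (fun m s => if Certifies (t s) k m.1 m.2 then (1 : ℝ) else 0) Ψ L hL hev Q Y hY0 ?_ ?_
      (fun x => ((C x).powersetCard j).sigma fun G => (C x \ G).powersetCard δ)
      (fun x p => (patch (m₀ x) (fin x) p.1, p.1 ∪ p.2)) ?_ _ (by positivity) ?_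
    · intro m _
      exact hmoment _ fun s => by split_ifs <;> simp
    · refine le_trans ?_ hY
      gcongr
      rw [Finset.card_product, Finset.card_powersetCard, Finset.card_univ, Fintype.card_fin]
      -- An address and a contents (`2 * w` bits) for each of `K₀ + j` changed cells, and an address
      -- for each of the `j + δ` cells that have to be visited.
      have h1 : (memoryBall pre (K₀ + j)).card * (2 ^ w).choose (j + δ) ≤
          2 ^ (w * (2 * K₀ + 3 * j + D)) := by
        calc _ ≤ (2 ^ w * 2 ^ w) ^ (K₀ + j) * (2 ^ w) ^ (j + δ) :=
              Nat.mul_le_mul (card_memoryBall_le _ _) (Nat.choose_le_pow _ _)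
          _ = 2 ^ (w * (2 * K₀ + 3 * j + δ)) := by ring
          _ ≤ _ := by gcongr; norm_num
      exact_mod_cast h1
    · rintro x ⟨G, T⟩ hp
      simp only [Finset.mem_sigma, Finset.mem_powersetCard] at hp
      obtain ⟨⟨hG, hGj⟩, hT, hTδ⟩ := hp
      simp only [Finset.mem_product, Finset.mem_powersetCard, memoryBall, Finset.mem_filter,
        Finset.mem_univ, true_and]
      refine ⟨?_, Finset.subset_univ _, ?_⟩
      · have : diffCells pre (patch (m₀ x) (fin x) G) ⊆ later x ∪ G := by
          intro a ha
          rw [mem_diffCells] at ha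
          by_contra h
          rw [Finset.mem_union, not_or] at h
          simp [patch, hm₀, h.1, h.2] at ha
        calc _ ≤ _ := Finset.card_le_card this
          _ ≤ _ := Finset.card_union_le _ _
          _ ≤ K₀ + j := by rw [hGj]; exact Nat.add_le_add_right (hK₀ x) _
      · rw [Finset.card_union_of_disjoint, hGj, hTδ]
        exact Finset.disjoint_left.2 fun a ha hb => (Finset.mem_sdiff.1 (hT hb)).2 ha
    · intro x
      rw [Finset.card_sigma]
      have h1 : ∑ G ∈ (C x).powersetCard j, ((C x \ G).powersetCard δ).card ≤
          Ct.choose j * Ct.choose δ := by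
        calc _ ≤ ∑ G ∈ (C x).powersetCard j, Ct.choose δ := by
              refine Finset.sum_le_sum fun G _ => ?_
              rw [Finset.card_powersetCard]
              exact Nat.choose_le_choose _ ((Finset.card_le_card Finset.sdiff_subset).trans (hCt x))
          _ = (C x).card.choose j * Ct.choose δ := by simp
          _ ≤ _ := Nat.mul_le_mul_right _ (Nat.choose_le_choose _ (hCt x))
      exact_mod_cast h1
  -- Interchanging the sums puts the correlation with `Ψ` of a test that depends only on the message
  -- innermost, as `hup` requires.
  have hswap : ∑ s, ∑ x, Ψ s x * guessWeight (t s) k j f (m₀ x) (fin x) (C x) =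
      ∑ δ ∈ Finset.range (D + 1), c δ *
        ∑ x, ∑ p ∈ ((C x).powersetCard j).sigma fun G => (C x \ G).powersetCard δ,
        ∑ s, (if Certifies (t s) k (patch (m₀ x) (fin x) p.1) (p.1 ∪ p.2) then (1 : ℝ) else 0) *
          Ψ s x := by
    simp_rw [hf, guessWeight_eq_sum]
    calc _ = ∑ s, ∑ x, ∑ δ ∈ Finset.range (D + 1), c δ *
          ∑ p ∈ ((C x).powersetCard j).sigma fun G => (C x \ G).powersetCard δ,
          (if Certifies (t s) k (patch (m₀ x) (fin x) p.1) (p.1 ∪ p.2) then (1 : ℝ) else 0) *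
            Ψ s x := by
          refine Finset.sum_congr rfl fun s _ => Finset.sum_congr rfl fun x _ => ?_
          rw [Finset.mul_sum]
          refine Finset.sum_congr rfl fun δ _ => ?_
          rw [← Finset.sum_mul]
          ring
      _ = ∑ x, ∑ s, ∑ δ ∈ Finset.range (D + 1), c δ *
          ∑ p ∈ ((C x).powersetCard j).sigma fun G => (C x \ G).powersetCard δ,
          (if Certifies (t s) k (patch (m₀ x) (fin x) p.1) (p.1 ∪ p.2) then (1 : ℝ) else 0) *
            Ψ s x := Finset.sum_comm
      _ = ∑ x, ∑ δ ∈ Finset.range (D + 1), ∑ s, c δ *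
          ∑ p ∈ ((C x).powersetCard j).sigma fun G => (C x \ G).powersetCard δ,
          (if Certifies (t s) k (patch (m₀ x) (fin x) p.1) (p.1 ∪ p.2) then (1 : ℝ) else 0) *
            Ψ s x := Finset.sum_congr rfl fun x _ => Finset.sum_comm
      _ = ∑ δ ∈ Finset.range (D + 1), ∑ x, ∑ s, c δ *
          ∑ p ∈ ((C x).powersetCard j).sigma fun G => (C x \ G).powersetCard δ,
          (if Certifies (t s) k (patch (m₀ x) (fin x) p.1) (p.1 ∪ p.2) then (1 : ℝ) else 0) *
            Ψ s x := Finset.sum_comm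
      _ = _ := by
          refine Finset.sum_congr rfl fun δ _ => ?_
          rw [Finset.mul_sum]
          refine Finset.sum_congr rfl fun x _ => ?_
          rw [← Finset.mul_sum, Finset.sum_comm]
  have h1 : ∑ s, ∑ x, ((if (t s).eval (fin x) = false ∧ ((t s).visited (fin x)).card ≤ k ∧
      ((t s).visited (fin x) ∩ C x).card = j then (1 : ℝ) else 0) - err) ≤
      ∑ s, ∑ x, Ψ s x * guessWeight (t s) k j f (m₀ x) (fin x) (C x) :=
    Finset.sum_le_sum fun s _ => Finset.sum_le_sum fun x _ => hlow s x
  have h2 : ∑ s, ∑ x, Ψ s x * guessWeight (t s) k j f (m₀ x) (fin x) (C x) ≤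
      (∑ δ ∈ Finset.range (D + 1), |c δ| * (Ct.choose j * Ct.choose δ)) * Y := by
    rw [hswap, Finset.sum_mul]
    refine Finset.sum_le_sum fun δ hδ => ?_
    refine (le_abs_self _).trans ?_
    rw [abs_mul, mul_assoc]
    gcongr
    exact hup δ hδ
  have h3 : ∑ s, ∑ x, ((if (t s).eval (fin x) = false ∧ ((t s).visited (fin x)).card ≤ k ∧
      ((t s).visited (fin x) ∩ C x).card = j then (1 : ℝ) else 0) - err) =
      ((∑ s, (Finset.univ.filter fun x => (t s).eval (fin x) = false ∧
      ((t s).visited (fin x)).card ≤ k ∧ ((t s).visited (fin x) ∩ C x).card = j).card : ℕ) : ℝ) -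
      Fintype.card S * Fintype.card X * err := by
    push_cast
    simp_rw [Finset.sum_sub_distrib, Finset.sum_boole]
    simp
    ring
  linarith

end Epoch

/-! ### Polynomials of low degree that decay fast on the integers. -/

section Polynomial
open Polynomial Polynomial.Chebyshev

theorem eval_T_real_mono (m : ℕ) {x y : ℝ} (hx : 1 ≤ x) (hxy : x ≤ y) :
    (T ℝ m).eval x ≤ (T ℝ m).eval y := by
  rw [← Real.cosh_arcosh hx, ← Real.cosh_arcosh (hx.trans hxy), T_real_cosh, T_real_cosh,
    Real.cosh_le_cosh]
  have h1 := Real.arcosh_nonneg hx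
  have h2 := Real.arcosh_nonneg (hx.trans hxy)
  have h3 : Real.arcosh x ≤ Real.arcosh y := by
    have : |Real.arcosh x| ≤ |Real.arcosh y| := by
      rw [← Real.cosh_le_cosh, Real.cosh_arcosh hx, Real.cosh_arcosh (hx.trans hxy)]
      exact hxy
    rwa [abs_of_nonneg h1, abs_of_nonneg h2] at this
  rw [abs_of_nonneg (by positivity), abs_of_nonneg (by positivity)]
  gcongr

/-- On `[0, 1]`, `cosh √x ≤ exp (x / 2) ≤ 1 + 2 * x`, hence the value is at least `cosh (m * √x)`.
The square root in this exponent is the gain of Chebyshev polynomials. -/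
theorem exp_half_le_eval_T_real (m : ℕ) {x : ℝ} (hx0 : 0 ≤ x) (hx1 : x ≤ 1) :
    Real.exp (m * √x) / 2 ≤ (T ℝ m).eval (1 + 2 * x) := by
  have h1 : Real.cosh (√x) ≤ 1 + 2 * x := by
    refine (Real.cosh_le_exp_half_sq _).trans ?_
    rw [Real.sq_sqrt hx0]
    have := Real.exp_bound_div_one_sub_of_interval (x := x / 2) (by linarith) (by linarith)
    refine this.trans ?_
    rw [div_le_iff₀ (by linarith)]
    nlinarith
  refine le_trans ?_ (eval_T_real_mono m (Real.one_le_cosh _) h1)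
  rw [T_real_cosh, Real.cosh_eq]
  have := Real.exp_pos (-((m : ℤ) * √x))
  push_cast at *
  linarith

/-- A rescaled Chebyshev polynomial: it is `1` at `0`, bounded by `1` on `[0, k]` and small on
`[θ, k]`. -/
noncomputable def chebyshevDamper (θ k : ℝ) (m : ℕ) : ℝ[X] :=
  C ((T ℝ m).eval (1 + 2 * (θ / k)))⁻¹ * (T ℝ m).comp (C (1 + 2 * (θ / k)) - C (2 / k) * X)

theorem chebyshevDamper_eval (θ k : ℝ) (m : ℕ) (b : ℝ) :
    (chebyshevDamper θ k m).eval b =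
      (T ℝ m).eval (1 + 2 * ((θ - b) / k)) / (T ℝ m).eval (1 + 2 * (θ / k)) := by
  simp only [chebyshevDamper, eval_mul, eval_C, eval_comp, eval_sub, eval_X]
  rw [show 1 + 2 * (θ / k) - 2 / k * b = 1 + 2 * ((θ - b) / k) by ring, mul_comm,
    ← div_eq_mul_inv]

theorem chebyshevDamper_natDegree_le (θ k : ℝ) (m : ℕ) :
    (chebyshevDamper θ k m).natDegree ≤ m := by
  refine (natDegree_C_mul_le _ _).trans (natDegree_comp_le.trans ?_)
  have h1 : (T ℝ (m : ℤ)).natDegree = m := by simp [natDegree_T]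
  have h2 : (C (1 + 2 * (θ / k)) - C (2 / k) * X : ℝ[X]).natDegree ≤ 1 := by
    refine (natDegree_sub_le _ _).trans ?_
    simp only [natDegree_C]
    exact max_le (by norm_num) ((natDegree_C_mul_le _ _).trans natDegree_X_le)
  rw [h1]
  calc m * _ ≤ m * 1 := Nat.mul_le_mul_left _ h2
    _ = m := mul_one m

theorem chebyshevDamper_eval_zero {θ k : ℝ} (hθ : 0 ≤ θ) (hk : 0 < k) (m : ℕ) :
    (chebyshevDamper θ k m).eval 0 = 1 := by
  rw [chebyshevDamper_eval, sub_zero]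
  have : 1 ≤ (T ℝ m).eval (1 + 2 * (θ / k)) :=
    one_le_eval_T_real _ (by have : 0 ≤ θ / k := by positivity
                             linarith)
  exact div_self (by linarith)

theorem chebyshevDamper_abs_le_one {θ k b : ℝ} (hθ : 0 ≤ θ) (hk : 0 < k) (hb : 0 ≤ b)
    (hbk : b ≤ k) (m : ℕ) : |(chebyshevDamper θ k m).eval b| ≤ 1 := by
  rw [chebyshevDamper_eval]
  have h0 : 0 ≤ θ / k := by positivity
  have h1 : 1 ≤ (T ℝ m).eval (1 + 2 * (θ / k)) := one_le_eval_T_real _ (by linarith)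
  rw [abs_div, abs_of_nonneg (by linarith : 0 ≤ (T ℝ m).eval (1 + 2 * (θ / k))),
    div_le_one (by linarith)]
  rcases le_total b θ with h | h
  · have h2 : 0 ≤ (θ - b) / k := div_nonneg (by linarith) hk.le
    have h3 : 1 ≤ (T ℝ m).eval (1 + 2 * ((θ - b) / k)) := one_le_eval_T_real _ (by linarith)
    rw [abs_of_nonneg (by linarith)]
    refine eval_T_real_mono m (by linarith) ?_
    have : (θ - b) / k ≤ θ / k := by gcongr; linarith
    linarith
  · refine (abs_eval_T_real_le_one _ ?_).trans h1
    rw [abs_le]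
    have h2 : (θ - b) / k ≤ 0 := div_nonpos_of_nonpos_of_nonneg (by linarith) hk.le
    have h3 : -1 ≤ (θ - b) / k := by rw [le_div_iff₀ hk]; linarith
    constructor <;> linarith

/-- For `b` in `[θ, k]` the argument of the numerator lies in `[-1, 1]`, where the Chebyshev
polynomial is at most `1`; the normalising denominator is exponentially large. -/
theorem chebyshevDamper_abs_le_exp {θ k b : ℝ} (hθ : 0 ≤ θ) (hk : 0 < k) (hb : θ ≤ b)
    (hbk : b ≤ k) (m : ℕ) :
    |(chebyshevDamper θ k m).eval b| ≤ 2 * Real.exp (-(m * √(θ / k))) := by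
  rw [chebyshevDamper_eval]
  have h0 : 0 ≤ θ / k := by positivity
  have h1 : θ / k ≤ 1 := by rw [div_le_one hk]; linarith
  have h4 := exp_half_le_eval_T_real m h0 h1
  have h5 : 0 < Real.exp (m * √(θ / k)) / 2 := by positivity
  have h6 : |(T ℝ m).eval (1 + 2 * ((θ - b) / k))| ≤ 1 := by
    refine abs_eval_T_real_le_one _ ?_
    rw [abs_le]
    have h2 : (θ - b) / k ≤ 0 := div_nonpos_of_nonpos_of_nonneg (by linarith) hk.le
    have h3 : -1 ≤ (θ - b) / k := by rw [le_div_iff₀ hk]; linarith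
    constructor <;> linarith
  rw [abs_div, abs_of_nonneg (by linarith : 0 ≤ (T ℝ m).eval (1 + 2 * (θ / k)))]
  calc _ ≤ 1 / (Real.exp (m * √(θ / k)) / 2) := by gcongr
    _ = _ := by rw [Real.exp_neg]; field_simp

/-- The polynomial `∏_{u = 1}^{r} (1 - X / u)`. -/
noncomputable def rootsPolynomial (r : ℕ) : ℝ[X] :=
  ∏ u ∈ Finset.range r, (1 - C ((u : ℝ) + 1)⁻¹ * X)

theorem rootsPolynomial_natDegree_le (r : ℕ) : (rootsPolynomial r).natDegree ≤ r := by
  refine (natDegree_prod_le _ _).trans ?_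
  calc _ ≤ ∑ u ∈ Finset.range r, 1 := Finset.sum_le_sum fun u _ => by
        refine (natDegree_sub_le _ _).trans ?_
        simp only [natDegree_one]
        exact max_le (by norm_num) ((natDegree_C_mul_le _ _).trans natDegree_X_le)
    _ = r := by simp

theorem rootsPolynomial_eval_zero (r : ℕ) : (rootsPolynomial r).eval 0 = 1 := by
  simp [rootsPolynomial, eval_prod]

theorem rootsPolynomial_eval_eq_zero {r b : ℕ} (h1 : 1 ≤ b) (hb : b ≤ r) :
    (rootsPolynomial r).eval (b : ℝ) = 0 := by
  rw [rootsPolynomial, eval_prod]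
  refine Finset.prod_eq_zero (i := b - 1) (Finset.mem_range.2 (by omega)) ?_
  have : ((b - 1 : ℕ) : ℝ) + 1 = b := by
    rw [Nat.cast_sub h1]; simp
  have hb0 : (b : ℝ) ≠ 0 := by positivity
  simp [this, hb0]

theorem rootsPolynomial_abs_le {r b : ℕ} (hb : r ≤ b) :
    |(rootsPolynomial r).eval (b : ℝ)| ≤ (b : ℝ) ^ r / r.factorial := by
  rw [rootsPolynomial, eval_prod, Finset.abs_prod]
  have h : (b : ℝ) ^ r / r.factorial = ∏ u ∈ Finset.range r, ((b : ℝ) / ((u : ℝ) + 1)) := by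
    rw [Finset.prod_div_distrib, Finset.prod_const, Finset.card_range]
    congr 1
    rw [← Finset.prod_range_add_one_eq_factorial]
    push_cast
    rfl
  rw [h]
  refine Finset.prod_le_prod (fun _ _ => abs_nonneg _) fun u hu => ?_
  have hu' : (u : ℝ) + 1 ≤ b := by
    have := Finset.mem_range.1 hu
    exact_mod_cast (by omega : u + 1 ≤ b)
  have hu0 : (0 : ℝ) < (u : ℝ) + 1 := by positivity
  have : (1 : ℝ) ≤ b / ((u : ℝ) + 1) := by rw [le_div_iff₀ hu0]; linarith
  simp only [eval_sub, eval_one, eval_mul, eval_C, eval_X]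
  rw [inv_mul_eq_div, abs_le]
  constructor <;> linarith

theorem pow_div_factorial_le_pow (x : ℝ) (hx : 0 ≤ x) {r : ℕ} (hr : 1 ≤ r) :
    x ^ r / r.factorial ≤ (Real.exp 1 * x / r) ^ r := by
  have hr0 : (0 : ℝ) < r := by positivity
  have h := Real.pow_div_factorial_le_exp (r : ℝ) hr0.le r
  have hf : (0 : ℝ) < r.factorial := by positivity
  have h2 : x ^ r / r.factorial = (x / r) ^ r * ((r : ℝ) ^ r / r.factorial) := by
    rw [div_pow]; field_simp
  rw [h2]
  calc _ ≤ (x / r) ^ r * Real.exp r := by gcongr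
    _ = _ := by rw [mul_div_assoc, mul_pow, ← Real.exp_nat_mul, mul_one, mul_comm]

/-- The number of damping scales between `ρ` and `k`. -/
def dampingScales (ρ k : ℕ) : ℕ := Nat.log 4 (k / ρ) + 1

/-- The degree of the damping polynomial at scale `s`. -/
noncomputable def dampingDegree (ρ k s : ℕ) : ℕ :=
  ⌈10 * (ρ : ℝ) / √((ρ * 4 ^ s : ℝ) / k)⌉₊

/-- A polynomial of small degree that is `1` at `0` and decays fast on the integers of
`[1, k]`. -/
noncomputable def decayPolynomial (ρ k : ℕ) : ℝ[X] :=
  rootsPolynomial ρ *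
    ∏ s ∈ Finset.range (dampingScales ρ k), chebyshevDamper (ρ * 4 ^ s) k (dampingDegree ρ k s)

theorem mul_four_pow_le_of_lt_dampingScales {ρ k s : ℕ} (hρ : 1 ≤ ρ) (hk : ρ ≤ k)
    (hs : s < dampingScales ρ k) : ρ * 4 ^ s ≤ k := by
  have h1 : 4 ^ s ≤ k / ρ :=
    Nat.pow_le_of_le_log (Nat.div_pos hk hρ).ne' (by unfold dampingScales at hs; omega)
  calc ρ * 4 ^ s ≤ ρ * (k / ρ) := Nat.mul_le_mul_left _ h1
    _ ≤ k := Nat.mul_div_le _ _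

theorem decayPolynomial_eval_zero {ρ k : ℕ} (hρ : 1 ≤ ρ) (hk : ρ ≤ k) :
    (decayPolynomial ρ k).eval 0 = 1 := by
  rw [decayPolynomial, eval_mul, rootsPolynomial_eval_zero, eval_prod, one_mul]
  refine Finset.prod_eq_one fun s _ => chebyshevDamper_eval_zero (by positivity) ?_ _
  exact_mod_cast hρ.trans hk

theorem dampingScales_le {ρ k : ℕ} (hρ : 1 ≤ ρ) (hk : ρ ≤ k) :
    (dampingScales ρ k : ℝ) ≤ √((k : ℝ) * ρ) := by
  set t := Nat.log 4 (k / ρ) with ht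
  have h1 : ρ * 4 ^ t ≤ k :=
    mul_four_pow_le_of_lt_dampingScales hρ hk (by simp [dampingScales, ← ht])
  have h2 : t + 1 ≤ 2 ^ t := Nat.lt_two_pow_self
  apply Real.le_sqrt_of_sq_le
  have h3 : (t + 1) ^ 2 ≤ k * ρ := by
    calc (t + 1) ^ 2 ≤ (2 ^ t) ^ 2 := Nat.pow_le_pow_left h2 2
      _ = 4 ^ t := by rw [← pow_mul, mul_comm, pow_mul]; norm_num
      _ ≤ ρ * 4 ^ t := Nat.le_mul_of_pos_left _ hρ
      _ ≤ k := h1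
      _ ≤ k * ρ := Nat.le_mul_of_pos_right _ hρ
  unfold dampingScales
  exact_mod_cast h3

/-- The degrees of the dampers form a geometric series with sum at most `20 * √(k * ρ)`. Rounding up
costs one per scale; the number of scales and the degree `ρ` of the root factor are at most `√(k *
ρ)` each. -/
theorem decayPolynomial_natDegree_le {ρ k : ℕ} (hρ : 1 ≤ ρ) (hk : ρ ≤ k) :
    ((decayPolynomial ρ k).natDegree : ℝ) ≤ 22 * √((k : ℝ) * ρ) := by
  have hρ0 : (0 : ℝ) < ρ := by exact_mod_cast hρ
  have hk0 : (0 : ℝ) < k := by exact_mod_cast hρ.trans hk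
  have hkρ : (ρ : ℝ) ≤ k := by exact_mod_cast hk
  have h1 : (decayPolynomial ρ k).natDegree ≤
      ρ + ∑ s ∈ Finset.range (dampingScales ρ k), dampingDegree ρ k s := by
    refine natDegree_mul_le.trans (add_le_add (rootsPolynomial_natDegree_le ρ) ?_)
    exact (natDegree_prod_le _ _).trans
      (Finset.sum_le_sum fun s _ => chebyshevDamper_natDegree_le _ _ _)
  have h2 : ∀ s, (dampingDegree ρ k s : ℝ) ≤ 10 * √((k : ℝ) * ρ) * (1 / 2) ^ s + 1 := by
    intro s
    have h3 : 10 * (ρ : ℝ) / √((ρ * 4 ^ s : ℝ) / k) = 10 * √((k : ℝ) * ρ) * (1 / 2) ^ s := by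
      have h4 : √((ρ * 4 ^ s : ℝ) / k) = √ρ * 2 ^ s / √k := by
        rw [Real.sqrt_div (by positivity), Real.sqrt_mul hρ0.le]
        congr 2
        rw [show (4 : ℝ) = 2 ^ 2 by norm_num, ← pow_mul, mul_comm, pow_mul,
          Real.sqrt_sq (by positivity)]
      have h5 : √(ρ : ℝ) * √ρ = ρ := Real.mul_self_sqrt hρ0.le
      rw [h4, Real.sqrt_mul hk0.le]
      have : 0 < √(ρ : ℝ) := Real.sqrt_pos.2 hρ0
      have : 0 < √(k : ℝ) := Real.sqrt_pos.2 hk0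
      rw [one_div, inv_pow]
      field_simp
      nlinarith
    rw [dampingDegree, h3]
    exact (Nat.ceil_lt_add_one (by positivity)).le
  have h3 : (∑ s ∈ Finset.range (dampingScales ρ k), (dampingDegree ρ k s : ℝ)) ≤
      20 * √((k : ℝ) * ρ) + √((k : ℝ) * ρ) := by
    refine (Finset.sum_le_sum fun s _ => h2 s).trans ?_
    rw [Finset.sum_add_distrib, ← Finset.mul_sum]
    have h4 : ∑ i ∈ Finset.range (dampingScales ρ k), (1 / 2 : ℝ) ^ i ≤ 2 := by
      simpa using sum_geometric_two_le (dampingScales ρ k)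
    have h5 := dampingScales_le hρ hk
    simp only [Finset.sum_const, Finset.card_range, nsmul_eq_mul, mul_one]
    have : 0 ≤ √((k : ℝ) * ρ) := Real.sqrt_nonneg _
    nlinarith
  have h4 : (ρ : ℝ) ≤ √((k : ℝ) * ρ) := by
    apply Real.le_sqrt_of_sq_le
    nlinarith
  have h5 : ((decayPolynomial ρ k).natDegree : ℝ) ≤
      ρ + ∑ s ∈ Finset.range (dampingScales ρ k), (dampingDegree ρ k s : ℝ) := by
    exact_mod_cast h1
  linarith

/-- Integers up to `ρ` are roots. If `b` lies between `ρ * 4 ^ t` and `ρ * 4 ^ (t + 1)`, the dampers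
of the scales `0, …, t` contribute `exp (-9ρ)` each and the others at most `1`. The root factor
times the binomial coefficient is at most `exp (6ρ(t + 1))`. -/
theorem decayPolynomial_abs_le {ρ k b : ℕ} (hρ : 1 ≤ ρ) (hk : ρ ≤ k) (hb : 1 ≤ b) (hbk : b ≤ k) :
    |(decayPolynomial ρ k).eval (b : ℝ)| * (ρ + b).choose ρ ≤ Real.exp (-(3 * ρ)) := by
  have hρ0 : (0 : ℝ) < ρ := by exact_mod_cast hρ
  have hρ1 : (1 : ℝ) ≤ ρ := by exact_mod_cast hρ
  have hk0 : (0 : ℝ) < k := by exact_mod_cast hρ.trans hk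
  rcases le_or_gt b ρ with h | h
  · rw [decayPolynomial, eval_mul, rootsPolynomial_eval_eq_zero hb h]
    simp [Real.exp_nonneg]
  set t := Nat.log 4 (b / ρ) with ht
  have hbρ : b / ρ ≠ 0 := (Nat.div_pos h.le hρ).ne'
  have ht1 : ρ * 4 ^ t ≤ b := by
    calc ρ * 4 ^ t ≤ ρ * (b / ρ) := Nat.mul_le_mul_left _ (Nat.pow_log_le_self _ hbρ)
      _ ≤ b := Nat.mul_div_le _ _
  have ht2 : b ≤ ρ * 4 ^ (t + 1) := by
    have h1 : b / ρ < 4 ^ (t + 1) := Nat.lt_pow_succ_log_self (by norm_num) _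
    rw [Nat.div_lt_iff_lt_mul hρ] at h1
    rw [mul_comm]
    exact h1.le
  have ht3 : t + 1 ≤ dampingScales ρ k := by
    unfold dampingScales
    have : Nat.log 4 (b / ρ) ≤ Nat.log 4 (k / ρ) := Nat.log_mono_right (Nat.div_le_div_right hbk)
    omega
  have hprod : |(∏ s ∈ Finset.range (dampingScales ρ k),
      chebyshevDamper (ρ * 4 ^ s) k (dampingDegree ρ k s)).eval (b : ℝ)| ≤
      Real.exp (-(9 * ρ)) ^ (t + 1) := by
    rw [eval_prod, Finset.abs_prod, ← Finset.prod_sdiff (Finset.range_subset_range.2 ht3),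
      ← one_mul (Real.exp (-(9 * (ρ : ℝ))) ^ (t + 1))]
    refine mul_le_mul ?_ ?_ (Finset.prod_nonneg fun _ _ => abs_nonneg _) zero_le_one
    · refine Finset.prod_le_one (fun _ _ => abs_nonneg _) fun s _ => ?_
      exact chebyshevDamper_abs_le_one (by positivity) hk0 (by positivity) (by exact_mod_cast hbk) _
    · rw [← Finset.card_range (t + 1), ← Finset.prod_const, Finset.card_range]
      refine Finset.prod_le_prod (fun _ _ => abs_nonneg _) fun s hs => ?_
      have hst : s ≤ t := Nat.lt_succ_iff.1 (Finset.mem_range.1 hs)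
      have h1 : (ρ * 4 ^ s : ℝ) ≤ b := by
        have : ρ * 4 ^ s ≤ b :=
          (Nat.mul_le_mul_left _ (Nat.pow_le_pow_right (by norm_num) hst)).trans ht1
        exact_mod_cast this
      refine (chebyshevDamper_abs_le_exp (by positivity) hk0 h1 (by exact_mod_cast hbk) _).trans ?_
      have h2 : 0 < √((ρ * 4 ^ s : ℝ) / k) := Real.sqrt_pos.2 (by positivity)
      have h3 : 10 * (ρ : ℝ) ≤ dampingDegree ρ k s * √((ρ * 4 ^ s : ℝ) / k) := by
        rw [← div_le_iff₀ h2]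
        exact Nat.le_ceil _
      -- The factor `2` is absorbed by `exp ρ`, which turns the `10` of `dampingDegree` into `9`.
      calc 2 * Real.exp (-(dampingDegree ρ k s * √((ρ * 4 ^ s : ℝ) / k)))
          ≤ Real.exp ρ * Real.exp (-(10 * ρ)) := by
            gcongr
            linarith [Real.add_one_le_exp (ρ : ℝ)]
        _ = Real.exp (-(9 * ρ)) := by rw [← Real.exp_add]; congr 1; ring
  have hroots : |(rootsPolynomial ρ).eval (b : ℝ)| ≤ (Real.exp 1 * 4 ^ (t + 1)) ^ ρ := by
    refine (rootsPolynomial_abs_le h.le).trans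
      ((pow_div_factorial_le_pow _ (by positivity) hρ).trans ?_)
    gcongr
    rw [mul_div_assoc]
    gcongr
    rw [div_le_iff₀ hρ0, mul_comm]
    exact_mod_cast ht2
  have hchoose : ((ρ + b).choose ρ : ℝ) ≤ (Real.exp 1 * (2 * 4 ^ (t + 1))) ^ ρ := by
    refine (Nat.choose_le_pow_div ρ (ρ + b)).trans
      ((pow_div_factorial_le_pow _ (by positivity) hρ).trans ?_)
    gcongr
    rw [mul_div_assoc]
    gcongr
    rw [div_le_iff₀ hρ0]
    have : ρ + b ≤ 2 * 4 ^ (t + 1) * ρ := by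
      have : ρ ≤ ρ * 4 ^ (t + 1) := Nat.le_mul_of_pos_right _ (by positivity)
      nlinarith
    exact_mod_cast this
  have he : Real.exp 1 * 4 * (Real.exp 1 * (2 * 4)) ≤ Real.exp 6 := by
    have h1 : (2.7 : ℝ) ≤ Real.exp 1 := by linarith [Real.exp_one_gt_d9]
    have h2 : (32 : ℝ) ≤ Real.exp 1 ^ 4 := by
      calc (32 : ℝ) ≤ 2.7 ^ 4 := by norm_num
        _ ≤ _ := by gcongr
    have h3 : Real.exp 6 = Real.exp 1 ^ 6 := by rw [← Real.exp_nat_mul]; norm_num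
    rw [h3]
    nlinarith [sq_nonneg (Real.exp 1), Real.exp_pos 1, mul_le_mul_of_nonneg_left h2 (sq_nonneg (Real.exp 1))]
  have hcomb : Real.exp 1 * 4 ^ (t + 1) * (Real.exp 1 * (2 * 4 ^ (t + 1))) ≤
      Real.exp 6 ^ (t + 1) := by
    have h1 : (1 : ℝ) ≤ Real.exp 1 * (Real.exp 1 * 2) := by
      nlinarith [Real.exp_one_gt_d9]
    calc Real.exp 1 * 4 ^ (t + 1) * (Real.exp 1 * (2 * 4 ^ (t + 1)))
        = (Real.exp 1 * (Real.exp 1 * 2)) * (4 ^ (t + 1) * 4 ^ (t + 1)) := by ring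
      _ ≤ (Real.exp 1 * (Real.exp 1 * 2)) ^ (t + 1) * (4 ^ (t + 1) * 4 ^ (t + 1)) := by
          gcongr
          exact le_self_pow₀ h1 (by omega)
      _ = (Real.exp 1 * 4 * (Real.exp 1 * (2 * 4))) ^ (t + 1) := by
          rw [← mul_pow, ← mul_pow]; congr 1; ring
      _ ≤ _ := by gcongr
  rw [decayPolynomial, eval_mul, abs_mul]
  calc _ ≤ (Real.exp 1 * 4 ^ (t + 1)) ^ ρ * Real.exp (-(9 * ρ)) ^ (t + 1) *
        (Real.exp 1 * (2 * 4 ^ (t + 1))) ^ ρ := by gcongr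
    _ = (Real.exp 1 * 4 ^ (t + 1) * (Real.exp 1 * (2 * 4 ^ (t + 1)))) ^ ρ *
        Real.exp (-(9 * ρ)) ^ (t + 1) := by rw [mul_pow (Real.exp 1 * 4 ^ (t + 1))]; ring
    _ ≤ (Real.exp 6 ^ (t + 1)) ^ ρ * Real.exp (-(9 * ρ)) ^ (t + 1) := by gcongr
    _ = Real.exp (-(3 * ρ * (t + 1))) := by
        rw [← Real.exp_nat_mul, ← Real.exp_nat_mul, ← Real.exp_nat_mul, ← Real.exp_add]
        congr 1
        push_cast
        ring
    _ ≤ _ := by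
        apply Real.exp_le_exp.2
        have : (0 : ℝ) ≤ t := by positivity
        nlinarith

theorem decayPolynomial_abs_le_one {ρ k b : ℕ} (hρ : 1 ≤ ρ) (hk : ρ ≤ k) (hbk : b ≤ k) :
    |(decayPolynomial ρ k).eval (b : ℝ)| ≤ 1 := by
  rcases Nat.eq_zero_or_pos b with rfl | hb
  · simp [decayPolynomial_eval_zero hρ hk]
  · have h1 := decayPolynomial_abs_le hρ hk hb hbk
    have h2 : (1 : ℝ) ≤ (ρ + b).choose ρ := by
      exact_mod_cast Nat.choose_pos (Nat.le_add_right ρ b)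
    have h3 : Real.exp (-(3 * ρ)) ≤ 1 := Real.exp_le_one_iff.2 (by
      have : (0 : ℝ) ≤ ρ := by positivity
      linarith)
    nlinarith [abs_nonneg ((decayPolynomial ρ k).eval (b : ℝ))]

/-- Newton coefficients of a fast decaying function of small degree. -/
theorem exists_decaying_newton_series {ρ k : ℕ} (hρ : 1 ≤ ρ) (hk : ρ ≤ k) :
    ∃ (D : ℕ) (a : ℕ → ℝ), (D : ℝ) ≤ 22 * √((k : ℝ) * ρ) ∧ (∀ δ, |a δ| ≤ 2 ^ δ) ∧
      (∑ δ ∈ Finset.range (D + 1), a δ * (Nat.choose 0 δ : ℝ) = 1) ∧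
      ∀ b, 1 ≤ b → b ≤ k →
        |∑ δ ∈ Finset.range (D + 1), a δ * (Nat.choose b δ : ℝ)| * (ρ + b).choose ρ ≤
          Real.exp (-(3 * ρ)) := by
  set P := decayPolynomial ρ k
  -- Differences of order above `k` involve values of `P` beyond `k`, where no bound is available.
  -- They are replaced by `0`, which is harmless because `b.choose δ = 0` for `b ≤ k < δ`.
  have hnewton : ∀ b ≤ k, ∑ δ ∈ Finset.range (P.natDegree + 1),
      (if δ ≤ k then (fwdDiff (1 : ℝ))^[δ] P.eval 0 else 0) * (Nat.choose b δ : ℝ) = P.eval (b : ℝ) := by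
    intro b hb
    have h1 := shift_eq_sum_fwdDiff_iter (1 : ℝ) P.eval b 0
    simp only [zero_add, nsmul_eq_mul, mul_one] at h1
    rw [h1]
    have h2 : ∀ δ, (if δ ≤ k then (fwdDiff (1 : ℝ))^[δ] P.eval 0 else 0) * (Nat.choose b δ : ℝ) =
        (Nat.choose b δ : ℝ) * (fwdDiff (1 : ℝ))^[δ] P.eval 0 := by
      intro δ
      split_ifs with h
      · ring
      · rw [Nat.choose_eq_zero_of_lt (by omega)]; simp
    simp_rw [h2]
    rcases le_total P.natDegree b with h | h
    · refine Finset.sum_subset (Finset.range_subset_range.2 (by omega)) fun δ _ hδ => ?_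
      rw [Polynomial.fwdDiff_iter_eq_zero_of_degree_lt (by simpa using hδ)]
      simp
    · refine (Finset.sum_subset (Finset.range_subset_range.2 (by omega)) fun δ _ hδ => ?_).symm
      rw [Nat.choose_eq_zero_of_lt (by simpa using hδ)]
      simp
  refine ⟨P.natDegree, fun δ => if δ ≤ k then (fwdDiff (1 : ℝ))^[δ] P.eval 0 else 0,
    decayPolynomial_natDegree_le hρ hk, fun δ => ?_, ?_, fun b hb hbk => ?_⟩
  · simp only
    split_ifs with h
    -- The values of `P` on `0, …, k` are at most `1` in absolute value, so the alternating sum is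
    -- at most the sum of the binomial coefficients.
    · rw [fwdDiff_iter_eq_sum_shift]
      refine (Finset.abs_sum_le_sum_abs _ _).trans ?_
      have h3 : ∑ i ∈ Finset.range (δ + 1), (Nat.choose δ i : ℝ) = 2 ^ δ := by
        exact_mod_cast Nat.sum_range_choose δ
      rw [← h3]
      refine Finset.sum_le_sum fun i hi => ?_
      have hi' : i ≤ k := by have := Finset.mem_range.1 hi; omega
      have h4 := decayPolynomial_abs_le_one hρ hk hi'
      simp only [zero_add, nsmul_eq_mul, mul_one, zsmul_eq_mul]
      rw [abs_mul]
      push_cast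
      rw [abs_mul, abs_pow, abs_neg, abs_one, one_pow, one_mul, Nat.abs_cast]
      calc _ ≤ (Nat.choose δ i : ℝ) * 1 := by gcongr
        _ = _ := mul_one _
    · simp
  · simpa [decayPolynomial_eval_zero hρ hk, P] using hnewton 0 (Nat.zero_le _)
  · rw [hnewton b hbk]
    exact decayPolynomial_abs_le hρ hk hb hbk

end Polynomial

/-! ### Counting arrays with many repeated entries. -/

section Collisions

open Classical in
/-- The number of colourings of an array with rows indexed by `R` in which many entries share
their colour with another one of the same row. -/
theorem card_colliding_le {I R : Type} [Fintype I] [Fintype R] (B e : ℕ) (hB : 0 < B) :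
    (Finset.univ.filter fun c : I × R → Fin B => ∃ Y : Finset (I × R), 2 * e ≤ Y.card ∧
      ∀ p ∈ Y, ∃ q ∈ Y, q ≠ p ∧ q.2 = p.2 ∧ c q = c p).card ≤
    Fintype.card I ^ (Fintype.card I * Fintype.card R) *
      B ^ (Fintype.card I * Fintype.card R - e) := by
  set E := Fintype.card I * Fintype.card R - e with hE
  -- `(g p, p.2)` stands for a representative of the entry `p` with the same row and colour. A
  -- colouring is determined by `g` and the colours of the representatives. Each class inside `Y`
  -- has at least two members, so `Y` needs at most half as many representatives as entries, which
  -- saves `e` colours.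
  set good : Finset (I × R → I) := Finset.univ.filter fun g =>
    (Finset.univ.image fun p : I × R => (g p, p.2)).card ≤ E with hgood
  have hsub : (Finset.univ.filter fun c : I × R → Fin B => ∃ Y : Finset (I × R), 2 * e ≤ Y.card ∧
      ∀ p ∈ Y, ∃ q ∈ Y, q ≠ p ∧ q.2 = p.2 ∧ c q = c p) ⊆
      good.biUnion fun g => Finset.univ.filter fun c : I × R → Fin B =>
        ∀ p, c (g p, p.2) = c p := by
    intro c hc
    obtain ⟨Y, hYe, hY⟩ := (Finset.mem_filter.1 hc).2
    rcases isEmpty_or_nonempty (I × R) with hemp | hne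
    · simp only [Finset.mem_biUnion, Finset.mem_filter, Finset.mem_univ, true_and, hgood]
      exact ⟨fun p => hemp.elim p, by simp, fun p => hemp.elim p⟩
    set key : I × R → R × Fin B := fun p => (p.2, c p) with hkey
    set rep : I × R → I × R := fun p =>
      if p ∈ Y then Function.invFunOn key (Y : Set (I × R)) (key p) else p with hrep
    have hex : ∀ p ∈ Y, ∃ q ∈ (Y : Set (I × R)), key q = key p := fun p hp => ⟨p, hp, rfl⟩
    have hrepkey : ∀ p, key (rep p) = key p := by
      intro p
      by_cases hp : p ∈ Y
      · simp only [hrep, hp, if_true]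
        exact Function.invFunOn_eq (hex p hp)
      · simp [hrep, hp]
    have hrep2 : ∀ p, (rep p).2 = p.2 := fun p => congrArg Prod.fst (hrepkey p)
    have hrepc : ∀ p, c (rep p) = c p := fun p => congrArg Prod.snd (hrepkey p)
    simp only [Finset.mem_biUnion, Finset.mem_filter, Finset.mem_univ, true_and, hgood]
    have hpair : ∀ p, ((rep p).1, p.2) = rep p := fun p => Prod.ext rfl (hrep2 p).symm
    refine ⟨fun p => (rep p).1, ?_, fun p => by rw [hpair, hrepc]⟩
    simp_rw [hpair]
    change (Finset.univ.image rep).card ≤ E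
    have himg : Finset.univ.image rep ⊆
        Yᶜ ∪ (Y.image key).image (Function.invFunOn key (Y : Set (I × R))) := by
      intro q hq
      obtain ⟨p, -, rfl⟩ := Finset.mem_image.1 hq
      by_cases hp : p ∈ Y
      · refine Finset.mem_union_right _ (Finset.mem_image.2 ⟨key p, Finset.mem_image_of_mem _ hp, ?_⟩)
        simp [hrep, hp]
      · refine Finset.mem_union_left _ ?_
        simp [hrep, hp]
    have hfiber : 2 * (Y.image key).card ≤ Y.card := by
      rw [Finset.card_eq_sum_card_image key Y, mul_comm, ← smul_eq_mul, ← Finset.sum_const]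
      refine Finset.sum_le_sum fun y hy => ?_
      obtain ⟨p, hp, rfl⟩ := Finset.mem_image.1 hy
      obtain ⟨q, hq, hqp, h2, h3⟩ := hY p hp
      have : ({p, q} : Finset (I × R)) ⊆ Y.filter fun r => key r = key p := by
        intro r hr
        rcases Finset.mem_insert.1 hr with rfl | hr
        · simp [hp]
        · rw [Finset.mem_singleton.1 hr]
          simp [hq, hkey, h2, h3]
      calc 2 = ({p, q} : Finset (I × R)).card := (Finset.card_pair hqp.symm).symm
        _ ≤ _ := Finset.card_le_card this
    have h1 := (Finset.card_le_card himg).trans (Finset.card_union_le _ _)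
    have h2 : ((Y.image key).image (Function.invFunOn key (Y : Set (I × R)))).card ≤
      (Y.image key).card := Finset.card_image_le
    rw [Finset.card_compl, Fintype.card_prod] at h1
    have h3 : Y.card ≤ Fintype.card I * Fintype.card R := by
      rw [← Fintype.card_prod]; exact Finset.card_le_univ _
    omega
  have hcard : ∀ g ∈ good, (Finset.univ.filter fun c : I × R → Fin B =>
      ∀ p, c (g p, p.2) = c p).card ≤ B ^ E := by
    intro g hg
    set T := Finset.univ.image fun p : I × R => (g p, p.2) with hT
    have hTE : T.card ≤ E := (Finset.mem_filter.1 hg).2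
    calc _ ≤ (Finset.univ : Finset (T → Fin B)).card := by
          refine Finset.card_le_card_of_injOn (fun c p => c p) (fun _ _ => Finset.mem_univ _) ?_
          intro c hc c' hc' hcc
          funext p
          have h1 := (Finset.mem_filter.1 hc).2 p
          have h2 := (Finset.mem_filter.1 hc').2 p
          rw [← h1, ← h2]
          exact congrFun hcc ⟨(g p, p.2), Finset.mem_image_of_mem _ (Finset.mem_univ p)⟩
      _ = B ^ T.card := by simp
      _ ≤ B ^ E := Nat.pow_le_pow_right hB hTE
  calc _ ≤ _ := Finset.card_le_card hsub
    _ ≤ ∑ g ∈ good, B ^ E := Finset.card_biUnion_le.trans (Finset.sum_le_sum hcard)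
    _ = good.card * B ^ E := by simp
    _ ≤ _ := by
        gcongr
        refine (Finset.card_le_univ _).trans ?_
        simp

end Collisions

/-! ### Path weights in a butterfly, and moments of batch products. -/

section Butterfly
variable {m B M : ℕ}

/-- The labels of the nodes of one layer of a butterfly of depth `m + 1` and degree `B`. -/
abbrev BNode (m B : ℕ) : Type := Fin (m + 1) → Fin B

/-- A weight for every edge of the butterfly: the edge in layer `a` at the node `v` that sets the
digit `a` to `c` has weight `x a v c`. -/
abbrev BInput (m B M : ℕ) : Type := Fin (m + 1) → BNode m B → Fin B → ZMod M

/-- The node in layer `a` of the path from `s` to `t`. -/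
def pathNode (s t : BNode m B) (a : ℕ) : BNode m B := fun i => if (i : ℕ) < a then t i else s i

/-- The total weight of the path from `s` to `t`. -/
def pathSum (x : BInput m B M) (s t : BNode m B) : ZMod M :=
  ∑ a : Fin (m + 1), x a (pathNode s t a) (t a)

/-- A permutation for every switch of the butterfly. -/
abbrev Switches (m B : ℕ) : Type := Fin (m + 1) → (Fin m → Fin B) → Equiv.Perm (Fin B)

/-- The digit that the switches write at the node `v` of layer `a`. -/
def outDigit (σ : Switches m B) (a : Fin (m + 1)) (v : BNode m B) : Fin B :=
  σ a (a.removeNth v) (v a)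

/-- The node in layer `k` of the path that the switches determine for the source `s`. -/
def route (σ : Switches m B) (s : BNode m B) : ℕ → BNode m B
  | 0 => s
  | k + 1 => if h : k < m + 1 then
      Function.update (route σ s k) ⟨k, h⟩ (outDigit σ ⟨k, h⟩ (route σ s k)) else route σ s k

/-- The sink that the switches determine for the source `s`. -/
def target (σ : Switches m B) (s : BNode m B) : BNode m B := route σ s (m + 1)

theorem route_succ (σ : Switches m B) (s : BNode m B) (a : Fin (m + 1)) :
    route σ s (a + 1) = Function.update (route σ s a) a (outDigit σ a (route σ s a)) := by
  have h : (a : ℕ) < m + 1 := a.2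
  simp only [route, h, dif_pos]

/-- Two nodes with the same successor agree outside the digit `k`, so they meet the same switch, and
its permutation can be inverted. Hence the paths of one batch share no node of a layer, and no edge.
-/
theorem route_injective (σ : Switches m B) (k : ℕ) :
    Function.Injective fun s => route σ s k := by
  induction k with
  | zero => exact fun s s' h => h
  | succ k ih =>
    intro s s' h
    apply ih
    simp only [route] at h ⊢
    split_ifs at h with hk
    · set v := route σ s k
      set v' := route σ s' k
      have hrest : ∀ i, i ≠ (⟨k, hk⟩ : Fin (m + 1)) → v i = v' i := by
        intro i hi
        have := congrFun h i
        rwa [Function.update_of_ne hi, Function.update_of_ne hi] at this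
      have hrem : (⟨k, hk⟩ : Fin (m + 1)).removeNth v = (⟨k, hk⟩ : Fin (m + 1)).removeNth v' := by
        funext i
        exact hrest _ (Fin.succAbove_ne _ _)
      have hk' := congrFun h ⟨k, hk⟩
      simp only [Function.update_self, outDigit, hrem] at hk'
      have := (σ ⟨k, hk⟩ _).injective hk'
      funext i
      by_cases hi : i = ⟨k, hk⟩
      · rw [hi]; exact this
      · exact hrest i hi
    · exact h

theorem route_apply_of_le (σ : Switches m B) (s : BNode m B) (k : ℕ) (i : Fin (m + 1))
    (h : k ≤ i) : route σ s k i = s i := by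
  induction k with
  | zero => rfl
  | succ k ih =>
    have hk : k < m + 1 := by omega
    rw [show k = ((⟨k, hk⟩ : Fin (m + 1)) : ℕ) from rfl, route_succ, Function.update_of_ne]
    · exact ih (by omega)
    · intro h'
      rw [h'] at h
      simp at h

theorem route_apply_of_lt (σ : Switches m B) (s : BNode m B) (k : ℕ) (i : Fin (m + 1))
    (h : (i : ℕ) < k) : route σ s k i = outDigit σ i (route σ s i) := by
  induction k with
  | zero => simp at h
  | succ k ih =>
    rcases Nat.lt_or_ge i k with h1 | h1
    · rw [← ih h1]
      simp only [route]
      split_ifs with hk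
      · rw [Function.update_of_ne]
        intro h'
        rw [h'] at h1
        simp at h1
      · rfl
    · have : k = (i : ℕ) := by omega
      subst this
      rw [route_succ, Function.update_self]

theorem target_apply (σ : Switches m B) (s : BNode m B) (a : Fin (m + 1)) :
    target σ s a = outDigit σ a (route σ s a) :=
  route_apply_of_lt σ s (m + 1) a a.2

/-- Only the layer `i` writes the digit `i`, so the digits below `k` are already those of the sink.
-/
theorem pathNode_target (σ : Switches m B) (s : BNode m B) (k : ℕ) :
    pathNode s (target σ s) k = route σ s k := by
  funext i
  simp only [pathNode]
  split_ifs with h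
  · rw [target_apply, route_apply_of_lt σ s k i h]
  · rw [route_apply_of_le σ s k i (by omega)]

/-- A function on `ℤ/M` with mean zero that is `1` away from `0`. -/
noncomputable def balanced (M : ℕ) (y : ZMod M) : ℝ := if y = 0 then -((M : ℝ) - 1) else 1

theorem sum_balanced [NeZero M] (c : ZMod M) : ∑ y : ZMod M, balanced M (c + y) = 0 := by
  have hc : ∑ y : ZMod M, balanced M (c + y) = ∑ y, balanced M y :=
    Equiv.sum_comp (Equiv.addLeft c) (balanced M)
  rw [hc]
  have h : ∀ y : ZMod M, balanced M y = 1 - if y = 0 then (M : ℝ) else 0 := by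
    intro y
    unfold balanced
    split_ifs <;> ring
  simp [h, ZMod.card]

theorem abs_balanced_le [NeZero M] (y : ZMod M) : |balanced M y| ≤ M := by
  have : (1 : ℝ) ≤ M := by exact_mod_cast NeZero.one_le
  unfold balanced
  split_ifs
  · rw [abs_neg, abs_of_nonneg (by linarith)]; linarith
  · simpa using this

/-- The input that is `z` on one edge and `0` elsewhere. -/
def bump (a : Fin (m + 1)) (v : BNode m B) (c : Fin B) (z : ZMod M) : BInput m B M :=
  Pi.single a (Pi.single v (Pi.single c z))

theorem pathSum_add (x y : BInput m B M) (s t : BNode m B) :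
    pathSum (x + y) s t = pathSum x s t + pathSum y s t := by
  simp [pathSum, Finset.sum_add_distrib]

theorem pathSum_bump (a : Fin (m + 1)) (v : BNode m B) (c : Fin B) (z : ZMod M)
    (s t : BNode m B) :
    pathSum (bump a v c z) s t = if pathNode s t a = v ∧ t a = c then z else 0 := by
  rw [pathSum, Finset.sum_eq_single a]
  · simp only [bump, Pi.single_eq_same]
    by_cases h1 : pathNode s t a = v
    · by_cases h2 : t a = c
      · simp [h1, h2]
      · simp [h1, h2]
    · simp [h1]
  · intro a' _ ha'
    simp [bump, ha']
  · simp

/-- The product of the balanced functions of the path weights for the sources in `A`. -/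
noncomputable def batchProd (A : Finset (BNode m B)) (σ : Switches m B) (x : BInput m B M) : ℝ :=
  ∏ s ∈ A, balanced M (pathSum x s (target σ s))

theorem abs_batchProd_le [NeZero M] (A : Finset (BNode m B)) (σ : Switches m B)
    (x : BInput m B M) : |batchProd A σ x| ≤ (M : ℝ) ^ B ^ (m + 1) := by
  have hM : (1 : ℝ) ≤ M := by exact_mod_cast NeZero.one_le
  rw [batchProd, Finset.abs_prod]
  calc _ ≤ ∏ s ∈ A, (M : ℝ) :=
        Finset.prod_le_prod (fun _ _ => abs_nonneg _) fun s _ => abs_balanced_le _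
    _ = (M : ℝ) ^ A.card := by simp
    _ ≤ _ := by
        refine pow_le_pow_right₀ hM ((Finset.card_le_univ _).trans ?_)
        simp

/-- Products of batches average to zero if some edge is used by exactly one path. -/
theorem sum_prod_batchProd_eq_zero [NeZero M] {L : ℕ} (A : Finset (BNode m B))
    (σ : Fin L → Switches m B) (l : Fin L) (a : Fin (m + 1)) (s : BNode m B) (hs : s ∈ A)
    (hlonely : ∀ l' ≠ l, ∀ s' ∈ A, route (σ l') s' a = route (σ l) s a →
      outDigit (σ l') a (route (σ l') s' a) ≠ outDigit (σ l) a (route (σ l) s a)) :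
    ∑ x : BInput m B M, ∏ l, batchProd A (σ l) x = 0 := by
  set v := route (σ l) s a with hv
  set c := outDigit (σ l) a v with hc
  set F : BInput m B M → ℝ := fun x => ∏ l, batchProd A (σ l) x with hF
  have hFp : ∀ x, F x = ∏ p ∈ Finset.univ ×ˢ A,
      balanced M (pathSum x p.2 (target (σ p.1) p.2)) := by
    intro x
    rw [Finset.prod_product]
    rfl
  -- Adding `z` to the weight of the edge `(a, v, c)` changes only the path of `s` in the batch `l`:
  -- other batches avoid the edge by `hlonely`, other sources by injectivity of the routing.
  -- Averaging over `z` then yields the mean of `balanced`, which is zero.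
  have hshift : ∀ p ∈ Finset.univ ×ˢ A, ∀ x z,
      pathSum (x + bump a v c z) p.2 (target (σ p.1) p.2) =
        pathSum x p.2 (target (σ p.1) p.2) + if p = (l, s) then z else (0 : ZMod M) := by
    rintro ⟨l', s'⟩ hp x z
    have hs' : s' ∈ A := (Finset.mem_product.1 hp).2
    rw [pathSum_add, pathSum_bump]
    congr 1
    simp only [pathNode_target, target_apply, Prod.mk.injEq]
    congr 1
    rw [eq_iff_iff]
    constructor
    · rintro ⟨h1, h2⟩
      by_cases hl : l' = l
      · subst hl
        exact ⟨rfl, route_injective _ _ h1⟩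
      · exact absurd (by rw [h2]) (hlonely l' hl s' hs' h1)
    · rintro ⟨rfl, rfl⟩
      exact ⟨rfl, rfl⟩
  have hmem : (l, s) ∈ Finset.univ ×ˢ A := by simp [hs]
  have hFz : ∀ x z, F (x + bump a v c z) = balanced M (pathSum x s (target (σ l) s) + z) *
      ∏ p ∈ (Finset.univ ×ˢ A).erase (l, s),
        balanced M (pathSum x p.2 (target (σ p.1) p.2)) := by
    intro x z
    rw [hFp, ← Finset.mul_prod_erase _ _ hmem]
    rw [hshift _ hmem]
    simp only [if_true]
    congr 1
    refine Finset.prod_congr rfl fun p hp => ?_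
    rw [hshift p (Finset.mem_of_mem_erase hp), if_neg (Finset.ne_of_mem_erase hp), add_zero]
  have h1 : (M : ℝ) * ∑ x, F x = ∑ z : ZMod M, ∑ x, F (x + bump a v c z) := by
    have : ∀ z : ZMod M, ∑ x, F (x + bump a v c z) = ∑ x, F x := fun z =>
      Equiv.sum_comp (Equiv.addRight (bump a v c z)) F
    simp [this, ZMod.card]
  rw [Finset.sum_comm] at h1
  have h2 : ∀ x, ∑ z : ZMod M, F (x + bump a v c z) = 0 := by
    intro x
    simp_rw [hFz, ← Finset.sum_mul, sum_balanced, zero_mul]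
  simp_rw [h2, Finset.sum_const_zero] at h1
  have hM : (M : ℝ) ≠ 0 := by exact_mod_cast NeZero.ne M
  exact (mul_eq_zero.1 h1).resolve_left hM

theorem card_switches : Fintype.card (Switches m B) = (B.factorial) ^ (B ^ m * (m + 1)) := by
  simp [Fintype.card_perm, ← pow_mul]

theorem pow_le_three_pow_mul_factorial (B : ℕ) : B ^ B ≤ 3 ^ B * B.factorial := by
  have h := Real.pow_div_factorial_le_exp (B : ℝ) (by positivity) B
  have hf : (0 : ℝ) < B.factorial := by positivity
  rw [div_le_iff₀ hf] at h
  have h2 : Real.exp B ≤ 3 ^ B := by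
    have h3 : Real.exp (B : ℝ) = Real.exp 1 ^ B := by rw [← Real.exp_nat_mul, mul_one]
    rw [h3]
    gcongr
    linarith [Real.exp_one_lt_d9]
  have h4 : (B : ℝ) ^ B ≤ 3 ^ B * B.factorial := h.trans (by gcongr)
  exact_mod_cast h4

theorem pow_le_card_switches :
    B ^ ((m + 1) * B ^ (m + 1)) ≤ 3 ^ ((m + 1) * B ^ (m + 1)) * Fintype.card (Switches m B) := by
  have h := Nat.pow_le_pow_left (pow_le_three_pow_mul_factorial B) (B ^ m * (m + 1))
  rw [mul_pow, ← pow_mul, ← pow_mul] at h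
  rw [card_switches]
  have e : (m + 1) * B ^ (m + 1) = B * (B ^ m * (m + 1)) := by ring
  rw [e]
  exact h

-- An array of digits, with a column for each batch and a row for each pair of layer and node,
-- determines the switches. An edge shared with another batch is a collision within a row. The paths
-- from `A` cover `L * ((m + 1) * A.card)` distinct entries of the array, since routing is
-- injective.
open Classical in
theorem card_nonlonely_le [NeZero B] {L e : ℕ} (A : Finset (BNode m B))
    (he : 2 * e ≤ L * ((m + 1) * A.card)) :
    (Finset.univ.filter fun σ : Fin L → Switches m B => ∀ l, ∀ a : Fin (m + 1), ∀ s ∈ A, ∃ l' ≠ l, ∃ s' ∈ A,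
      route (σ l') s' a = route (σ l) s a ∧
      outDigit (σ l') a (route (σ l') s' a) = outDigit (σ l) a (route (σ l) s a)).card ≤
    L ^ (L * ((m + 1) * B ^ (m + 1))) * B ^ (L * ((m + 1) * B ^ (m + 1)) - e) := by
  have h := card_colliding_le (I := Fin L) (R := Fin (m + 1) × BNode m B) B e (NeZero.pos B)
  simp only [Fintype.card_prod, Fintype.card_fin, Fintype.card_fun] at h
  refine le_trans ?_ h
  refine Finset.card_le_card_of_injOn (fun σ p => outDigit (σ p.1) p.2.1 p.2.2) ?_ ?_
  · intro σ hσ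
    have hσ := (Finset.mem_filter.1 hσ).2
    simp only [Finset.coe_filter, Finset.mem_univ, true_and, Set.mem_ofPred_eq]
    set ι : Fin L × Fin (m + 1) × BNode m B → Fin L × Fin (m + 1) × BNode m B :=
      fun p => (p.1, p.2.1, route (σ p.1) p.2.2 p.2.1) with hι
    have hinj : Function.Injective ι := by
      rintro ⟨l, a, s⟩ ⟨l', a', s'⟩ h
      simp only [hι, Prod.mk.injEq] at h
      obtain ⟨rfl, rfl, h⟩ := h
      rw [route_injective _ _ h]
    refine ⟨(Finset.univ ×ˢ (Finset.univ ×ˢ A)).image ι, ?_, ?_⟩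
    · rw [Finset.card_image_of_injective _ hinj]
      simpa [Finset.card_product] using he
    · intro p hp
      obtain ⟨⟨l, a, s⟩, hmem, rfl⟩ := Finset.mem_image.1 hp
      simp only [Finset.mem_product, Finset.mem_univ, true_and] at hmem
      obtain ⟨l', hl', s', hs', h1, h2⟩ := hσ l a s hmem
      refine ⟨ι (l', a, s'), Finset.mem_image_of_mem _ (by simp [hs']), ?_, ?_, h2⟩
      · intro h
        exact hl' (congrArg Prod.fst h)
      · simp [hι, h1]
  · intro σ _ σ' _ h
    funext l a u
    ext y
    have := congrFun h (l, a, Fin.insertNth a y u)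
    simp only [outDigit, Fin.removeNth_insertNth, Fin.insertNth_apply_same] at this
    rw [this]

open Classical in
/-- Fixed combinations of the batch products have small moments. -/
theorem sum_pow_sum_batchProd_le [NeZero B] [NeZero M] {L e : ℕ} (A : Finset (BNode m B))
    (he : 2 * e ≤ L * ((m + 1) * A.card)) (h : Switches m B → ℝ) (hh : ∀ σ, |h σ| ≤ 1) :
    ∑ x : BInput m B M, (∑ σ, h σ * batchProd A σ x) ^ L ≤
    Fintype.card (BInput m B M) * ((M : ℝ) ^ (L * B ^ (m + 1)) *
      ((L : ℝ) ^ (L * ((m + 1) * B ^ (m + 1))) *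
        (B : ℝ) ^ (L * ((m + 1) * B ^ (m + 1)) - e))) := by
  set bad := Finset.univ.filter fun σ : Fin L → Switches m B => ∀ l, ∀ a : Fin (m + 1), ∀ s ∈ A, ∃ l' ≠ l, ∃ s' ∈ A,
      route (σ l') s' a = route (σ l) s a ∧
      outDigit (σ l') a (route (σ l') s' a) = outDigit (σ l) a (route (σ l) s a) with hbad
  -- The `L`-th power expands into `L`-tuples of batches. A tuple with an edge on exactly one path
  -- contributes zero, and `card_nonlonely_le` counts the others.
  have hexp : ∑ x : BInput m B M, (∑ σ, h σ * batchProd A σ x) ^ L =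
      ∑ σ : Fin L → Switches m B, (∏ l, h (σ l)) *
        ∑ x : BInput m B M, ∏ l, batchProd A (σ l) x := by
    simp_rw [Fintype.sum_pow]
    rw [Finset.sum_comm]
    refine Finset.sum_congr rfl fun σ _ => ?_
    rw [Finset.mul_sum]
    exact Finset.sum_congr rfl fun x _ => Finset.prod_mul_distrib
  have hzero : ∀ σ ∉ bad, (∏ l, h (σ l)) * ∑ x : BInput m B M, ∏ l, batchProd A (σ l) x = 0 := by
    intro σ hσ
    simp only [hbad, Finset.mem_filter, Finset.mem_univ, true_and] at hσ
    push Not at hσ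
    obtain ⟨l, a, s, hs, hl⟩ := hσ
    rw [sum_prod_batchProd_eq_zero A σ l a s hs hl, mul_zero]
  have hterm : ∀ σ : Fin L → Switches m B,
      (∏ l, h (σ l)) * ∑ x : BInput m B M, ∏ l, batchProd A (σ l) x ≤
      Fintype.card (BInput m B M) * (M : ℝ) ^ (L * B ^ (m + 1)) := by
    intro σ
    refine (le_abs_self _).trans ?_
    rw [abs_mul, Finset.abs_prod]
    have h1 : ∏ l, |h (σ l)| ≤ 1 :=
      Finset.prod_le_one (fun _ _ => abs_nonneg _) fun l _ => hh _
    have h2 : |∑ x : BInput m B M, ∏ l, batchProd A (σ l) x| ≤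
        Fintype.card (BInput m B M) * (M : ℝ) ^ (L * B ^ (m + 1)) := by
      refine (Finset.abs_sum_le_sum_abs _ _).trans ?_
      calc _ ≤ ∑ x : BInput m B M, (M : ℝ) ^ (L * B ^ (m + 1)) := by
            refine Finset.sum_le_sum fun x _ => ?_
            rw [Finset.abs_prod]
            calc _ ≤ ∏ l : Fin L, (M : ℝ) ^ B ^ (m + 1) :=
                  Finset.prod_le_prod (fun _ _ => abs_nonneg _) fun l _ => abs_batchProd_le _ _ _
              _ = _ := by simp [← pow_mul, mul_comm]
        _ = _ := by simp
    calc _ ≤ 1 * _ := mul_le_mul h1 h2 (abs_nonneg _) zero_le_one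
      _ = _ := one_mul _
  rw [hexp, ← Finset.sum_subset (Finset.subset_univ bad) fun σ _ hσ => hzero σ hσ]
  calc _ ≤ ∑ σ ∈ bad, Fintype.card (BInput m B M) * (M : ℝ) ^ (L * B ^ (m + 1)) :=
        Finset.sum_le_sum fun σ _ => hterm σ
    _ = (Fintype.card (BInput m B M) * (M : ℝ) ^ (L * B ^ (m + 1))) * bad.card := by
        simp [mul_comm]
    _ ≤ (Fintype.card (BInput m B M) * (M : ℝ) ^ (L * B ^ (m + 1))) *
        ((L : ℝ) ^ (L * ((m + 1) * B ^ (m + 1))) *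
        (B : ℝ) ^ (L * ((m + 1) * B ^ (m + 1)) - e)) := by
        gcongr
        exact_mod_cast card_nonlonely_le A he
    _ = _ := by ring

/-- Every path has weight zero for a fraction `1 / M` of the inputs. -/
theorem card_pathSum_eq_zero [NeZero M] (s t : BNode m B) :
    M * (Finset.univ.filter fun x : BInput m B M => pathSum x s t = 0).card =
      Fintype.card (BInput m B M) := by
  set a : Fin (m + 1) := 0
  have hsum : ∀ x (z : ZMod M), pathSum (x + bump a (pathNode s t a) (t a) z) s t =
      pathSum x s t + z := by
    intro x z
    rw [pathSum_add, pathSum_bump, if_pos ⟨rfl, rfl⟩]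
  have h1 : M * (Finset.univ.filter fun x : BInput m B M => pathSum x s t = 0).card =
      ∑ z : ZMod M, ∑ x : BInput m B M,
        if pathSum (x + bump a (pathNode s t a) (t a) z) s t = 0 then 1 else 0 := by
    have : ∀ z : ZMod M, (∑ x : BInput m B M,
        if pathSum (x + bump a (pathNode s t a) (t a) z) s t = 0 then 1 else 0) =
        (Finset.univ.filter fun x : BInput m B M => pathSum x s t = 0).card := by
      intro z
      rw [Finset.card_filter]
      exact Equiv.sum_comp (Equiv.addRight (bump a (pathNode s t a) (t a) z))
        (fun x : BInput m B M => if pathSum x s t = 0 then 1 else 0)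
    simp [this, ZMod.card]
  rw [h1, Finset.sum_comm]
  simp_rw [hsum]
  have h2 : ∀ x : BInput m B M, (∑ z : ZMod M, if pathSum x s t + z = 0 then 1 else 0) = 1 := by
    intro x
    rw [Finset.sum_eq_single (-pathSum x s t)]
    · simp
    · intro z _ hz
      rw [if_neg]
      intro h
      exact hz (eq_neg_of_add_eq_zero_right h)
    · simp
  simp [h2]

/-- Change the switches such that all sinks are shifted by `z`. -/
def shiftSwitches [NeZero B] (z : BNode m B) (σ : Switches m B) : Switches m B := fun a u =>
  (σ a (u - a.removeNth (pathNode 0 z a))).trans (Equiv.addRight (z a))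

/-- `pathNode 0 z k` is `z` with the digits from `k` on set to `0`: only digits that were already
written are shifted. The definition of `shiftSwitches` undoes this shift when it selects the
permutation. -/
theorem route_shiftSwitches [NeZero B] (z : BNode m B) (σ : Switches m B) (s : BNode m B) (k : ℕ)
    (hk : k ≤ m + 1) : route (shiftSwitches z σ) s k = route σ s k + pathNode 0 z k := by
  induction k with
  | zero =>
    funext i
    simp [route, pathNode]
  | succ k ih =>
    have hk' : k < m + 1 := by omega
    specialize ih hk'.le
    set a : Fin (m + 1) := ⟨k, hk'⟩ with ha
    rw [show k + 1 = (a : ℕ) + 1 from rfl, route_succ, route_succ, show (a : ℕ) = k from rfl, ih]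
    have hza : pathNode 0 z k a = 0 := by simp [pathNode, ha]
    have hout : outDigit (shiftSwitches z σ) a (route σ s k + pathNode 0 z k) =
        outDigit σ a (route σ s k) + z a := by
      have hrem : a.removeNth (route σ s k + pathNode 0 z k) - a.removeNth (pathNode 0 z a) =
          a.removeNth (route σ s k) := by
        funext i
        simp [Fin.removeNth, ha]
      simp only [outDigit, shiftSwitches, hrem, Equiv.trans_apply, Equiv.coe_addRight, Pi.add_apply,
        hza, add_zero]
    rw [hout]
    funext i
    by_cases hi : i = a
    · subst hi
      simp [pathNode, ha]
    · simp only [Function.update_of_ne hi, Pi.add_apply, pathNode]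
      have : (i : ℕ) < k ↔ (i : ℕ) < k + 1 := by
        have : (i : ℕ) ≠ k := fun h => hi (Fin.ext h)
        omega
      simp [this]

theorem target_shiftSwitches [NeZero B] (z : BNode m B) (σ : Switches m B) (s : BNode m B) :
    target (shiftSwitches z σ) s = target σ s + z := by
  rw [target, route_shiftSwitches z σ s _ le_rfl, target]
  congr 1
  funext i
  have h : (i : ℕ) < m + 1 := i.2
  simp only [pathNode, h, if_true]

theorem shiftSwitches_neg [NeZero B] (z : BNode m B) (σ : Switches m B) :
    shiftSwitches (-z) (shiftSwitches z σ) = σ := by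
  funext a u
  ext y
  have : u - a.removeNth (pathNode 0 (-z) a) - a.removeNth (pathNode 0 z a) = u := by
    funext i
    simp only [Fin.removeNth, pathNode, Pi.sub_apply, Pi.neg_apply, Pi.zero_apply]
    split_ifs <;> simp
  simp [shiftSwitches, this]

/-- Uniformly random switches send every source to a uniformly random sink. -/
theorem sum_target [NeZero B] (g : BNode m B → ℝ) (s : BNode m B) :
    (B : ℝ) ^ (m + 1) * ∑ σ : Switches m B, g (target σ s) =
      Fintype.card (Switches m B) * ∑ t, g t := by
  have hbij : ∀ z : BNode m B, Function.Bijective (shiftSwitches z) := fun z =>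
    Function.bijective_iff_has_inverse.2 ⟨shiftSwitches (-z), shiftSwitches_neg z, fun σ => by
      simpa using shiftSwitches_neg (-z) σ⟩
  have h1 : ∀ z : BNode m B, ∑ σ : Switches m B, g (target σ s + z) =
      ∑ σ : Switches m B, g (target σ s) := by
    intro z
    rw [← (hbij z).sum_comp fun σ => g (target σ s)]
    simp_rw [target_shiftSwitches]
  have h2 : (B : ℝ) ^ (m + 1) * ∑ σ : Switches m B, g (target σ s) =
      ∑ z : BNode m B, ∑ σ : Switches m B, g (target σ s + z) := by
    simp [h1]
  rw [h2, Finset.sum_comm]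
  have h3 : ∀ σ : Switches m B, ∑ z, g (target σ s + z) = ∑ t, g t := fun σ =>
    Equiv.sum_comp (Equiv.addLeft (target σ s)) g
  simp [h3]

end Butterfly

/-! ### Transferring an edge list to the nodes `0, …, n - 1`. -/

section MappedEdges

theorem reflTransGen_map_iff {V : Type} {n : ℕ} (φ : V ↪ Fin n) (l : List (V × V)) (u v : V) :
    Reaches (l.map (Prod.map φ φ)) (φ u) (φ v) ↔
      Relation.ReflTransGen (fun a b => (a, b) ∈ l) u v := by
  constructor
  · intro h
    have key : ∀ y, Relation.ReflTransGen (Edge (l.map (Prod.map φ φ))) (φ u) y →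
        ∃ v', y = φ v' ∧ Relation.ReflTransGen (fun a b => (a, b) ∈ l) u v' := by
      intro y hy
      induction hy with
      | refl => exact ⟨u, rfl, Relation.ReflTransGen.refl⟩
      | tail _ hbc ih =>
        obtain ⟨b, rfl, hb⟩ := ih
        obtain ⟨⟨p, q⟩, hpq, h⟩ := List.mem_map.1 hbc
        simp only [Prod.map_apply, Prod.mk.injEq, EmbeddingLike.apply_eq_iff_eq] at h
        obtain ⟨rfl, rfl⟩ := h
        exact ⟨q, rfl, hb.tail hpq⟩
    obtain ⟨v', h1, h2⟩ := key _ h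
    rwa [φ.injective h1]
  · intro h
    induction h with
    | refl => exact Relation.ReflTransGen.refl
    | tail _ hbc ih => exact ih.tail (List.mem_map.2 ⟨_, hbc, rfl⟩)

/-- Edge lists along which a rank increases are legal. -/
theorem validInsertions_map {V : Type} {n : ℕ} (φ : V ↪ Fin n) (l : List (V × V))
    (hnd : l.Nodup) (rank : V → ℕ) (hrank : ∀ p ∈ l, rank p.1 < rank p.2) :
    ValidInsertions (l.map (Prod.map φ φ)) := by
  refine ⟨hnd.map (φ.injective.prodMap φ.injective), fun v hv => ?_⟩
  -- Nodes outside the range of `φ` get rank `0`; no edge touches them.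
  set f := Function.extend φ rank 0 with hf
  have hlt : ∀ a b, Relation.TransGen (Edge (l.map (Prod.map φ φ))) a b → f a < f b := by
    intro a b hab
    have hstep : ∀ a b, Edge (l.map (Prod.map φ φ)) a b → f a < f b := by
      intro a b h
      obtain ⟨⟨p, q⟩, hpq, h⟩ := List.mem_map.1 h
      simp only [Prod.map_apply, Prod.mk.injEq] at h
      obtain ⟨rfl, rfl⟩ := h
      rw [hf, φ.injective.extend_apply, φ.injective.extend_apply]
      exact hrank _ hpq
    induction hab with
    | single h => exact hstep _ _ h
    | tail _ h ih => exact ih.trans (hstep _ _ h)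
  exact lt_irrefl _ (hlt v v hv)

theorem ValidInsertions.of_append {n : ℕ} {l l' : List (Fin n × Fin n)}
    (h : ValidInsertions (l ++ l')) : ValidInsertions l := by
  refine ⟨(List.nodup_append.1 h.1).1, fun v hv => h.2 v ?_⟩
  have hle : Edge l ≤ Edge (l ++ l') := fun a b hab => List.mem_append_left _ hab
  exact Relation.TransGen.mono hle v v hv

end MappedEdges

/-! ### The hard graph: a union of weighted butterflies. -/

section Graph
variable (ℓ B M : ℕ)

/-- The butterfly of epoch `e` has depth `epochDepth ℓ e + 1`. -/
def epochDepth (e : ℕ) : ℕ := 2 * (ℓ - 1 - e) + 1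

theorem epochDepth_le (e : ℕ) : epochDepth ℓ e + 1 ≤ epochDepth ℓ 0 + 1 := by
  unfold epochDepth
  omega

/-- The labels of the sources and of the sinks. -/
abbrev Terminal : Type := BNode (epochDepth ℓ 0) B

/-- The inputs of all epochs. -/
abbrev Inputs : Type := ∀ e : Fin ℓ, BInput (epochDepth ℓ e) B M

/-- The nodes of the union of butterflies: sources, sinks and, for each epoch, layers of nodes
that carry a partial path weight. -/
abbrev GNode : Type :=
  Terminal ℓ B ⊕ Terminal ℓ B ⊕
    (Σ e : Fin ℓ, Fin (epochDepth ℓ e + 2) × BNode (epochDepth ℓ e) B × ZMod M)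

variable {ℓ B M}

/-- The first digits of a label. -/
def restrict (s : Terminal ℓ B) (e : ℕ) : BNode (epochDepth ℓ e) B :=
  fun i => s (Fin.castLE (epochDepth_le ℓ e) i)

/-- A source. -/
def src (s : Terminal ℓ B) : GNode ℓ B M := Sum.inl s

/-- A sink. -/
def snk (t : Terminal ℓ B) : GNode ℓ B M := Sum.inr (Sum.inl t)

/-- A node of the butterfly of epoch `e`. -/
def mid (e : Fin ℓ) (a : Fin (epochDepth ℓ e + 2)) (v : BNode (epochDepth ℓ e) B) (r : ZMod M) :
    GNode ℓ B M := Sum.inr (Sum.inr ⟨e, a, v, r⟩)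

theorem mid_inj {e e' : Fin ℓ} {a a' v v'} {r r' : ZMod M}
    (h : (mid e a v r : GNode ℓ B M) = mid e' a' v' r') :
    (⟨e, a, v, r⟩ : Σ e : Fin ℓ, Fin (epochDepth ℓ e + 2) × BNode (epochDepth ℓ e) B × ZMod M) =
      ⟨e', a', v', r'⟩ :=
  Sum.inr_injective (Sum.inr_injective h)

/-- The weight of the first `k` edges of the path from `s` to `v`. -/
def partialSum {m : ℕ} (x : BInput m B M) (s v : BNode m B) (k : ℕ) : ZMod M :=
  ∑ a : Fin (m + 1), if (a : ℕ) < k then x a (pathNode s v a) (v a) else 0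

theorem partialSum_succ {m : ℕ} (x : BInput m B M) (s v : BNode m B) (a : Fin (m + 1)) (c : Fin B) :
    partialSum x s (Function.update v a c) (a + 1) =
      partialSum x s v a + x a (pathNode s v a) c := by
  have hpath : ∀ a' : Fin (m + 1), (a' : ℕ) ≤ a →
      pathNode s (Function.update v a c) a' = pathNode s v a' := by
    intro a' ha'
    funext i
    simp only [pathNode]
    split_ifs with h
    · rw [Function.update_of_ne]
      rintro rfl
      omega
    · rfl
  have hterm : ∀ a' : Fin (m + 1), (if (a' : ℕ) < a + 1 then
      x a' (pathNode s (Function.update v a c) a') (Function.update v a c a') else 0) =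
      (if (a' : ℕ) < a then x a' (pathNode s v a') (v a') else 0) +
        if a' = a then x a (pathNode s v a) c else 0 := by
    intro a'
    rcases lt_trichotomy (a' : ℕ) a with h | h | h
    · have hne : a' ≠ a := fun h' => by rw [h'] at h; exact lt_irrefl _ h
      rw [if_pos (by omega), if_pos h, if_neg hne, hpath a' h.le, Function.update_of_ne hne, add_zero]
    · have he : a' = a := Fin.ext h
      subst he
      simp [hpath a' le_rfl]
    · have hne : a' ≠ a := fun h' => by rw [h'] at h; exact lt_irrefl _ h
      rw [if_neg (by omega), if_neg (by omega), if_neg hne, add_zero]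
  simp only [partialSum, hterm, Finset.sum_add_distrib]
  simp

theorem partialSum_last {m : ℕ} (x : BInput m B M) (s t : BNode m B) :
    partialSum x s t (m + 1) = pathSum x s t := by
  unfold partialSum pathSum
  refine Finset.sum_congr rfl fun a _ => ?_
  rw [if_pos a.2]

variable (ℓ B M) in
/-- The edges between the terminals and the butterflies. -/
noncomputable def baseEdges [NeZero M] : List (GNode ℓ B M × GNode ℓ B M) :=
  ((Finset.univ : Finset (Terminal ℓ B × Fin ℓ)).toList.map fun p =>
    (src p.1, mid p.2 0 (restrict p.1 p.2) 0)) ++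
  ((Finset.univ : Finset (Terminal ℓ B × Fin ℓ)).toList.map fun p =>
    (mid p.2 (Fin.last _) (restrict p.1 p.2) 0, snk p.1))

/-- The edges of epoch `e`. -/
noncomputable def epochEdges [NeZero M] (e : Fin ℓ) (x : BInput (epochDepth ℓ e) B M) :
    List (GNode ℓ B M × GNode ℓ B M) :=
  (Finset.univ : Finset (Fin (epochDepth ℓ e + 1) × BNode (epochDepth ℓ e) B × Fin B ×
    ZMod M)).toList.map fun p =>
    (mid e p.1.castSucc p.2.1 p.2.2.2,
      mid e p.1.succ (Function.update p.2.1 p.1 p.2.2.1) (p.2.2.2 + x p.1 p.2.1 p.2.2.1))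

/-- The edges that are inserted before epoch `k`. -/
noncomputable def history [NeZero M] (x : Inputs ℓ B M) : ℕ → List (GNode ℓ B M × GNode ℓ B M)
  | 0 => baseEdges ℓ B M
  | k + 1 => history x k ++ if h : k < ℓ then epochEdges ⟨k, h⟩ (x ⟨k, h⟩) else []

variable [NeZero M]

theorem length_epochEdges (e : Fin ℓ) (x : BInput (epochDepth ℓ e) B M) :
    (epochEdges e x).length =
      (epochDepth ℓ e + 1) * (B ^ (epochDepth ℓ e + 1) * (B * M)) := by
  simp [epochEdges, ZMod.card]

theorem history_succ (x : Inputs ℓ B M) (e : Fin ℓ) :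
    history x (e + 1) = history x e ++ epochEdges e (x e) := by
  simp [history]

theorem mem_history {x : Inputs ℓ B M} {k : ℕ} {p : GNode ℓ B M × GNode ℓ B M} :
    p ∈ history x k ↔ p ∈ baseEdges ℓ B M ∨ ∃ e : Fin ℓ, (e : ℕ) < k ∧ p ∈ epochEdges e (x e) := by
  induction k with
  | zero => simp [history]
  | succ k ih =>
    simp only [history, List.mem_append, ih]
    constructor
    · rintro ((h | ⟨e, he, h⟩) | h)
      · exact Or.inl h
      · exact Or.inr ⟨e, by omega, h⟩
      · split_ifs at h with hk
        · exact Or.inr ⟨⟨k, hk⟩, by simp, h⟩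
        · simp at h
    · rintro (h | ⟨e, he, h⟩)
      · exact Or.inl (Or.inl h)
      · rcases Nat.lt_succ_iff_lt_or_eq.1 he with h1 | h1
        · exact Or.inl (Or.inr ⟨e, h1, h⟩)
        · right
          subst h1
          simpa using h

/-- A rank that increases along all edges. -/
def gRank : GNode ℓ B M → ℕ
  | Sum.inl _ => 0
  | Sum.inr (Sum.inl _) => epochDepth ℓ 0 + 3
  | Sum.inr (Sum.inr p) => p.2.1 + 1

theorem gRank_lt {x : Inputs ℓ B M} {k : ℕ} : ∀ p ∈ history x k, gRank p.1 < gRank p.2 := by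
  intro p hp
  rcases mem_history.1 hp with h | ⟨e, -, h⟩
  · simp only [baseEdges, List.mem_append, List.mem_map, Finset.mem_toList, Finset.mem_univ,
      true_and] at h
    rcases h with ⟨q, rfl⟩ | ⟨q, rfl⟩
    · simp [gRank, src, mid]
    · have := epochDepth_le ℓ q.2
      simp only [gRank, snk, mid, Fin.val_last]
      omega
  · simp only [epochEdges, List.mem_map, Finset.mem_toList, Finset.mem_univ, true_and] at h
    obtain ⟨q, rfl⟩ := h
    simp [gRank, mid]

theorem nodup_baseEdges : (baseEdges ℓ B M).Nodup := by
  refine List.Nodup.append ?_ ?_ ?_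
  · refine (Finset.nodup_toList _).map fun p q h => ?_
    simp only [Prod.mk.injEq] at h
    have h1 := Sum.inl_injective h.1
    have h2 := congrArg Sigma.fst (mid_inj h.2)
    exact Prod.ext h1 h2
  · refine (Finset.nodup_toList _).map fun p q h => ?_
    simp only [Prod.mk.injEq] at h
    have h1 := Sum.inl_injective (Sum.inr_injective h.2)
    have h2 := congrArg Sigma.fst (mid_inj h.1)
    exact Prod.ext h1 h2
  · intro p hp hq
    simp only [List.mem_map] at hp hq
    obtain ⟨a, -, rfl⟩ := hp
    obtain ⟨b, -, h⟩ := hq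
    simp [src, mid] at h

theorem nodup_epochEdges (e : Fin ℓ) (x : BInput (epochDepth ℓ e) B M) :
    (epochEdges e x).Nodup := by
  refine (Finset.nodup_toList _).map ?_
  rintro ⟨a, v, c, r⟩ ⟨a', v', c', r'⟩ h
  simp only [Prod.mk.injEq] at h
  have h1 := eq_of_heq (Sigma.mk.inj (mid_inj h.1)).2
  have h2 := eq_of_heq (Sigma.mk.inj (mid_inj h.2)).2
  simp only [Prod.mk.injEq] at h1 h2
  obtain ⟨ha, rfl, rfl⟩ := h1
  have ha : a = a' := Fin.castSucc_injective _ ha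
  subst ha
  have hc := congrFun h2.2.1 a
  simp only [Function.update_self] at hc
  rw [hc]

theorem nodup_history (x : Inputs ℓ B M) (k : ℕ) : (history x k).Nodup := by
  induction k with
  | zero => exact nodup_baseEdges
  | succ k ih =>
    simp only [history]
    split_ifs with hk
    · refine List.Nodup.append ih (nodup_epochEdges _ _) fun p hp hq => ?_
      simp only [epochEdges, List.mem_map, Finset.mem_toList, Finset.mem_univ, true_and] at hq
      obtain ⟨q, rfl⟩ := hq
      rcases mem_history.1 hp with h | ⟨e, he, h⟩
      · simp only [baseEdges, List.mem_append, List.mem_map, Finset.mem_toList, Finset.mem_univ,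
          true_and, Prod.mk.injEq] at h
        rcases h with ⟨q, h, -⟩ | ⟨q, -, h⟩
        · simp [src, mid] at h
        · simp [snk, mid] at h
      · simp only [epochEdges, List.mem_map, Finset.mem_toList, Finset.mem_univ, true_and,
          Prod.mk.injEq] at h
        obtain ⟨q', h, -⟩ := h
        have := congrArg Sigma.fst (mid_inj h)
        simp only at this
        rw [this] at he
        simp at he
    · simpa using ih

theorem validInsertions_history {n : ℕ} (φ : GNode ℓ B M ↪ Fin n) (x : Inputs ℓ B M) (k : ℕ) :
    ValidInsertions ((history x k).map (Prod.map φ φ)) :=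
  validInsertions_map φ _ (nodup_history x k) gRank gRank_lt

/-- What holds for the nodes that are reachable from the source `s`. -/
def Reachable (x : Inputs ℓ B M) (s : Terminal ℓ B) : GNode ℓ B M → Prop
  | Sum.inl s' => s' = s
  | Sum.inr (Sum.inl t) => ∃ e : Fin ℓ, pathSum (x e) (restrict s e) (restrict t e) = 0
  | Sum.inr (Sum.inr ⟨e, a, v, r⟩) => (∀ i : Fin (epochDepth ℓ e + 1), (a : ℕ) ≤ i →
      v i = restrict s e i) ∧ r = partialSum (x e) (restrict s e) v a

/-- An edge of layer `a` writes the digit `a` and adds its weight to the stored partial weight, so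
the node keeps describing the unique path from `s`. Sinks are entered only from the last layer at
stored weight `0`, which means a path of weight zero. -/
theorem reachable_of_edge {x : Inputs ℓ B M} {s : Terminal ℓ B} {u v : GNode ℓ B M}
    (hu : Reachable x s u) (huv : (u, v) ∈ history x ℓ) : Reachable x s v := by
  rcases mem_history.1 huv with h | ⟨e, -, h⟩
  · simp only [baseEdges, List.mem_append, List.mem_map, Finset.mem_toList, Finset.mem_univ,
      true_and, Prod.mk.injEq] at h
    rcases h with ⟨q, rfl, rfl⟩ | ⟨q, rfl, rfl⟩
    · have : q.1 = s := hu
      subst this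
      exact ⟨fun i _ => rfl, by simp [partialSum]⟩
    · obtain ⟨-, h⟩ := hu
      rw [Fin.val_last, partialSum_last] at h
      exact ⟨q.2, h.symm⟩
  · simp only [epochEdges, List.mem_map, Finset.mem_toList, Finset.mem_univ, true_and,
      Prod.mk.injEq] at h
    obtain ⟨⟨a, v, c, r⟩, rfl, rfl⟩ := h
    obtain ⟨h1, h2⟩ := hu
    refine ⟨fun i hi => ?_, ?_⟩
    · have hi' : (a : ℕ) + 1 ≤ i := by simpa using hi
      simp only
      rw [Function.update_of_ne (by rintro rfl; omega)]
      exact h1 i (by simp; omega)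
    · have hv : pathNode (restrict s e) v a = v := by
        funext i
        simp only [pathNode]
        split_ifs with h
        · rfl
        · exact (h1 i (by simp; omega)).symm
      simp only [Fin.val_succ, Fin.val_castSucc] at h2 ⊢
      rw [partialSum_succ, hv, h2]

theorem reflTransGen_history_iff (x : Inputs ℓ B M) (s t : Terminal ℓ B) :
    Relation.ReflTransGen (fun a b => (a, b) ∈ history x ℓ) (src s) (snk t) ↔
      ∃ e : Fin ℓ, pathSum (x e) (restrict s e) (restrict t e) = 0 := by
  constructor
  · intro h
    have key : ∀ y, Relation.ReflTransGen (fun a b => (a, b) ∈ history x ℓ) (src s) y →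
        Reachable x s y := by
      intro y hy
      induction hy with
      | refl => exact rfl
      | tail _ hbc ih => exact reachable_of_edge ih hbc
    exact key _ h
  · rintro ⟨e, he⟩
    have key : ∀ k (hk : k < epochDepth ℓ e + 2),
        Relation.ReflTransGen (fun a b => (a, b) ∈ history x ℓ) (src s)
          (mid e ⟨k, hk⟩ (pathNode (restrict s e) (restrict t e) k)
            (partialSum (x e) (restrict s e) (restrict t e) k)) := by
      intro k
      induction k with
      | zero =>
        intro hk
        refine Relation.ReflTransGen.single (mem_history.2 (Or.inl ?_))
        refine List.mem_append_left _ (List.mem_map.2 ⟨(s, e), by simp, ?_⟩)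
        have h1 : pathNode (restrict s e) (restrict t e) 0 = restrict s e := by
          funext i; simp [pathNode]
        rw [h1]
        simp [partialSum]
      | succ k ih =>
        intro hk
        have hk' : k < epochDepth ℓ e + 1 := by omega
        refine (ih (by omega)).tail (mem_history.2 (Or.inr ⟨e, e.2, ?_⟩))
        set a : Fin (epochDepth ℓ e + 1) := ⟨k, hk'⟩ with ha
        refine List.mem_map.2 ⟨(a, pathNode (restrict s e) (restrict t e) k, restrict t e a,
          partialSum (x e) (restrict s e) (restrict t e) k), by simp, ?_⟩
        have h1 : Function.update (pathNode (restrict s e) (restrict t e) k) a (restrict t e a) =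
            pathNode (restrict s e) (restrict t e) (k + 1) := by
          funext i
          by_cases hi : i = a
          · subst hi; simp [pathNode, ha]
          · rw [Function.update_of_ne hi]
            have : (i : ℕ) ≠ k := fun h => hi (Fin.ext h)
            simp only [pathNode]
            have : (i : ℕ) < k ↔ (i : ℕ) < k + 1 := by omega
            simp [this]
        have h2 := partialSum_succ (x e) (restrict s e) (restrict t e) a (restrict t e a)
        rw [Function.update_eq_self] at h2
        have h3 : (a : ℕ) = k := rfl
        rw [h3] at h2
        simp only [h1, ← h2]
        rfl
    have hlast := key (epochDepth ℓ e + 1) (by omega)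
    refine hlast.tail (mem_history.2 (Or.inl ?_))
    refine List.mem_append_right _ (List.mem_map.2 ⟨(t, e), by simp, ?_⟩)
    have h1 : pathNode (restrict s e) (restrict t e) (epochDepth ℓ e + 1) = restrict t e := by
      funext i
      simp only [pathNode, i.2, if_true]
    rw [h1, partialSum_last, he]
    rfl

/-- A source reaches a sink iff the path in one of the butterflies has weight zero. -/
theorem reaches_history_iff {n : ℕ} (φ : GNode ℓ B M ↪ Fin n) (x : Inputs ℓ B M)
    (s t : Terminal ℓ B) :
    Reaches ((history x ℓ).map (Prod.map φ φ)) (φ (src s)) (φ (snk t)) ↔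
      ∃ e : Fin ℓ, pathSum (x e) (restrict s e) (restrict t e) = 0 := by
  rw [reflTransGen_map_iff, reflTransGen_history_iff]

/-- The graph fits into `n` nodes. -/
theorem card_gNode_le (hℓ : 1 ≤ ℓ) (hB : 2 + ℓ * ((2 * ℓ + 1) * M) ≤ B) :
    Fintype.card (GNode ℓ B M) ≤ B ^ (2 * ℓ + 1) := by
  have hB0 : 0 < B := by omega
  have hd : epochDepth ℓ 0 + 1 = 2 * ℓ := by unfold epochDepth; omega
  have h1 : ∀ e : Fin ℓ, (epochDepth ℓ e + 2) * (B ^ (epochDepth ℓ e + 1) * M) ≤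
      (2 * ℓ + 1) * (B ^ (2 * ℓ) * M) := by
    intro e
    have h2 := epochDepth_le ℓ e
    have h3 : B ^ (epochDepth ℓ e + 1) ≤ B ^ (2 * ℓ) := Nat.pow_le_pow_right hB0 (by omega)
    exact Nat.mul_le_mul (by omega) (Nat.mul_le_mul_right _ h3)
  simp only [Fintype.card_sum, Fintype.card_sigma, Fintype.card_prod, Fintype.card_fin,
    Fintype.card_fun, ZMod.card, hd]
  calc B ^ (2 * ℓ) + (B ^ (2 * ℓ) + ∑ e : Fin ℓ, (epochDepth ℓ e + 2) *
        (B ^ (epochDepth ℓ e + 1) * M))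
      ≤ B ^ (2 * ℓ) + (B ^ (2 * ℓ) + ∑ e : Fin ℓ, (2 * ℓ + 1) * (B ^ (2 * ℓ) * M)) := by
        exact Nat.add_le_add_left (Nat.add_le_add_left (Finset.sum_le_sum fun e _ => h1 e) _) _
    _ = B ^ (2 * ℓ) * (2 + ℓ * ((2 * ℓ + 1) * M)) := by
        simp only [Finset.sum_const, Finset.card_univ, Fintype.card_fin, smul_eq_mul]; ring
    _ ≤ B ^ (2 * ℓ) * B := Nat.mul_le_mul_left _ hB
    _ = _ := (pow_succ _ _).symm

end Graph

/-! ### Assigning each cell to the epoch of its last change. -/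

section MemoryChanges
variable {n w : ℕ}

theorem diffCells_subset_union (m m' m'' : Memory w) :
    diffCells m m'' ⊆ diffCells m m' ∪ diffCells m' m'' := by
  intro a ha
  rw [Finset.mem_union, mem_diffCells, mem_diffCells]
  rw [mem_diffCells] at ha
  by_cases h : m' a = m a
  · right; rwa [h]
  · exact Or.inl h

theorem card_diffCells_memory_append_le {D : ReachabilityDS n w} {tu : ℕ}
    (hD : D.UpdateTimeLE tu) (l l' : List (Fin n × Fin n)) (hv : ValidInsertions (l ++ l')) :
    (diffCells (D.memory l) (D.memory (l ++ l'))).card ≤ tu * l'.length := by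
  induction l' using List.reverseRecOn with
  | nil => simp [diffCells]
  | append_singleton l' u ih =>
    rw [← List.append_assoc] at hv ⊢
    have h1 := ih hv.of_append
    have h2 : D.memory (l ++ l' ++ [u]) = (D.update u).run (D.memory (l ++ l')) := by
      simp [DataStructure.memory]
    have h3 := (UpdateTree.card_diffCells_run_le (D.update u) (D.memory (l ++ l'))).trans
      (hD (l ++ l') u hv)
    rw [← h2] at h3
    refine (Finset.card_le_card (diffCells_subset_union _ (D.memory (l ++ l')) _)).trans
      ((Finset.card_union_le _ _).trans ?_)
    simp only [List.length_append, List.length_singleton]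
    nlinarith

/-- The cells that change for the last time in step `e` of a sequence of memory states. -/
def lastChanged (st : ℕ → Memory w) (ℓ e : ℕ) : Finset (Addr w) :=
  Finset.univ.filter fun a => st (e + 1) a ≠ st e a ∧
    ∀ k ∈ Finset.Ioo e ℓ, st (k + 1) a = st k a

/-- The cells that change after step `e`. -/
def laterChanged (st : ℕ → Memory w) (ℓ e : ℕ) : Finset (Addr w) :=
  (Finset.Ioo e ℓ).biUnion fun k => diffCells (st k) (st (k + 1))

theorem lastChanged_subset (st : ℕ → Memory w) (ℓ e : ℕ) :
    lastChanged st ℓ e ⊆ diffCells (st e) (st (e + 1)) := by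
  intro a ha
  rw [mem_diffCells]
  exact (Finset.mem_filter.1 ha).2.1

/-- This splits the final memory into the state before epoch `e`, the cells changed later and the
cells that only epoch `e` accounts for. -/
theorem eq_of_notMem_changed {st : ℕ → Memory w} {ℓ e : ℕ} (he : e < ℓ) {a : Addr w}
    (h1 : a ∉ laterChanged st ℓ e) (h2 : a ∉ lastChanged st ℓ e) : st ℓ a = st e a := by
  have hlater : ∀ k ∈ Finset.Ioo e ℓ, st (k + 1) a = st k a := by
    intro k hk
    by_contra h
    exact h1 (Finset.mem_biUnion.2 ⟨k, hk, mem_diffCells.2 h⟩)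
  have hchain : ∀ k, e + 1 ≤ k → k ≤ ℓ → st k a = st (e + 1) a := by
    intro k hk
    induction k, hk using Nat.le_induction with
    | base => exact fun _ => rfl
    | succ k hk ih =>
      intro hkℓ
      rw [hlater k (Finset.mem_Ioo.2 ⟨by omega, by omega⟩)]
      exact ih (by omega)
  rw [hchain ℓ (by omega) le_rfl]
  by_contra h
  exact h2 (Finset.mem_filter.2 ⟨Finset.mem_univ _, h, hlater⟩)

/-- A cell has only one last change, so the sets for different epochs are disjoint. -/
theorem sum_card_inter_lastChanged_le (st : ℕ → Memory w) (ℓ h : ℕ) (hh : h ≤ ℓ)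
    (V : Finset (Addr w)) :
    ∑ e ∈ Finset.range h, (V ∩ lastChanged st ℓ e).card ≤ V.card := by
  rw [← Finset.card_biUnion]
  · refine Finset.card_le_card fun a ha => ?_
    obtain ⟨e, -, h⟩ := Finset.mem_biUnion.1 ha
    exact (Finset.mem_inter.1 h).1
  · have key : ∀ e e', e < e' → e' < h → Disjoint (V ∩ lastChanged st ℓ e)
        (V ∩ lastChanged st ℓ e') := by
      intro e e' hee' he'
      refine Finset.disjoint_left.2 fun a ha ha' => ?_
      have h1 := (Finset.mem_filter.1 (Finset.mem_inter.1 ha).2).2.2 e'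
        (Finset.mem_Ioo.2 ⟨hee', by omega⟩)
      exact (Finset.mem_filter.1 (Finset.mem_inter.1 ha').2).2.1 h1
    intro e he e' he' hne
    have he := Finset.mem_range.1 he
    have he' := Finset.mem_range.1 he'
    rcases lt_or_gt_of_ne hne with h1 | h1
    · exact key e e' h1 he'
    · exact (key e' e h1 he).symm

end MemoryChanges

/-! ### Averages over inputs and queries. -/

section Averages
variable {ℓ B M : ℕ}

/-- The label with first digits `s` and remaining digits as in `s'`. -/
def extend (e : ℕ) (s : BNode (epochDepth ℓ e) B) (s' : Terminal ℓ B) : Terminal ℓ B :=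
  fun i => if h : (i : ℕ) < epochDepth ℓ e + 1 then s ⟨i, h⟩ else s' i

theorem restrict_extend (e : ℕ) (s : BNode (epochDepth ℓ e) B) (s' : Terminal ℓ B) :
    restrict (extend e s s') e = s := by
  funext i
  have h : (i : ℕ) < epochDepth ℓ e + 1 := i.2
  simp [restrict, extend, h]

theorem extend_restrict (e : ℕ) (s : BNode (epochDepth ℓ e) B) (s' : Terminal ℓ B) :
    extend e (restrict s' e) (extend e s s') = s' := by
  funext i
  by_cases h : (i : ℕ) < epochDepth ℓ e + 1
  · simp [restrict, extend, h]
  · simp [extend, h]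

/-- Exchanging `s` with the first digits of `s'` is an involution on pairs, so resampling these
digits preserves the uniform distribution. `sum_update` exchanges the input of one epoch in the same
way. -/
theorem sum_extend (e : ℕ) (g : Terminal ℓ B → ℝ) :
    ∑ s', ∑ s, g (extend e s s') = (B : ℝ) ^ (epochDepth ℓ e + 1) * ∑ u, g u := by
  set f : Terminal ℓ B × BNode (epochDepth ℓ e) B → Terminal ℓ B × BNode (epochDepth ℓ e) B :=
    fun p => (extend e p.2 p.1, restrict p.1 e) with hf
  have hinv : Function.Involutive f := by
    rintro ⟨s', s⟩
    simp [hf, restrict_extend, extend_restrict]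
  rw [← Fintype.sum_prod_type' (f := fun s' s => g (extend e s s'))]
  have h1 : ∑ p : Terminal ℓ B × BNode (epochDepth ℓ e) B, g (extend e p.2 p.1) =
      ∑ p : Terminal ℓ B × BNode (epochDepth ℓ e) B, g p.1 :=
    hinv.bijective.sum_comp fun p => g p.1
  rw [h1, Fintype.sum_prod_type]
  simp [Finset.mul_sum]

theorem sum_update [NeZero M] (e : Fin ℓ) (g : Inputs ℓ B M → ℝ) :
    ∑ x : Inputs ℓ B M, ∑ y : BInput (epochDepth ℓ e) B M, g (Function.update x e y) =
      Fintype.card (BInput (epochDepth ℓ e) B M) * ∑ x, g x := by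
  set f : Inputs ℓ B M × BInput (epochDepth ℓ e) B M → Inputs ℓ B M × BInput (epochDepth ℓ e) B M :=
    fun p => (Function.update p.1 e p.2, p.1 e) with hf
  have hinv : Function.Involutive f := by
    rintro ⟨x, y⟩
    simp [hf]
  rw [← Fintype.sum_prod_type' (f := fun x y => g (Function.update x e y))]
  have h1 : ∑ p : Inputs ℓ B M × BInput (epochDepth ℓ e) B M, g (Function.update p.1 e p.2) =
      ∑ p : Inputs ℓ B M × BInput (epochDepth ℓ e) B M, g p.1 :=
    hinv.bijective.sum_comp fun p => g p.1
  rw [h1, Fintype.sum_prod_type]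
  simp [Finset.mul_sum]

/-- A random batch of queries of epoch `e` consists of uniformly random queries. -/
theorem sum_batch_eq [NeZero B] [NeZero M] (e : Fin ℓ)
    (F : Inputs ℓ B M → Terminal ℓ B → Terminal ℓ B → ℝ) :
    ∑ x : Inputs ℓ B M, ∑ s', ∑ t', ∑ σ : Switches (epochDepth ℓ e) B,
      ∑ y : BInput (epochDepth ℓ e) B M, ∑ s,
        F (Function.update x e y) (extend e s s') (extend e (target σ s) t') =
    (B : ℝ) ^ (epochDepth ℓ e + 1) * (Fintype.card (Switches (epochDepth ℓ e) B) *
      Fintype.card (BInput (epochDepth ℓ e) B M)) * ∑ x, ∑ s, ∑ t, F x s t := by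
  set N : ℝ := (B : ℝ) ^ (epochDepth ℓ e + 1) with hN
  have hN0 : N ≠ 0 := by
    have : (B : ℝ) ≠ 0 := by exact_mod_cast NeZero.ne B
    positivity
  set cS : ℝ := ((Fintype.card (Switches (epochDepth ℓ e) B) : ℕ) : ℝ) with hcS
  set cY : ℝ := ((Fintype.card (BInput (epochDepth ℓ e) B M) : ℕ) : ℝ) with hcY
  set H : Terminal ℓ B → Terminal ℓ B → ℝ := fun s t => ∑ x, F x s t with hH
  have hstep1 : ∑ x : Inputs ℓ B M, ∑ s', ∑ t', ∑ σ : Switches (epochDepth ℓ e) B,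
      ∑ y : BInput (epochDepth ℓ e) B M, ∑ s,
        F (Function.update x e y) (extend e s s') (extend e (target σ s) t') =
      ∑ s', ∑ t', ∑ σ : Switches (epochDepth ℓ e) B, ∑ s,
        cY * H (extend e s s') (extend e (target σ s) t') := by
    rw [Finset.sum_comm]
    refine Finset.sum_congr rfl fun s' _ => ?_
    rw [Finset.sum_comm]
    refine Finset.sum_congr rfl fun t' _ => ?_
    rw [Finset.sum_comm]
    refine Finset.sum_congr rfl fun σ _ => ?_
    have : ∀ x : Inputs ℓ B M, ∑ y : BInput (epochDepth ℓ e) B M, ∑ s,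
        F (Function.update x e y) (extend e s s') (extend e (target σ s) t') =
        ∑ s, ∑ y : BInput (epochDepth ℓ e) B M,
        F (Function.update x e y) (extend e s s') (extend e (target σ s) t') :=
      fun x => Finset.sum_comm
    simp_rw [this]
    rw [Finset.sum_comm]
    refine Finset.sum_congr rfl fun s _ => ?_
    exact sum_update e fun x => F x (extend e s s') (extend e (target σ s) t')
  have hstep2 : ∀ s' t', N * ∑ σ : Switches (epochDepth ℓ e) B, ∑ s,
      cY * H (extend e s s') (extend e (target σ s) t') =
      cS * cY * ∑ s, ∑ t, H (extend e s s') (extend e t t') := by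
    intro s' t'
    rw [Finset.sum_comm, Finset.mul_sum, Finset.mul_sum]
    refine Finset.sum_congr rfl fun s _ => ?_
    rw [sum_target (fun t => cY * H (extend e s s') (extend e t t')) s, ← Finset.mul_sum]
    ring
  have hstep3 : ∑ s', ∑ t', ∑ s, ∑ t, H (extend e s s') (extend e t t') =
      N * (N * ∑ s, ∑ t, H s t) := by
    have h1 : ∀ s', ∑ t', ∑ s, ∑ t, H (extend e s s') (extend e t t') =
        ∑ s, N * ∑ t, H (extend e s s') t := by
      intro s'
      rw [Finset.sum_comm]
      exact Finset.sum_congr rfl fun s _ => sum_extend e (H (extend e s s'))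
    simp_rw [h1]
    rw [sum_extend e fun s => N * ∑ t, H s t, ← Finset.mul_sum]
  rw [hstep1]
  have h4 : N * ∑ s', ∑ t', ∑ σ : Switches (epochDepth ℓ e) B, ∑ s,
      cY * H (extend e s s') (extend e (target σ s) t') =
      N * (N * (cS * cY) * ∑ s, ∑ t, H s t) := by
    rw [Finset.mul_sum]
    refine (Finset.sum_congr rfl fun s' _ => (Finset.mul_sum _ _ _).trans
      (Finset.sum_congr rfl fun t' _ => hstep2 s' t')).trans ?_
    simp only [← Finset.mul_sum]
    rw [hstep3]
    ring
  rw [mul_left_cancel₀ hN0 h4]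
  congr 1
  simp only [hH]
  rw [Finset.sum_comm (s := (Finset.univ : Finset (Inputs ℓ B M)))]
  refine Finset.sum_congr rfl fun s _ => ?_
  rw [Finset.sum_comm]

/-- Few queries have a positive answer. -/
theorem sum_card_positive_le [NeZero B] [NeZero M] (hM : 4 * ℓ ≤ M) (s t : Terminal ℓ B) :
    4 * (Finset.univ.filter fun x : Inputs ℓ B M => ∃ e : Fin ℓ,
      pathSum (x e) (restrict s e) (restrict t e) = 0).card ≤ Fintype.card (Inputs ℓ B M) := by
  classical
  have h1 : ∀ e : Fin ℓ, M * (Finset.univ.filter fun x : Inputs ℓ B M =>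
      pathSum (x e) (restrict s e) (restrict t e) = 0).card = Fintype.card (Inputs ℓ B M) := by
    intro e
    have h2 := sum_update e fun x : Inputs ℓ B M =>
      if pathSum (x e) (restrict s e) (restrict t e) = 0 then (1 : ℝ) else 0
    simp only [Function.update_self, Finset.sum_boole, Finset.sum_const, nsmul_eq_mul,
      Finset.card_univ] at h2
    have h3 := card_pathSum_eq_zero (M := M) (restrict s e) (restrict t e)
    have h4 : (Fintype.card (BInput (epochDepth ℓ e) B M) : ℝ) ≠ 0 := by
      exact_mod_cast Fintype.card_ne_zero
    rw [← h3] at h2 h4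
    push_cast at h2 h4
    set p : ℝ := ((Finset.univ.filter fun y : BInput (epochDepth ℓ e) B M =>
      pathSum y (restrict s e) (restrict t e) = 0).card : ℝ) with hp
    have hp0 : p ≠ 0 := right_ne_zero_of_mul h4
    have h5 : (Fintype.card (Inputs ℓ B M) : ℝ) = M * (Finset.univ.filter fun x : Inputs ℓ B M =>
      pathSum (x e) (restrict s e) (restrict t e) = 0).card := by
      apply mul_right_cancel₀ hp0
      rw [h2]
      ring
    exact_mod_cast h5.symm
  have h2 : (Finset.univ.filter fun x : Inputs ℓ B M => ∃ e : Fin ℓ,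
      pathSum (x e) (restrict s e) (restrict t e) = 0).card ≤ ∑ e : Fin ℓ,
      (Finset.univ.filter fun x : Inputs ℓ B M =>
        pathSum (x e) (restrict s e) (restrict t e) = 0).card := by
    refine (Finset.card_le_card fun x hx => ?_).trans Finset.card_biUnion_le
    obtain ⟨e, he⟩ := (Finset.mem_filter.1 hx).2
    exact Finset.mem_biUnion.2 ⟨e, Finset.mem_univ _, Finset.mem_filter.2 ⟨Finset.mem_univ _, he⟩⟩
  have h3 : M * (Finset.univ.filter fun x : Inputs ℓ B M => ∃ e : Fin ℓ,
      pathSum (x e) (restrict s e) (restrict t e) = 0).card ≤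
      ℓ * Fintype.card (Inputs ℓ B M) := by
    refine (Nat.mul_le_mul_left M h2).trans ?_
    rw [Finset.mul_sum]
    simp [h1]
  rcases Nat.eq_zero_or_pos ℓ with h0 | h0
  · have : (Finset.univ.filter fun x : Inputs ℓ B M => ∃ e : Fin ℓ,
        pathSum (x e) (restrict s e) (restrict t e) = 0).card = 0 := by
      rw [Finset.card_eq_zero, Finset.filter_eq_empty_iff]
      rintro x - ⟨e, -⟩
      exact absurd e.2 (by omega)
    omega
  · have h4 := (Nat.mul_le_mul_right _ hM).trans h3
    refine Nat.le_of_mul_le_mul_left ?_ h0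
    linarith

end Averages

/-! ### The memory between the epochs. -/

section Stages
variable {ℓ B M n w : ℕ} [NeZero M] (D : ReachabilityDS n w) (φ : GNode ℓ B M ↪ Fin n)

/-- The memory after the first `k` epochs. -/
noncomputable def stage (x : Inputs ℓ B M) (k : ℕ) : Memory w :=
  D.memory ((history x k).map (Prod.map φ φ))

/-- The query algorithm for a source and a sink. -/
def ask (s t : Terminal ℓ B) : QueryTree w Bool := D.query (φ (src s), φ (snk t))

variable {D φ}

theorem eval_ask_eq_false_iff (hD : D.Correct) (x : Inputs ℓ B M) (s t : Terminal ℓ B) :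
    (ask D φ s t).eval (stage D φ x ℓ) = false ↔
      ∀ e : Fin ℓ, pathSum (x e) (restrict s e) (restrict t e) ≠ 0 := by
  have h := (hD _ (validInsertions_history φ x ℓ) (φ (src s)) (φ (snk t))).trans
    (reaches_history_iff φ x s t)
  rw [← Bool.not_eq_true, ask, stage, h]
  push Not
  rfl

theorem stage_update (x : Inputs ℓ B M) (e : Fin ℓ) (y : BInput (epochDepth ℓ e) B M) {k : ℕ}
    (hk : k ≤ e) : stage D φ (Function.update x e y) k = stage D φ x k := by
  have h : history (Function.update x e y) k = history x k := by
    induction k with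
    | zero => rfl
    | succ k ih =>
      have hkℓ : k < ℓ := by omega
      have hne : (⟨k, hkℓ⟩ : Fin ℓ) ≠ e := fun h => by rw [← h] at hk; simp at hk
      simp only [history, ih (by omega), hkℓ, dif_pos, Function.update_of_ne hne]
  rw [stage, stage, h]

theorem card_diffCells_stage_le {tu : ℕ} (hD : D.UpdateTimeLE tu) (x : Inputs ℓ B M)
    (e : Fin ℓ) : (diffCells (stage D φ x e) (stage D φ x (e + 1))).card ≤
      tu * ((epochDepth ℓ e + 1) * (B ^ (epochDepth ℓ e + 1) * (B * M))) := by
  have h := validInsertions_history φ x (e + 1)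
  rw [history_succ, List.map_append] at h
  have h1 := card_diffCells_memory_append_le hD _ _ h
  rw [List.length_map, length_epochEdges, ← List.map_append, ← history_succ] at h1
  exact h1

theorem card_lastChanged_stage_le {tu : ℕ} (hD : D.UpdateTimeLE tu) (x : Inputs ℓ B M)
    (e : Fin ℓ) : (lastChanged (stage D φ x) ℓ e).card ≤
      tu * ((epochDepth ℓ e + 1) * (B ^ (epochDepth ℓ e + 1) * (B * M))) :=
  (Finset.card_le_card (lastChanged_subset _ _ _)).trans (card_diffCells_stage_le hD x e)

/-- Later epochs are smaller by a factor of `B`. -/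
theorem card_laterChanged_stage_le [NeZero B] {tu : ℕ} (hD : D.UpdateTimeLE tu)
    (x : Inputs ℓ B M) (e : Fin ℓ) : (laterChanged (stage D φ x) ℓ e).card ≤
      ℓ * (tu * ((epochDepth ℓ e + 1) * (B ^ epochDepth ℓ e * M))) := by
  refine Finset.card_biUnion_le.trans ?_
  have h : ∀ k ∈ Finset.Ioo (e : ℕ) ℓ, (diffCells (stage D φ x k) (stage D φ x (k + 1))).card ≤
      tu * ((epochDepth ℓ e + 1) * (B ^ epochDepth ℓ e * M)) := by
    intro k hk
    have hk := Finset.mem_Ioo.1 hk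
    refine (card_diffCells_stage_le hD x ⟨k, hk.2⟩).trans (Nat.mul_le_mul_left _ ?_)
    -- The depth falls by two per epoch: one factor `B` pays for the `B` edges at each node, the
    -- other one makes the later epochs small compared with the `B ^ (epochDepth ℓ e + 1)` queries
    -- of a batch.
    have h1 : epochDepth ℓ k + 1 + 1 ≤ epochDepth ℓ e := by unfold epochDepth; omega
    refine Nat.mul_le_mul (by simp only; omega) ?_
    rw [← mul_assoc, ← pow_succ]
    exact Nat.mul_le_mul_right _ (Nat.pow_le_pow_right (NeZero.pos B) h1)
  refine (Finset.sum_le_card_nsmul _ _ _ h).trans ?_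
  rw [smul_eq_mul, Nat.card_Ioo]
  exact Nat.mul_le_mul_right _ (by omega)

end Stages

/-! ### Batches of queries that are answered with few probes. -/

section Batches
variable {ℓ B M n w : ℕ} [NeZero M] (D : ReachabilityDS n w) (φ : GNode ℓ B M ↪ Fin n)

/-- The algorithm that runs the queries of a batch until one of them has a positive answer. -/
noncomputable def batchTree (e : Fin ℓ) (s' t' : Terminal ℓ B)
    (A : Finset (BNode (epochDepth ℓ e) B)) (σ : Switches (epochDepth ℓ e) B) :
    QueryTree w Bool :=
  QueryTree.any (A.toList.map fun s => ask D φ (extend e s s') (extend e (target σ s) t'))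

/-- At least half of the queries of a batch have negative answers and these are found with few
probes, both in total and to the cells of epoch `e`. -/
def GoodBatch (e : Fin ℓ) (K u : ℕ) (x : Inputs ℓ B M) (s' t' : Terminal ℓ B)
    (σ : Switches (epochDepth ℓ e) B) : Prop :=
  ∃ A : Finset (BNode (epochDepth ℓ e) B), B ^ (epochDepth ℓ e + 1) ≤ 2 * A.card ∧
    (batchTree D φ e s' t' A σ).eval (stage D φ x ℓ) = false ∧
    ((batchTree D φ e s' t' A σ).visited (stage D φ x ℓ)).card ≤ B ^ (epochDepth ℓ e + 1) * K ∧
    ((batchTree D φ e s' t' A σ).visited (stage D φ x ℓ) ∩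
      lastChanged (stage D φ x) ℓ e).card ≤ B ^ (epochDepth ℓ e + 1) * u

/-- The number of probes for a query after all epochs. -/
noncomputable def askProbes (x : Inputs ℓ B M) (s t : Terminal ℓ B) : ℕ :=
  (ask D φ s t).probes (stage D φ x ℓ)

/-- The number of cells of epoch `e` that are probed by a query after all epochs. -/
noncomputable def askHits (e : ℕ) (x : Inputs ℓ B M) (s t : Terminal ℓ B) : ℕ :=
  ((ask D φ s t).visited (stage D φ x ℓ) ∩ lastChanged (stage D φ x) ℓ e).card

open Classical in
/-- The cost of a query; a batch of cost below `1` is good. -/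
noncomputable def askCost (e : Fin ℓ) (K u : ℕ) (x : Inputs ℓ B M) (s t : Terminal ℓ B) : ℝ :=
  (askHits D φ e x s t / u + askProbes D φ x s t / K +
    2 * if ∃ e : Fin ℓ, pathSum (x e) (restrict s e) (restrict t e) = 0 then 1 else 0) /
  (B : ℝ) ^ (epochDepth ℓ e + 1)

variable {D φ}

theorem askCost_nonneg (e : Fin ℓ) (K u : ℕ) (x : Inputs ℓ B M) (s t : Terminal ℓ B) :
    0 ≤ askCost D φ e K u x s t := by
  unfold askCost
  positivity

/-- A total cost below `1` bounds each of its three parts: the hits by `N * u`, the probes by `N *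
K` and the positive answers by `N / 2`. The sources with negative answers form the set `A`. -/
theorem goodBatch_of_cost_lt [NeZero B] (hD : D.Correct) (e : Fin ℓ) {K u : ℕ} (hK : 0 < K) (hu : 0 < u)
    (x : Inputs ℓ B M) (s' t' : Terminal ℓ B) (σ : Switches (epochDepth ℓ e) B)
    (h : ∑ s, askCost D φ e K u x (extend e s s') (extend e (target σ s) t') < 1) :
    GoodBatch D φ e K u x s' t' σ := by
  classical
  set S : BNode (epochDepth ℓ e) B → Terminal ℓ B := fun s => extend e s s' with hS
  set T : BNode (epochDepth ℓ e) B → Terminal ℓ B := fun s => extend e (target σ s) t' with hT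
  set N := B ^ (epochDepth ℓ e + 1) with hN
  have hN0 : (0 : ℝ) < N := by
    have : 0 < N := Nat.pow_pos (NeZero.pos B)
    exact_mod_cast this
  have hK' : (0 : ℝ) < K := by exact_mod_cast hK
  have hu' : (0 : ℝ) < u := by exact_mod_cast hu
  set bad : BNode (epochDepth ℓ e) B → Prop := fun s =>
    ∃ i : Fin ℓ, pathSum (x i) (restrict (S s) i) (restrict (T s) i) = 0 with hbad
  have hsum : (∑ s, (askHits D φ e x (S s) (T s) : ℝ)) / u +
      (∑ s, (askProbes D φ x (S s) (T s) : ℝ)) / K +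
      2 * ((Finset.univ.filter bad).card : ℝ) < N := by
    have h1 : ∑ s, askCost D φ e K u x (S s) (T s) =
        ((∑ s, (askHits D φ e x (S s) (T s) : ℝ)) / u +
        (∑ s, (askProbes D φ x (S s) (T s) : ℝ)) / K +
        2 * ((Finset.univ.filter bad).card : ℝ)) / N := by
      simp only [askCost, ← Finset.sum_div, Finset.sum_add_distrib, ← Finset.mul_sum, hN]
      rw [Finset.sum_boole]
      push_cast
      rfl
    have h2 := h
    rw [show ∑ s, askCost D φ e K u x (extend e s s') (extend e (target σ s) t') =
      ∑ s, askCost D φ e K u x (S s) (T s) from rfl, h1, div_lt_one hN0] at h2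
    exact h2
  have hp1 : 0 ≤ (∑ s, (askHits D φ e x (S s) (T s) : ℝ)) / u := by positivity
  have hp2 : 0 ≤ (∑ s, (askProbes D φ x (S s) (T s) : ℝ)) / K := by positivity
  have hp3 : (0 : ℝ) ≤ (Finset.univ.filter bad).card := by positivity
  have hb1 : ∑ s, askHits D φ e x (S s) (T s) ≤ N * u := by
    have : (∑ s, (askHits D φ e x (S s) (T s) : ℝ)) / u ≤ N := by linarith
    rw [div_le_iff₀ hu'] at this
    exact_mod_cast this
  have hb2 : ∑ s, askProbes D φ x (S s) (T s) ≤ N * K := by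
    have : (∑ s, (askProbes D φ x (S s) (T s) : ℝ)) / K ≤ N := by linarith
    rw [div_le_iff₀ hK'] at this
    exact_mod_cast this
  have hb3 : 2 * (Finset.univ.filter bad).card ≤ N := by
    have : (2 * (Finset.univ.filter bad).card : ℝ) ≤ N := by linarith
    exact_mod_cast this
  set A := Finset.univ.filter fun s => ¬ bad s with hA
  have hcard : (Finset.univ.filter bad).card + A.card = N := by
    rw [hA, Finset.card_filter_add_card_filter_not]
    simp [hN]
  have hvis : ((batchTree D φ e s' t' A σ).visited (stage D φ x ℓ)) ⊆
      A.biUnion fun s => (ask D φ (S s) (T s)).visited (stage D φ x ℓ) := by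
    intro a ha
    obtain ⟨t, ht, hat⟩ := QueryTree.exists_of_mem_visited_any _ _ ha
    obtain ⟨s, hs, rfl⟩ := List.mem_map.1 ht
    exact Finset.mem_biUnion.2 ⟨s, Finset.mem_toList.1 hs, hat⟩
  refine ⟨A, by omega, ?_, ?_, ?_⟩
  · refine (QueryTree.eval_any_eq_false _ _).2 fun t ht => ?_
    obtain ⟨s, hs, rfl⟩ := List.mem_map.1 ht
    rw [eval_ask_eq_false_iff hD]
    have := (Finset.mem_filter.1 (Finset.mem_toList.1 hs)).2
    simp only [hbad] at this
    push Not at this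
    exact this
  · refine le_trans ((Finset.card_le_card hvis).trans Finset.card_biUnion_le) (le_trans ?_ hb2)
    refine (Finset.sum_le_sum fun s _ => QueryTree.card_visited_le _ _).trans ?_
    exact Finset.sum_le_sum_of_subset (Finset.subset_univ A)
  · refine le_trans (Finset.card_le_card (Finset.inter_subset_inter_right hvis)) (le_trans ?_ hb1)
    rw [Finset.biUnion_inter]
    exact Finset.card_biUnion_le.trans
      (Finset.sum_le_sum_of_subset (f := fun s => askHits D φ e x (S s) (T s))
        (Finset.subset_univ A))

/-- The average cost of a query. -/
theorem sum_askCost_le [NeZero B] (hM : 4 * ℓ ≤ M) (e : Fin ℓ) {K u : ℕ} (hK : 0 < K) (hu : 0 < u) {T U : ℝ}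
    (hT : ∑ x, ∑ s, ∑ t, (askProbes D φ x s t : ℝ) ≤
      T * (Fintype.card (Inputs ℓ B M) * (Fintype.card (Terminal ℓ B)) ^ 2))
    (hU : ∑ x, ∑ s, ∑ t, (askHits D φ e x s t : ℝ) ≤
      U * (Fintype.card (Inputs ℓ B M) * (Fintype.card (Terminal ℓ B)) ^ 2))
    (hTK : 8 * T ≤ K) (hUu : 8 * U ≤ u) :
    (B : ℝ) ^ (epochDepth ℓ e + 1) * ∑ x, ∑ s, ∑ t, askCost D φ e K u x s t ≤
      3 / 4 * (Fintype.card (Inputs ℓ B M) * (Fintype.card (Terminal ℓ B)) ^ 2) := by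
  classical
  have hB0 : (B : ℝ) ≠ 0 := by exact_mod_cast NeZero.ne B
  have hN0 : (B : ℝ) ^ (epochDepth ℓ e + 1) ≠ 0 := pow_ne_zero _ hB0
  have hK' : (0 : ℝ) < K := by exact_mod_cast hK
  have hu' : (0 : ℝ) < u := by exact_mod_cast hu
  set W : ℝ := (Fintype.card (Inputs ℓ B M) * (Fintype.card (Terminal ℓ B)) ^ 2) with hW
  have hW0 : 0 ≤ W := by positivity
  have hpos : ∑ x : Inputs ℓ B M, ∑ s, ∑ t,
      (if ∃ e : Fin ℓ, pathSum (x e) (restrict s e) (restrict t e) = 0 then (1 : ℝ) else 0) ≤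
      1 / 4 * W := by
    rw [Finset.sum_comm]
    have h1 : ∀ s : Terminal ℓ B, ∑ x : Inputs ℓ B M, ∑ t,
        (if ∃ e : Fin ℓ, pathSum (x e) (restrict s e) (restrict t e) = 0 then (1 : ℝ) else 0) ≤
        Fintype.card (Terminal ℓ B) * (1 / 4 * Fintype.card (Inputs ℓ B M)) := by
      intro s
      rw [Finset.sum_comm]
      refine (Finset.sum_le_card_nsmul _ _ (1 / 4 * (Fintype.card (Inputs ℓ B M) : ℝ))
        fun t _ => ?_).trans ?_
      · rw [Finset.sum_boole]
        have h := sum_card_positive_le hM s t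
        have h' : (4 : ℝ) * ((Finset.univ.filter fun x : Inputs ℓ B M => ∃ e : Fin ℓ,
          pathSum (x e) (restrict s e) (restrict t e) = 0).card : ℝ) ≤
          Fintype.card (Inputs ℓ B M) := by exact_mod_cast h
        linarith
      · rw [nsmul_eq_mul, Finset.card_univ]
    refine (Finset.sum_le_card_nsmul _ _ _ fun s _ => h1 s).trans ?_
    rw [nsmul_eq_mul, Finset.card_univ, hW]
    apply le_of_eq
    ring
  simp only [askCost, ← Finset.sum_div, Finset.sum_add_distrib, ← Finset.mul_sum]
  rw [mul_div_cancel₀ _ hN0]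
  -- Hits and probes contribute `1 / 8` each, positive answers `2 * (1 / 4)`.
  have h1 : (∑ x, ∑ s, ∑ t, (askHits D φ e x s t : ℝ)) / u ≤ 1 / 8 * W := by
    rw [div_le_iff₀ hu']
    nlinarith
  have h2 : (∑ x, ∑ s, ∑ t, (askProbes D φ x s t : ℝ)) / K ≤ 1 / 8 * W := by
    rw [div_le_iff₀ hK']
    nlinarith
  linarith

open Classical in
/-- In some context, a quarter of the batches are good. -/
theorem exists_many_goodBatch [NeZero B] (hD : D.Correct) (hM : 4 * ℓ ≤ M) (e : Fin ℓ) {K u : ℕ} (hK : 0 < K)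
    (hu : 0 < u) {T U : ℝ}
    (hT : ∑ x, ∑ s, ∑ t, (askProbes D φ x s t : ℝ) ≤
      T * (Fintype.card (Inputs ℓ B M) * (Fintype.card (Terminal ℓ B)) ^ 2))
    (hU : ∑ x, ∑ s, ∑ t, (askHits D φ e x s t : ℝ) ≤
      U * (Fintype.card (Inputs ℓ B M) * (Fintype.card (Terminal ℓ B)) ^ 2))
    (hTK : 8 * T ≤ K) (hUu : 8 * U ≤ u) :
    ∃ (x : Inputs ℓ B M) (s' t' : Terminal ℓ B),
      Fintype.card (Switches (epochDepth ℓ e) B) * Fintype.card (BInput (epochDepth ℓ e) B M) ≤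
      4 * ∑ σ : Switches (epochDepth ℓ e) B, (Finset.univ.filter fun y =>
        GoodBatch D φ e K u (Function.update x e y) s' t' σ).card := by
  -- Markov's inequality: a batch that is not good costs at least `1`, so less than a quarter of
  -- good batches in every context would push the mean cost above the `3 / 4` of `sum_askCost_le`.
  by_contra! hcon
  set cS : ℝ := ((Fintype.card (Switches (epochDepth ℓ e) B) : ℕ) : ℝ) with hcS
  set cY : ℝ := ((Fintype.card (BInput (epochDepth ℓ e) B M) : ℕ) : ℝ) with hcY
  have hlow : ∀ (x : Inputs ℓ B M) (s' t' : Terminal ℓ B), 3 / 4 * (cS * cY) <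
      ∑ σ : Switches (epochDepth ℓ e) B, ∑ y : BInput (epochDepth ℓ e) B M, ∑ s,
        askCost D φ e K u (Function.update x e y) (extend e s s') (extend e (target σ s) t') := by
    intro x s' t'
    have h1 : (4 : ℝ) * ∑ σ : Switches (epochDepth ℓ e) B, ((Finset.univ.filter fun y =>
        GoodBatch D φ e K u (Function.update x e y) s' t' σ).card : ℝ) < cS * cY := by
      rw [hcS, hcY]
      exact_mod_cast hcon x s' t'
    have h2 : ∑ σ : Switches (epochDepth ℓ e) B, (cY - ((Finset.univ.filter fun y =>
        GoodBatch D φ e K u (Function.update x e y) s' t' σ).card : ℝ)) ≤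
        ∑ σ : Switches (epochDepth ℓ e) B, ∑ y : BInput (epochDepth ℓ e) B M, ∑ s,
        askCost D φ e K u (Function.update x e y) (extend e s s') (extend e (target σ s) t') := by
      refine Finset.sum_le_sum fun σ _ => ?_
      have h3 : cY - ((Finset.univ.filter fun y =>
          GoodBatch D φ e K u (Function.update x e y) s' t' σ).card : ℝ) =
          ∑ y : BInput (epochDepth ℓ e) B M, (1 - if
          GoodBatch D φ e K u (Function.update x e y) s' t' σ then (1 : ℝ) else 0) := by
        rw [Finset.sum_sub_distrib, Finset.sum_boole]
        simp [hcY]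
      rw [h3]
      refine Finset.sum_le_sum fun y _ => ?_
      split_ifs with h
      · rw [sub_self]
        exact Finset.sum_nonneg fun s _ => askCost_nonneg _ _ _ _ _ _
      · rw [sub_zero]
        by_contra! h4
        exact h (goodBatch_of_cost_lt hD e hK hu _ s' t' σ h4)
    rw [Finset.sum_sub_distrib, Finset.sum_const, Finset.card_univ, nsmul_eq_mul] at h2
    linarith
  have htotal := sum_batch_eq e (askCost D φ e K u)
  have hB1 : (0 : ℝ) < cS * cY := by positivity
  have h5 : ∑ x : Inputs ℓ B M, ∑ _s' : Terminal ℓ B, ∑ _t' : Terminal ℓ B,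
      3 / 4 * (cS * cY) < ∑ x : Inputs ℓ B M, ∑ s', ∑ t',
      ∑ σ : Switches (epochDepth ℓ e) B, ∑ y : BInput (epochDepth ℓ e) B M, ∑ s,
      askCost D φ e K u (Function.update x e y) (extend e s s') (extend e (target σ s) t') := by
    refine Finset.sum_lt_sum_of_nonempty Finset.univ_nonempty fun x _ => ?_
    refine Finset.sum_lt_sum_of_nonempty Finset.univ_nonempty fun s' _ => ?_
    exact Finset.sum_lt_sum_of_nonempty Finset.univ_nonempty fun t' _ => hlow x s' t'
  rw [htotal] at h5
  have h6 := mul_le_mul_of_nonneg_left (sum_askCost_le hM e hK hu hT hU hTK hUu) hB1.le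
  simp only [Finset.sum_const, Finset.card_univ, nsmul_eq_mul] at h5
  nlinarith

end Batches

/-! ### Good batches of a single epoch are rare. -/

section EpochBound
variable {ℓ B M n w : ℕ} [NeZero M] {D : ReachabilityDS n w} {φ : GNode ℓ B M ↪ Fin n}

theorem batchProd_eq_one_of_eval (hD : D.Correct) (x : Inputs ℓ B M) (e : Fin ℓ)
    (s' t' : Terminal ℓ B) (A : Finset (BNode (epochDepth ℓ e) B))
    (σ : Switches (epochDepth ℓ e) B)
    (h : (batchTree D φ e s' t' A σ).eval (stage D φ x ℓ) = false) :
    batchProd A σ (x e) = 1 := by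
  refine Finset.prod_eq_one fun s hs => if_neg ?_
  have h1 := (QueryTree.eval_any_eq_false _ _).1 h _
    (List.mem_map.2 ⟨s, Finset.mem_toList.2 hs, rfl⟩)
  have h2 := (eval_ask_eq_false_iff hD x _ _).1 h1 e
  rwa [restrict_extend, restrict_extend] at h2

/-- The `L`-th root of the moment bound is far below the number of switch settings. -/
theorem moment_root_le_card_switches {a m E : ℕ} (hB : B = a ^ 64) (ha : 12 ≤ a ^ 4)
    (hE : E = (m + 1) * B ^ (m + 1)) :
    (4 * a ^ 52) ^ E * a ^ (8 * E) ≤ Fintype.card (Switches m B) := by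
  have h := pow_le_card_switches (m := m) (B := B)
  rw [← hE] at h
  refine Nat.le_of_mul_le_mul_left (le_trans ?_ h) (Nat.pow_pos (n := E) (show 0 < 3 by norm_num))
  rw [pow_mul, ← mul_pow, ← mul_pow]
  refine Nat.pow_le_pow_left ?_ E
  calc 3 * (4 * a ^ 52 * a ^ 8) = 12 * a ^ 60 := by ring
    _ ≤ a ^ 4 * a ^ 60 := Nat.mul_le_mul_right _ ha
    _ = B := by rw [hB]; ring

/-- This is the condition `hY` of `sum_card_certified_le`. For `L = 4 * a ^ 4` the power of `B`
equals `a ^ (48 * L * E)`, which gives `4 * a ^ 52` per edge after the `L`-th root. The message has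
at most `2 * L * N` bits and costs `4 ^ N`. -/
theorem moment_budget {a E N L v : ℕ} (hB : B = a ^ 64) {M' c : ℝ} (hL : L = 4 * a ^ 4) (hL0 : L ≠ 0) (hc : 0 ≤ c)
    (hM' : 0 ≤ M') (hv : v ≤ 8 * a ^ 4 * N) :
    c ^ (L - 1) * (2 ^ v * (c * (M' ^ (L * N) * ((L : ℝ) ^ (L * E) *
      (B : ℝ) ^ (L * E - a ^ 4 * E))))) ≤
    (c * ((4 * M') ^ N * (4 * (a : ℝ) ^ 52) ^ E)) ^ L := by
  have h1 : L * E - a ^ 4 * E = 3 * a ^ 4 * E := by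
    rw [hL, ← Nat.sub_mul]
    congr 1
    omega
  have h2 : c ^ (L - 1) * c = c ^ L := pow_sub_one_mul hL0 c
  have h3 : (2 : ℝ) ^ v ≤ (4 ^ N) ^ L := by
    calc (2 : ℝ) ^ v ≤ 2 ^ (8 * a ^ 4 * N) := pow_le_pow_right₀ (by norm_num) hv
      _ = (4 ^ N) ^ L := by
        rw [hL, show (4 : ℝ) = 2 ^ 2 by norm_num, ← pow_mul, ← pow_mul]
        congr 1
        ring
  have h4 : (L : ℝ) ^ (L * E) * (B : ℝ) ^ (L * E - a ^ 4 * E) =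
      ((4 * (a : ℝ) ^ 52) ^ E) ^ L := by
    rw [h1, hB]
    push_cast
    have h5 : (L : ℝ) = 4 * (a : ℝ) ^ 4 := by rw [hL]; push_cast; ring
    have h6 : ((a : ℝ) ^ 64) ^ (3 * a ^ 4 * E) = ((a : ℝ) ^ 48) ^ (L * E) := by
      rw [← pow_mul, ← pow_mul, hL]
      congr 1
      ring
    rw [h6, h5, ← mul_pow, ← pow_mul, mul_comm E L]
    congr 1
    ring
  rw [h4]
  calc _ = c ^ L * (2 ^ v * (M' ^ (L * N) * ((4 * (a : ℝ) ^ 52) ^ E) ^ L)) := by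
        rw [← h2]; ring
    _ ≤ c ^ L * ((4 ^ N) ^ L * (M' ^ (L * N) * ((4 * (a : ℝ) ^ 52) ^ E) ^ L)) := by gcongr
    _ = _ := by
        rw [mul_pow, mul_pow, mul_pow, mul_pow, mul_comm L N, pow_mul M']
        ring

open Classical in
/-- Few batches with negative answers are found with few probes to the cells of an epoch. -/
theorem sum_card_batch_le [NeZero B] (hD : D.Correct) {tu : ℕ} (hU : D.UpdateTimeLE tu) (e : Fin ℓ)
    (x : Inputs ℓ B M) (s' t' : Terminal ℓ B) (A : Finset (BNode (epochDepth ℓ e) B))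
    (hA : B ^ (epochDepth ℓ e + 1) ≤ 2 * A.card) {a : ℕ} (hB : B = a ^ 64) (ha : 12 ≤ a ^ 4)
    {ρ k j δmax : ℕ} (hj : j ≤ ρ) (c : ℕ → ℝ) (hc2 : ∀ δ, |c δ| ≤ 2 ^ δ)
    (hc0 : ∑ δ ∈ Finset.range (δmax + 1), c δ * (Nat.choose 0 δ : ℝ) = 1)
    (hck : ∀ b, 1 ≤ b → b ≤ k →
      |∑ δ ∈ Finset.range (δmax + 1), c δ * (Nat.choose b δ : ℝ)| * (ρ + b).choose ρ ≤
        Real.exp (-(3 * ρ)))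
    (hbits : w * (2 * (ℓ * (tu * ((epochDepth ℓ e + 1) * (B ^ epochDepth ℓ e * M)))) + 3 * j + δmax)
      ≤ 8 * a ^ 4 * B ^ (epochDepth ℓ e + 1)) {G : ℝ}
    (hG : ∀ δ ≤ δmax,
      (((tu * ((epochDepth ℓ e + 1) * (B ^ (epochDepth ℓ e + 1) * (B * M)))).choose j : ℝ) *
        (tu * ((epochDepth ℓ e + 1) * (B ^ (epochDepth ℓ e + 1) * (B * M)))).choose δ) ≤ G) :
    ((∑ σ : Switches (epochDepth ℓ e) B, (Finset.univ.filter fun y =>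
      (batchTree D φ e s' t' A σ).eval (stage D φ (Function.update x e y) ℓ) = false ∧
      ((batchTree D φ e s' t' A σ).visited (stage D φ (Function.update x e y) ℓ)).card ≤ k ∧
      ((batchTree D φ e s' t' A σ).visited (stage D φ (Function.update x e y) ℓ) ∩
        lastChanged (stage D φ (Function.update x e y)) ℓ e).card = j).card : ℕ) : ℝ) ≤
    (Fintype.card (Switches (epochDepth ℓ e) B) * Fintype.card (BInput (epochDepth ℓ e) B M)) *
      ((M : ℝ) ^ B ^ (epochDepth ℓ e + 1) * (k * Real.exp (-(3 * ρ))) +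
        (δmax + 1) * 2 ^ δmax * G * ((4 * M : ℝ) ^ B ^ (epochDepth ℓ e + 1) /
          (a : ℝ) ^ (8 * ((epochDepth ℓ e + 1) * B ^ (epochDepth ℓ e + 1))))) := by
  set N := B ^ (epochDepth ℓ e + 1) with hN
  set E := (epochDepth ℓ e + 1) * N with hE
  set L := 4 * a ^ 4 with hL
  have ha0 : 0 < a := by
    rcases Nat.eq_zero_or_pos a with h | h
    · rw [h] at ha; norm_num at ha
    · exact h
  have hL0 : L ≠ 0 := by omega
  set cS : ℝ := ((Fintype.card (Switches (epochDepth ℓ e) B) : ℕ) : ℝ) with hcS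
  set cY : ℝ := ((Fintype.card (BInput (epochDepth ℓ e) B M) : ℕ) : ℝ) with hcY
  -- `A` contains at least half of the sources and collisions save at least half of the digits on
  -- their paths, so a quarter of the `L * E` digits is saved.
  have he : 2 * (a ^ 4 * E) ≤ L * ((epochDepth ℓ e + 1) * A.card) := by
    calc 2 * (a ^ 4 * E) = 2 * a ^ 4 * (epochDepth ℓ e + 1) * N := by rw [hE]; ring
      _ ≤ 2 * a ^ 4 * (epochDepth ℓ e + 1) * (2 * A.card) := Nat.mul_le_mul_left _ hA
      _ = L * ((epochDepth ℓ e + 1) * A.card) := by rw [hL]; ring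
  have hcS0 : 0 ≤ cS := Nat.cast_nonneg _
  have hcY0 : 0 ≤ cY := Nat.cast_nonneg _
  have hG0 : 0 ≤ G := le_trans (by positivity) (hG 0 (Nat.zero_le _))
  -- Only the input `y` of epoch `e` varies. Batches play the role of the queries, and batch
  -- products the role of `Ψ`.
  have hmain := sum_card_certified_le (fun σ : Switches (epochDepth ℓ e) B => batchTree D φ e s' t' A σ)
    (stage D φ x e) (fun y : BInput (epochDepth ℓ e) B M => stage D φ (Function.update x e y) ℓ)
    (fun y => laterChanged (stage D φ (Function.update x e y)) ℓ e)
    (fun y => lastChanged (stage D φ (Function.update x e y)) ℓ e)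
    (fun y b h1 h2 => by
      rw [← stage_update x e y le_rfl]
      exact eq_of_notMem_changed e.2 h1 h2)
    (ℓ * (tu * ((epochDepth ℓ e + 1) * (B ^ epochDepth ℓ e * M)))) (tu * ((epochDepth ℓ e + 1) * (B ^ (epochDepth ℓ e + 1) * (B * M))))
    (fun y => card_laterChanged_stage_le hU _ e) (fun y => card_lastChanged_stage_le hU _ e)
    (fun σ y => batchProd A σ y) ((M : ℝ) ^ N) (fun σ y => abs_batchProd_le A σ y)
    (fun σ y h => by
      have := batchProd_eq_one_of_eval hD (Function.update x e y) e s' t' A σ h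
      rwa [Function.update_self] at this)
    L hL0 ⟨2 * a ^ 4, by omega⟩
    (cY * ((M : ℝ) ^ (L * N) * ((L : ℝ) ^ (L * E) * (B : ℝ) ^ (L * E - a ^ 4 * E))))
    (cY * ((4 * M : ℝ) ^ N * (4 * (a : ℝ) ^ 52) ^ E)) (mul_nonneg (Nat.cast_nonneg _) (by positivity))
    (fun h hh => sum_pow_sum_batchProd_le A he h hh) k j δmax c hc0
    (moment_budget hB hL hL0 hcY0 (Nat.cast_nonneg _) hbits)
  refine hmain.trans ?_
  rw [mul_add]
  refine add_le_add ?_ ?_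
  · refine mul_le_mul_of_nonneg_left ?_ (by positivity)
    refine mul_le_mul_of_nonneg_left ?_ (by positivity)
    have h1 : ∀ b ∈ Finset.Icc 1 k, ((j + b).choose j : ℝ) *
        |∑ δ ∈ Finset.range (δmax + 1), c δ * (b.choose δ : ℝ)| ≤ Real.exp (-(3 * ρ)) := by
      intro b hb
      have hb := Finset.mem_Icc.1 hb
      refine le_trans ?_ (hck b hb.1 hb.2)
      rw [mul_comm]
      refine mul_le_mul_of_nonneg_left ?_ (abs_nonneg _)
      rw [Nat.choose_symm_add, Nat.choose_symm_add]
      exact_mod_cast Nat.choose_le_choose b (Nat.add_le_add_right hj b)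
    refine (Finset.sum_le_card_nsmul _ _ _ h1).trans ?_
    simp
  · have h1 : ∑ δ ∈ Finset.range (δmax + 1), |c δ| *
        (((tu * ((epochDepth ℓ e + 1) * (B ^ (epochDepth ℓ e + 1) * (B * M)))).choose j : ℝ) *
          (tu * ((epochDepth ℓ e + 1) * (B ^ (epochDepth ℓ e + 1) * (B * M)))).choose δ) ≤
        (δmax + 1) * (2 ^ δmax * G) := by
      refine (Finset.sum_le_card_nsmul _ _ (2 ^ δmax * G) fun δ hδ => ?_).trans ?_
      · have hδ : δ ≤ δmax := Nat.lt_succ_iff.1 (Finset.mem_range.1 hδ)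
        exact mul_le_mul ((hc2 δ).trans (pow_le_pow_right₀ (by norm_num) hδ)) (hG δ hδ)
          (by positivity) (by positivity)
      · rw [nsmul_eq_mul, Finset.card_range]
        push_cast
        exact le_rfl
    have h2 : (4 * (a : ℝ) ^ 52) ^ E ≤ cS / (a : ℝ) ^ (8 * E) := by
      rw [le_div_iff₀ (by positivity), hcS]
      exact_mod_cast moment_root_le_card_switches hB ha hE
    calc _ ≤ ((δmax + 1) * (2 ^ δmax * G)) *
          (cY * ((4 * M : ℝ) ^ N * (cS / (a : ℝ) ^ (8 * E)))) := by
          refine mul_le_mul h1 ?_ (by positivity) (by positivity)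
          gcongr
      _ = _ := by ring

open Classical in
/-- Few batches are good. -/
theorem sum_card_goodBatch_le (e : Fin ℓ) (x : Inputs ℓ B M) (s' t' : Terminal ℓ B) (K u : ℕ)
    {β : ℝ}
    (hβ : ∀ A : Finset (BNode (epochDepth ℓ e) B), B ^ (epochDepth ℓ e + 1) ≤ 2 * A.card →
      ∀ j ≤ B ^ (epochDepth ℓ e + 1) * u,
      ((∑ σ : Switches (epochDepth ℓ e) B, (Finset.univ.filter fun y =>
      (batchTree D φ e s' t' A σ).eval (stage D φ (Function.update x e y) ℓ) = false ∧
      ((batchTree D φ e s' t' A σ).visited (stage D φ (Function.update x e y) ℓ)).card ≤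
        B ^ (epochDepth ℓ e + 1) * K ∧
      ((batchTree D φ e s' t' A σ).visited (stage D φ (Function.update x e y) ℓ) ∩
        lastChanged (stage D φ (Function.update x e y)) ℓ e).card = j).card : ℕ) : ℝ) ≤ β) :
    ((∑ σ : Switches (epochDepth ℓ e) B, (Finset.univ.filter fun y =>
        GoodBatch D φ e K u (Function.update x e y) s' t' σ).card : ℕ) : ℝ) ≤
      2 ^ B ^ (epochDepth ℓ e + 1) * ((B ^ (epochDepth ℓ e + 1) * u : ℕ) + 1) * β := by
  set N := B ^ (epochDepth ℓ e + 1) with hN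
  set P : Finset (BNode (epochDepth ℓ e) B) → ℕ → Switches (epochDepth ℓ e) B →
      Finset (BInput (epochDepth ℓ e) B M) := fun A j σ => Finset.univ.filter fun y =>
    (batchTree D φ e s' t' A σ).eval (stage D φ (Function.update x e y) ℓ) = false ∧
    ((batchTree D φ e s' t' A σ).visited (stage D φ (Function.update x e y) ℓ)).card ≤ N * K ∧
    ((batchTree D φ e s' t' A σ).visited (stage D φ (Function.update x e y) ℓ) ∩
      lastChanged (stage D φ (Function.update x e y)) ℓ e).card = j with hP
  set As := Finset.univ.filter fun A : Finset (BNode (epochDepth ℓ e) B) => N ≤ 2 * A.card with hAs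
  have hβ0 : 0 ≤ β := by
    refine le_trans ?_ (hβ Finset.univ ?_ 0 (Nat.zero_le _))
    · exact Nat.cast_nonneg _
    · rw [Finset.card_univ, Fintype.card_fun, Fintype.card_fin, Fintype.card_fin]
      omega
  -- A union bound over the set `A` of negative queries and the exact number `j` of hits, as the
  -- simulation needs both to be fixed.
  have hcover : ∀ σ : Switches (epochDepth ℓ e) B, (Finset.univ.filter fun y =>
      GoodBatch D φ e K u (Function.update x e y) s' t' σ).card ≤
      ∑ A ∈ As, ∑ j ∈ Finset.range (N * u + 1), (P A j σ).card := by
    intro σ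
    refine (Finset.card_le_card (t := As.biUnion fun A =>
      (Finset.range (N * u + 1)).biUnion fun j => P A j σ) fun y hy => ?_).trans
      (Finset.card_biUnion_le.trans (Finset.sum_le_sum fun A _ => Finset.card_biUnion_le))
    obtain ⟨A, h1, h2, h3, h4⟩ := (Finset.mem_filter.1 hy).2
    refine Finset.mem_biUnion.2 ⟨A, Finset.mem_filter.2 ⟨Finset.mem_univ _, h1⟩, ?_⟩
    exact Finset.mem_biUnion.2 ⟨_, Finset.mem_range.2 (Nat.lt_succ_of_le h4),
      Finset.mem_filter.2 ⟨Finset.mem_univ _, h2, h3, rfl⟩⟩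
  have h1 : ∑ σ : Switches (epochDepth ℓ e) B, (Finset.univ.filter fun y =>
      GoodBatch D φ e K u (Function.update x e y) s' t' σ).card ≤
      ∑ A ∈ As, ∑ j ∈ Finset.range (N * u + 1), ∑ σ, (P A j σ).card := by
    refine (Finset.sum_le_sum fun σ _ => hcover σ).trans ?_
    rw [Finset.sum_comm]
    refine Finset.sum_le_sum fun A _ => ?_
    rw [Finset.sum_comm]
  have h2 : ((∑ A ∈ As, ∑ j ∈ Finset.range (N * u + 1), ∑ σ, (P A j σ).card : ℕ) : ℝ) ≤
      ∑ A ∈ As, ((N * u : ℕ) + 1) * β := by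
    rw [Nat.cast_sum]
    refine Finset.sum_le_sum fun A hA => ?_
    rw [Nat.cast_sum]
    refine (Finset.sum_le_card_nsmul _ _ β fun j hj => ?_).trans ?_
    · exact hβ A (Finset.mem_filter.1 hA).2 j (Nat.lt_succ_iff.1 (Finset.mem_range.1 hj))
    · rw [nsmul_eq_mul, Finset.card_range]
      push_cast
      exact le_rfl
  refine (Nat.cast_le.2 h1).trans (h2.trans ?_)
  rw [Finset.sum_const, nsmul_eq_mul, mul_assoc]
  refine mul_le_mul_of_nonneg_right ?_ (by positivity)
  have h3 : As.card ≤ 2 ^ N := by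
    refine (Finset.card_le_univ _).trans ?_
    rw [Fintype.card_finset]
    simp [hN]
  exact_mod_cast h3

end EpochBound

/-! ### Numerical estimates for the two error terms. -/

section Estimates

/-- The `j`-th term of `(R⁻¹ + 1) ^ n`, which is at most `exp (n / R)`. For `n = N * R` only `R`,
the number of cells per query of a batch, is raised to the power `j`, at the price of `exp N`. -/
theorem choose_le_exp_mul_pow (n j : ℕ) {R : ℝ} (hR : 0 < R) :
    (n.choose j : ℝ) ≤ Real.exp (n / R) * R ^ j := by
  have h1 : (n.choose j : ℝ) * R⁻¹ ^ j ≤ (R⁻¹ + 1) ^ n := by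
    rcases lt_or_ge n j with h | h
    · rw [Nat.choose_eq_zero_of_lt h]
      simp only [Nat.cast_zero, zero_mul]
      positivity
    · rw [add_pow]
      refine le_trans (le_of_eq ?_) (Finset.single_le_sum (f := fun m =>
        R⁻¹ ^ m * 1 ^ (n - m) * (n.choose m : ℝ)) (fun m _ => by positivity)
        (Finset.mem_range.2 (Nat.lt_succ_of_le h)))
      simp [mul_comm]
  have h2 : (R⁻¹ + 1) ^ n ≤ Real.exp (n / R) := by
    rw [div_eq_mul_inv, Real.exp_nat_mul]
    exact pow_le_pow_left₀ (by positivity) (Real.add_one_le_exp _) n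
  have h3 := h1.trans h2
  rw [inv_pow, ← div_eq_mul_inv, div_le_iff₀ (by positivity)] at h3
  exact h3

/-- The error of the polynomial approximation, summed over all batches and counts. -/
theorem approximation_error_lt {N M K u z : ℕ} (hN : 2 ≤ N) (huz : u ≤ z) (hz : 3 ≤ z) (hM : 2 * M ≤ 2 ^ z)
    (hK : K ≤ N) :
    (2 : ℝ) ^ N * ((N * u : ℕ) + 1) * ((M : ℝ) ^ N * ((N * K : ℕ) *
      Real.exp (-(3 * (N * z : ℕ))))) < 1 / 8 := by
  have h1 : Real.exp (-(3 * (N * z : ℕ))) ≤ ((((2 : ℝ) ^ (N * z)) ^ 3))⁻¹ := by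
    rw [Real.exp_neg]
    refine inv_anti₀ (by positivity) ?_
    rw [show (3 : ℝ) * (N * z : ℕ) = (3 : ℕ) * ((N * z : ℕ) * 1) by push_cast; ring,
      Real.exp_nat_mul, Real.exp_nat_mul]
    gcongr
    have := Real.add_one_le_exp 1
    linarith
  -- One factor `2 ^ (N * z)` is spent on `2 ^ N * M ^ N`, one on `N * u + 1` and one on `8 * (N *
  -- K)`.
  have h2 : 8 * (2 ^ N * (N * u + 1) * (M ^ N * (N * K))) < (2 ^ (N * z)) ^ 3 := by
    set X := 2 ^ (N * z) with hX
    have hX0 : 0 < X := Nat.pow_pos (by norm_num)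
    have a1 : 2 ^ N * M ^ N ≤ X := by
      rw [← mul_pow, hX, mul_comm N z, pow_mul]
      exact Nat.pow_le_pow_left hM N
    have a2 : N * u + 1 ≤ X := by
      have : N * z < X := Nat.lt_two_pow_self
      have : N * u ≤ N * z := Nat.mul_le_mul_left _ huz
      omega
    have a3 : 8 * (N * K) < X := by
      rcases Nat.eq_zero_or_pos N with h0 | h0
      · omega
      have b1 : N < 2 ^ N := Nat.lt_two_pow_self
      have b2 : 2 ^ N * 2 ^ N * 2 ^ N ≤ X := by
        rw [hX, ← pow_add, ← pow_add]
        exact Nat.pow_le_pow_right (by norm_num) (by nlinarith)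
      have b3 : N * K ≤ N * N := Nat.mul_le_mul_left _ hK
      have b4 : 8 * (N * N) < 2 ^ N * 2 ^ N * 2 ^ N := by
        by_cases h3 : 3 ≤ N
        · have : 2 ^ 3 ≤ 2 ^ N := Nat.pow_le_pow_right (by norm_num) h3
          nlinarith [Nat.mul_lt_mul'' b1 b1]
        · obtain rfl : N = 2 := by omega
          norm_num
      omega
    calc 8 * (2 ^ N * (N * u + 1) * (M ^ N * (N * K))) =
          (2 ^ N * M ^ N) * (N * u + 1) * (8 * (N * K)) := by ring
      _ ≤ X * X * (8 * (N * K)) := by gcongr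
      _ < X * X * X := by
        exact Nat.mul_lt_mul_of_pos_left a3 (Nat.mul_pos hX0 hX0)
      _ = X ^ 3 := by ring
  have h3 : (8 : ℝ) * (2 ^ N * ((N * u : ℕ) + 1) * ((M : ℝ) ^ N * (N * K : ℕ))) <
      (2 ^ (N * z)) ^ 3 := by exact_mod_cast h2
  calc _ ≤ (2 : ℝ) ^ N * ((N * u : ℕ) + 1) * ((M : ℝ) ^ N * ((N * K : ℕ) *
        ((((2 : ℝ) ^ (N * z)) ^ 3))⁻¹)) := by gcongr
    _ = (2 ^ N * ((N * u : ℕ) + 1) * ((M : ℝ) ^ N * (N * K : ℕ))) / (2 ^ (N * z)) ^ 3 := by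
      rw [div_eq_mul_inv]; ring
    _ < 1 / 8 := by
      rw [div_lt_iff₀ (by positivity)]
      linarith

/-- The contribution of the moment bound, summed over all batches and counts. -/
theorem moment_error_lt {N M u a d δmax : ℕ} (hN : 0 < N) (ha : 8 ≤ a) (hM : M ≤ a ^ 2)
    (h : 6 * N + 129 * (N * u + δmax) < 8 * (d * N)) :
    (2 : ℝ) ^ N * ((N * u : ℕ) + 1) * ((δmax + 1) * 2 ^ δmax *
      (Real.exp (2 * N) * ((a : ℝ) ^ 128) ^ (N * u + δmax)) *
      ((4 * M : ℝ) ^ N / (a : ℝ) ^ (8 * (d * N)))) < 1 / 8 := by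
  have ha' : (8 : ℝ) ≤ a := by exact_mod_cast ha
  have ha1 : (1 : ℝ) ≤ a := by linarith
  have h1 : (2 : ℝ) ^ N ≤ (a : ℝ) ^ N := pow_le_pow_left₀ (by norm_num) (by linarith) N
  have h2 : ((N * u : ℕ) : ℝ) + 1 ≤ (a : ℝ) ^ (N * u) := by
    have : N * u + 1 ≤ 2 ^ (N * u) := Nat.lt_two_pow_self
    have : ((N * u : ℕ) : ℝ) + 1 ≤ 2 ^ (N * u) := by exact_mod_cast this
    exact this.trans (pow_le_pow_left₀ (by norm_num) (by linarith) _)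
  have h3 : ((δmax : ℝ) + 1) * 2 ^ δmax ≤ (a : ℝ) ^ δmax := by
    have : δmax + 1 ≤ 2 ^ δmax := Nat.lt_two_pow_self
    have : (δmax : ℝ) + 1 ≤ 2 ^ δmax := by exact_mod_cast this
    calc ((δmax : ℝ) + 1) * 2 ^ δmax ≤ 2 ^ δmax * 2 ^ δmax := by gcongr
      _ = (2 * 2) ^ δmax := by rw [mul_pow]
      _ ≤ _ := pow_le_pow_left₀ (by norm_num) (by linarith) _
  have h4 : Real.exp (2 * N) ≤ (a : ℝ) ^ N := by
    rw [mul_comm, Real.exp_nat_mul]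
    refine pow_le_pow_left₀ (Real.exp_pos _).le (le_trans ?_ ha') N
    have := Real.exp_one_lt_d9
    have h0 := Real.exp_pos 1
    rw [show (2 : ℝ) = 1 + 1 by norm_num, Real.exp_add]
    nlinarith
  have h5 : (4 * M : ℝ) ^ N ≤ (a : ℝ) ^ (3 * N) := by
    rw [pow_mul]
    refine pow_le_pow_left₀ (by positivity) ?_ N
    have hM' : (M : ℝ) ≤ (a : ℝ) ^ 2 := by exact_mod_cast hM
    nlinarith [sq_nonneg (a : ℝ)]
  have h6 : (8 : ℝ) ≤ (a : ℝ) ^ N := ha'.trans (le_self_pow₀ ha1 hN.ne')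
  -- Everything is measured in powers of `a`. The constant `8`, the choice of `A`, the exponential
  -- and `(4 * M) ^ N` use `N + N + N + 3 * N`; each guessed cell uses `128` for its choice and one
  -- more for the sums and coefficients.
  have h7 : (8 : ℝ) * ((a : ℝ) ^ N * a ^ (N * u) * (a ^ δmax *
      ((a : ℝ) ^ N * ((a : ℝ) ^ 128) ^ (N * u + δmax)) * a ^ (3 * N))) <
      (a : ℝ) ^ (8 * (d * N)) := by
    calc _ ≤ (a : ℝ) ^ N * ((a : ℝ) ^ N * a ^ (N * u) * (a ^ δmax *
          ((a : ℝ) ^ N * ((a : ℝ) ^ 128) ^ (N * u + δmax)) * a ^ (3 * N))) := by gcongr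
      _ = (a : ℝ) ^ (6 * N + 129 * (N * u + δmax)) := by
          rw [← pow_mul]
          simp only [← pow_add]
          congr 1
          ring
      _ < _ := pow_lt_pow_right₀ (by linarith) h
  rw [← mul_div_assoc, ← mul_div_assoc, div_lt_iff₀ (by positivity)]
  have h8 : (2 : ℝ) ^ N * ((N * u : ℕ) + 1) * ((δmax + 1) * 2 ^ δmax *
      (Real.exp (2 * N) * ((a : ℝ) ^ 128) ^ (N * u + δmax)) * (4 * M : ℝ) ^ N) ≤
      (a : ℝ) ^ N * a ^ (N * u) * (a ^ δmax *
      ((a : ℝ) ^ N * ((a : ℝ) ^ 128) ^ (N * u + δmax)) * a ^ (3 * N)) := by gcongr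
  linarith

/-- The later cells number a multiple of `B ^ d`, and the spare factor `B = a ^ 64` in `N` pays for
`ℓ`, `d + 1`, `M` and `a`. The guessed cells number at most `N * (d + 1)`. -/
theorem message_length_le {ℓ B M w a tu d N u δmax : ℕ} (haw : a = tu * w) (ha : 8 ≤ a)
    (hM : M ≤ a ^ 2) (hℓ : 4 * ℓ ≤ a ^ 2) (hd : d + 1 ≤ 2 * ℓ) (hB : B = a ^ 64)
    (hN : N = B ^ (d + 1)) (h : N * u + δmax ≤ N * (d + 1)) {j : ℕ} (hj : j ≤ N * u)
    (htu : 0 < tu) :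
    w * (2 * (ℓ * (tu * ((d + 1) * (B ^ d * M)))) + 3 * j + δmax) ≤ 8 * a ^ 4 * N := by
  have hw : w ≤ a := by rw [haw]; exact Nat.le_mul_of_pos_left _ htu
  have hd' : d + 1 ≤ a ^ 2 := by omega
  have h1 : w * (2 * (ℓ * (tu * ((d + 1) * (B ^ d * M))))) ≤ 2 * a ^ 4 * N := by
    calc w * (2 * (ℓ * (tu * ((d + 1) * (B ^ d * M))))) =
        2 * (ℓ * (d + 1) * M * a) * B ^ d := by rw [haw]; ring
      _ ≤ 2 * (a ^ 2 * a ^ 2 * a ^ 2 * a) * B ^ d := by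
        gcongr
        omega
      _ ≤ 2 * (a ^ 4 * B) * B ^ d := by
        refine Nat.mul_le_mul_right _ (Nat.mul_le_mul_left _ ?_)
        rw [hB]
        simp only [← pow_add, ← pow_succ]
        exact Nat.pow_le_pow_right (by omega) (by norm_num)
      _ = 2 * a ^ 4 * N := by rw [hN]; ring
  have h2 : w * (3 * j + δmax) ≤ 3 * a ^ 4 * N := by
    calc w * (3 * j + δmax) ≤ a * (3 * (N * (d + 1))) := by
          gcongr
          omega
      _ ≤ a * (3 * (N * a ^ 2)) := by gcongr
      _ = 3 * a ^ 3 * N := by ring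
      _ ≤ 3 * a ^ 4 * N := by
        gcongr
        · omega
        · norm_num
  calc _ = w * (2 * (ℓ * (tu * ((d + 1) * (B ^ d * M))))) + w * (3 * j + δmax) := by ring
    _ ≤ 2 * a ^ 4 * N + 3 * a ^ 4 * N := Nat.add_le_add h1 h2
    _ ≤ _ := by nlinarith [Nat.zero_le (a ^ 4 * N)]

theorem choose_mul_choose_le {a N R Ct j δ J δmax : ℕ} (hC : Ct = N * R) (hR0 : 0 < R)
    (hR : R ≤ a ^ 128) (hj : j ≤ J) (hδ : δ ≤ δmax) :
    ((Ct.choose j : ℝ) * Ct.choose δ) ≤ Real.exp (2 * N) * ((a : ℝ) ^ 128) ^ (J + δmax) := by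
  have hR0' : (0 : ℝ) < R := by exact_mod_cast hR0
  have hRa : (R : ℝ) ≤ (a : ℝ) ^ 128 := by exact_mod_cast hR
  have hRa1 : (1 : ℝ) ≤ (a : ℝ) ^ 128 := by
    have : 1 ≤ R := hR0
    have : (1 : ℝ) ≤ R := by exact_mod_cast this
    linarith
  have h1 : ∀ i i', i ≤ i' → (Ct.choose i : ℝ) ≤ Real.exp N * ((a : ℝ) ^ 128) ^ i' := by
    intro i i' hi
    refine (choose_le_exp_mul_pow Ct i hR0').trans ?_
    have h2 : (Ct : ℝ) / R = N := by
      rw [hC]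
      push_cast
      field_simp
    rw [h2]
    refine mul_le_mul_of_nonneg_left ?_ (Real.exp_pos _).le
    exact (pow_le_pow_left₀ hR0'.le hRa i).trans (pow_le_pow_right₀ hRa1 hi)
  calc ((Ct.choose j : ℝ) * Ct.choose δ) ≤ (Real.exp N * ((a : ℝ) ^ 128) ^ J) *
        (Real.exp N * ((a : ℝ) ^ 128) ^ δmax) :=
        mul_le_mul (h1 j J hj) (h1 δ δmax hδ) (by positivity) (by positivity)
    _ = _ := by
        rw [two_mul, Real.exp_add, pow_add]
        ring

end Estimates

/-! ### Abundance and rarity of good batches contradict each other. -/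

section Contradiction
variable {ℓ B M n w : ℕ} [NeZero M] {D : ReachabilityDS n w} {φ : GNode ℓ B M ↪ Fin n}

/-- Some large epoch receives few of the probes. -/
theorem exists_epoch_sum_askHits_le (hℓ : 0 < ℓ) {T : ℝ} (hT0 : 0 ≤ T)
    (hT : ∑ x, ∑ s, ∑ t, (askProbes D φ x s t : ℝ) ≤
      T * (Fintype.card (Inputs ℓ B M) * (Fintype.card (Terminal ℓ B)) ^ 2)) :
    ∃ e : Fin ℓ, 2 * (e : ℕ) < ℓ ∧ ∑ x, ∑ s, ∑ t, (askHits D φ e x s t : ℝ) ≤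
      (2 * T / ℓ) * (Fintype.card (Inputs ℓ B M) * (Fintype.card (Terminal ℓ B)) ^ 2) := by
  -- The epochs below `h` are those with `2 * e < ℓ`; their butterflies have depth at least `ℓ`.
  set h := (ℓ + 1) / 2 with hh
  set W : ℝ := (Fintype.card (Inputs ℓ B M) * (Fintype.card (Terminal ℓ B)) ^ 2) with hW
  have hW0 : 0 ≤ W := by positivity
  have hℓ' : (0 : ℝ) < ℓ := by exact_mod_cast hℓ
  have h1 : ∑ e ∈ Finset.range h, ∑ x, ∑ s, ∑ t, (askHits D φ e x s t : ℝ) ≤ T * W := by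
    refine le_trans ?_ hT
    rw [Finset.sum_comm]
    refine Finset.sum_le_sum fun x _ => ?_
    rw [Finset.sum_comm]
    refine Finset.sum_le_sum fun s _ => ?_
    rw [Finset.sum_comm]
    refine Finset.sum_le_sum fun t _ => ?_
    have h2 : ∑ e ∈ Finset.range h, askHits D φ e x s t ≤ askProbes D φ x s t :=
      (sum_card_inter_lastChanged_le (stage D φ x) ℓ h (by omega) _).trans
        (QueryTree.card_visited_le _ _)
    exact_mod_cast h2
  have h2 : ∑ e ∈ Finset.range h, ∑ x, ∑ s, ∑ t, (askHits D φ e x s t : ℝ) ≤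
      ∑ _e ∈ Finset.range h, (2 * T / ℓ) * W := by
    refine h1.trans ?_
    rw [Finset.sum_const, Finset.card_range, nsmul_eq_mul]
    have h3 : (ℓ : ℝ) ≤ 2 * h := by
      have : ℓ ≤ 2 * h := by omega
      exact_mod_cast this
    have h4 : T ≤ h * (2 * T / ℓ) := by
      rw [← mul_div_assoc, le_div_iff₀ hℓ']
      nlinarith
    calc T * W ≤ (h * (2 * T / ℓ)) * W := mul_le_mul_of_nonneg_right h4 hW0
      _ = h * (2 * T / ℓ * W) := mul_assoc _ _ _
  obtain ⟨e, he, h3⟩ := Finset.exists_le_of_sum_le (Finset.nonempty_range_iff.2 (by omega)) h2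
  have he := Finset.mem_range.1 he
  exact ⟨⟨e, by omega⟩, by simp only; omega, h3⟩

/-- No data structure answers the queries with few probes on average. -/
theorem not_sum_askProbes_le (hD : D.Correct) {tu : ℕ} (hU : D.UpdateTimeLE tu) (hℓ : 0 < ℓ)
    {a : ℕ} (haw : a = tu * w) (ha : 8 ≤ a) (hℓa : 4 * ℓ ≤ a ^ 2) (hB : B = a ^ 64)
    (hM : M = 4 * ℓ) {T : ℝ} (hT0 : 0 ≤ T) {K u z : ℕ} (hu : 0 < u) (huz : u ≤ z) (hz : 3 ≤ z)
    (hMz : 2 * M ≤ 2 ^ z) (hzK : z ≤ K) (hK : K ≤ 2 ^ ℓ) (hTK : 8 * T ≤ K) (hTu : 16 * T ≤ ℓ * u)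
    (hlast : 6 + 129 * (u + 22 * √(K * z)) < 8 * (ℓ : ℝ)) :
    ¬ ∑ x, ∑ s, ∑ t, (askProbes D φ x s t : ℝ) ≤
      T * (Fintype.card (Inputs ℓ B M) * (Fintype.card (Terminal ℓ B)) ^ 2) := by
  intro hT
  classical
  have hℓ' : (0 : ℝ) < ℓ := by exact_mod_cast hℓ
  have htu : 0 < tu := by
    rcases Nat.eq_zero_or_pos tu with h | h
    · rw [h, zero_mul] at haw; omega
    · exact h
  have htua : tu ≤ a := by
    rw [haw]
    refine Nat.le_mul_of_pos_right _ ?_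
    rcases Nat.eq_zero_or_pos w with h | h
    · rw [h, mul_zero] at haw; omega
    · exact h
  have hB0 : 0 < B := by rw [hB]; exact Nat.pow_pos (by omega)
  have : NeZero B := ⟨hB0.ne'⟩
  obtain ⟨e, he, hhits⟩ := exists_epoch_sum_askHits_le hℓ hT0 hT
  have hdℓ : ℓ ≤ epochDepth ℓ e + 1 := by rw [epochDepth]; omega
  have hd2 : epochDepth ℓ e + 1 ≤ 2 * ℓ := by rw [epochDepth]; omega
  obtain ⟨x, s', t', hgood⟩ := exists_many_goodBatch hD hM.ge e (by omega : 0 < K) hu hT hhits hTK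
    (by
      rw [← mul_div_assoc, div_le_iff₀ hℓ']
      linarith)
  set N := B ^ (epochDepth ℓ e + 1) with hN
  have hN0 : 0 < N := Nat.pow_pos hB0
  have hN0' : (0 : ℝ) < N := by exact_mod_cast hN0
  have hB2 : 2 ≤ B := by
    rw [hB]
    exact le_trans (by omega : 2 ≤ a) (Nat.le_self_pow (by norm_num) a)
  have hN2 : 2 ≤ N := hB2.trans (Nat.le_self_pow (by omega) B)
  have hKN : K ≤ N := by
    refine hK.trans ((Nat.pow_le_pow_right (by norm_num) hdℓ).trans ?_)
    exact Nat.pow_le_pow_left hB2 _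
  -- Both parameters scale with the batch: `N * K` bounds its probes, and `N * z` its hits. The
  -- degree therefore is at most `22 * N * √(K * z)`.
  obtain ⟨δmax, c, hδ, hc2, hc0, hck⟩ := exists_decaying_newton_series (ρ := N * z) (k := N * K)
    (Nat.mul_pos hN0 (by omega)) (Nat.mul_le_mul_left _ hzK)
  have hδ' : (δmax : ℝ) ≤ 22 * (N * √(K * z)) := by
    refine hδ.trans (le_of_eq ?_)
    congr 1
    push_cast
    rw [show ((N : ℝ) * K * (N * z)) = N ^ 2 * (K * z) by ring, Real.sqrt_mul (by positivity),
      Real.sqrt_sq hN0'.le]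
  have hexp : 6 * N + 129 * (N * u + δmax) < 8 * ((epochDepth ℓ e + 1) * N) := by
    have h1 : (6 : ℝ) * N + 129 * (N * u + δmax) < 8 * ((epochDepth ℓ e + 1) * N) := by
      have h2 : (ℓ : ℝ) ≤ epochDepth ℓ e + 1 := by exact_mod_cast hdℓ
      have h3 := mul_lt_mul_of_pos_left hlast hN0'
      nlinarith
    exact_mod_cast h1
  have hM2 : M ≤ a ^ 2 := hM.le.trans hℓa
  have ha12 : 12 ≤ a ^ 4 := by
    have : 8 ^ 4 ≤ a ^ 4 := Nat.pow_le_pow_left ha 4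
    omega
  have hR : tu * ((epochDepth ℓ e + 1) * (B * M)) ≤ a ^ 128 := by
    calc tu * ((epochDepth ℓ e + 1) * (B * M)) ≤ a * (a ^ 2 * (a ^ 64 * a ^ 2)) := by
          rw [hB]
          gcongr
          omega
      _ = a ^ 69 := by ring
      _ ≤ a ^ 128 := Nat.pow_le_pow_right (by omega) (by norm_num)
  have hR0 : 0 < tu * ((epochDepth ℓ e + 1) * (B * M)) := by
    have := NeZero.pos M
    positivity
  set cS : ℝ := ((Fintype.card (Switches (epochDepth ℓ e) B) : ℕ) : ℝ) with hcS
  set cY : ℝ := ((Fintype.card (BInput (epochDepth ℓ e) B M) : ℕ) : ℝ) with hcY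
  have hW0 : 0 < cS * cY := by
    have h1 : 0 < Fintype.card (Switches (epochDepth ℓ e) B) := Fintype.card_pos
    have h2 : 0 < Fintype.card (BInput (epochDepth ℓ e) B M) := Fintype.card_pos
    rw [hcS, hcY]
    exact_mod_cast Nat.mul_pos h1 h2
  have hup := sum_card_goodBatch_le (D := D) (φ := φ) e x s' t' K u
    (fun A hA j hj => sum_card_batch_le hD hU e x s' t' A hA hB ha12 (ρ := N * z) (k := N * K)
      (hj.trans (Nat.mul_le_mul_left _ huz)) c hc2 hc0 hck
      (message_length_le haw ha hM2 hℓa hd2 hB hN (by nlinarith) hj htu)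
      (G := Real.exp (2 * N) * ((a : ℝ) ^ 128) ^ (N * u + δmax))
      (fun δ hδ => choose_mul_choose_le (by ring) hR0 hR hj hδ))
  have hgood' : cS * cY ≤ 4 * ((∑ σ : Switches (epochDepth ℓ e) B, (Finset.univ.filter fun y =>
      GoodBatch D φ e K u (Function.update x e y) s' t' σ).card : ℕ) : ℝ) := by
    rw [hcS, hcY]
    exact_mod_cast hgood
  -- Either error accounts for less than an eighth of the pairs of batch and input, whereas a
  -- quarter of them is good.
  have e1 := approximation_error_lt hN2 huz hz hMz hKN
  have e2 := moment_error_lt hN0 ha hM2 hexp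
  have h3 := hgood'.trans (mul_le_mul_of_nonneg_left hup (by norm_num : (0 : ℝ) ≤ 4))
  have h4 := mul_lt_mul_of_pos_left (add_lt_add e1 e2) hW0
  rw [← hcS, ← hcY] at h3
  linarith

end Contradiction

/-! ### Choice of the thresholds. -/

section Parameters

theorem exists_mul_sq_le_two_pow : ∃ q₀ : ℕ, ∀ q : ℕ, q₀ ≤ q → 8000000 * q ^ 2 ≤ 2 ^ q := by
  have h := tendsto_pow_const_div_const_pow_of_one_lt 2 (by norm_num : (1 : ℝ) < 2)
  have h1 := h.eventually (gt_mem_nhds (by norm_num : (0 : ℝ) < 1 / 8000000))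
  obtain ⟨q₀, hq⟩ := Filter.eventually_atTop.1 h1
  refine ⟨q₀, fun q hq' => ?_⟩
  have h2 := hq q hq'
  rw [div_lt_iff₀ (by positivity)] at h2
  have h3 : (8000000 : ℝ) * (q : ℝ) ^ 2 ≤ 2 ^ q := by linarith
  exact_mod_cast h3

/-- The thresholds for the numbers of probes of a batch. -/
theorem exists_thresholds : ∃ ℓ₀ : ℕ, 1 ≤ ℓ₀ ∧ ∀ ℓ : ℕ, ℓ₀ ≤ ℓ → ∀ T : ℝ, 0 ≤ T →
    T ≤ 1 / 10000 * (ℓ * √ℓ) → ∃ K u z : ℕ, 0 < u ∧ u ≤ z ∧ 3 ≤ z ∧ 2 * (4 * ℓ) ≤ 2 ^ z ∧ z ≤ K ∧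
      K ≤ 2 ^ ℓ ∧ 8 * T ≤ K ∧ 16 * T ≤ ℓ * u ∧
      6 + 129 * (u + 22 * √(K * z)) < 8 * (ℓ : ℝ) := by
  obtain ⟨q₀, hq₀⟩ := exists_mul_sq_le_two_pow
  refine ⟨(1000 * q₀ + 100000) ^ 2, Nat.one_le_pow _ _ (by omega), fun ℓ hℓ T hT0 hT => ?_⟩
  set r : ℝ := √ℓ with hr
  have hℓ' : ((1000 * q₀ + 100000 : ℕ) : ℝ) ^ 2 ≤ ℓ := by exact_mod_cast hℓ
  have hr1 : (1000 * q₀ + 100000 : ℝ) ≤ r := by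
    have := Real.le_sqrt_of_sq_le hℓ'
    push_cast at this
    exact this
  have hq0 : (0 : ℝ) ≤ q₀ := Nat.cast_nonneg _
  have hr0 : 0 < r := by linarith
  have hr2 : (ℓ : ℝ) = r ^ 2 := (Real.sq_sqrt (Nat.cast_nonneg _)).symm
  have hℓpos : (0 : ℝ) < ℓ := by rw [hr2]; positivity
  -- `u` and `K` are the means `2 * T / ℓ` and `T` with the factor `8` for Markov. The slack `q` of
  -- order `√ℓ` makes `2 ^ z` exceed `8 * ℓ`. For `T ≤ ℓ * √ℓ / 10000` all of `u` and `z` is `O(√ℓ)`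
  -- and `K` is `O(ℓ * √ℓ)`, so `√(K * z)` is a small multiple of `ℓ`: this yields the exponent `3 /
  -- 2`.
  set u := ⌈16 * T / ℓ⌉₊ + 1 with hu
  set q := ⌈r / 1000⌉₊ + 3 with hq
  set z := u + q with hz
  set K := ⌈8 * T⌉₊ + z with hK
  have hu1 : (u : ℝ) ≤ 16 / 10000 * r + 2 := by
    have h1 : 16 * T / ℓ ≤ 16 / 10000 * r := by
      rw [div_le_iff₀ hℓpos]
      nlinarith
    have h2 := Nat.ceil_lt_add_one (show 0 ≤ 16 * T / ℓ by positivity)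
    rw [hu]
    push_cast
    linarith
  have hq1 : (q : ℝ) ≤ r / 1000 + 4 := by
    have h2 := Nat.ceil_lt_add_one (show 0 ≤ r / 1000 by positivity)
    rw [hq]
    push_cast
    linarith
  have hq2 : r / 1000 + 3 ≤ q := by
    have h2 := Nat.le_ceil (r / 1000)
    rw [hq]
    push_cast
    linarith
  have hz1 : (z : ℝ) ≤ 3 / 1000 * r := by
    rw [hz]
    push_cast
    linarith
  have hK1 : (K : ℝ) ≤ 12 / 10000 * (ℓ * r) := by
    have h2 := Nat.ceil_lt_add_one (show 0 ≤ 8 * T by positivity)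
    have h3 : r * 100000 ≤ ℓ * r := by rw [hr2]; nlinarith
    rw [hK]
    push_cast
    linarith
  refine ⟨K, u, z, by omega, by omega, by omega, ?_, by omega, ?_, ?_, ?_, ?_⟩
  · have h1 : q₀ ≤ q := by
      have : (q₀ : ℝ) ≤ q := by linarith
      exact_mod_cast this
    have h2 : ℓ ≤ 1000000 * q ^ 2 := by
      have : (ℓ : ℝ) ≤ 1000000 * (q : ℝ) ^ 2 := by
        rw [hr2]
        nlinarith
      exact_mod_cast this
    calc 2 * (4 * ℓ) ≤ 8000000 * q ^ 2 := by omega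
      _ ≤ 2 ^ q := hq₀ q h1
      _ ≤ 2 ^ z := Nat.pow_le_pow_right (by norm_num) (by omega)
  · have h1 : q₀ ≤ ℓ := by
      have : (q₀ : ℝ) ≤ ℓ := by rw [hr2]; nlinarith
      exact_mod_cast this
    have h2 : K ≤ ℓ ^ 2 := by
      have h3 : r ≤ ℓ := by rw [hr2]; nlinarith
      have : (K : ℝ) ≤ (ℓ : ℝ) ^ 2 := by nlinarith
      exact_mod_cast this
    have := hq₀ ℓ h1
    omega
  · have h2 := Nat.le_ceil (8 * T)
    have h3 : (0 : ℝ) ≤ z := Nat.cast_nonneg _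
    rw [hK]
    push_cast
    linarith
  · have h2 := Nat.le_ceil (16 * T / ℓ)
    rw [div_le_iff₀ hℓpos] at h2
    rw [hu]
    push_cast
    nlinarith
  -- `129 * 22 * (2 / 1000) < 6` leaves room for the terms of order `√ℓ` below `8 * ℓ`.
  · have h1 : √((K : ℝ) * z) ≤ 2 / 1000 * ℓ := by
      rw [Real.sqrt_le_left (by positivity)]
      have h0 : (0 : ℝ) ≤ z := Nat.cast_nonneg _
      calc (K : ℝ) * z ≤ 12 / 10000 * (ℓ * r) * (3 / 1000 * r) :=
            mul_le_mul hK1 hz1 h0 (by positivity)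
        _ = 36 / 10000000 * (ℓ * r ^ 2) := by ring
        _ ≤ (2 / 1000 * ℓ) ^ 2 := by
          rw [← hr2]
          nlinarith [sq_nonneg (ℓ : ℝ)]
    have h2 : 100000 * r ≤ ℓ := by rw [hr2]; nlinarith
    linarith

end Parameters

/-! ### From randomized to deterministic data structures. -/

section Randomized
variable {n w : ℕ} {Ω : Type*} [MeasurableSpace Ω] {μ : Measure Ω} [IsProbabilityMeasure μ]
  {D : Ω → ReachabilityDS n w} {tu : ℕ} {tq : ℝ≥0}

/-- Some outcome of the coins is good on average over the hard distribution. -/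
theorem exists_sum_askProbes_le {ℓ B M : ℕ} [NeZero M] (h : IsDynamicReachabilityDS μ D tu tq)
    (φ : GNode ℓ B M ↪ Fin n) : ∃ ω, (D ω).Correct ∧ (D ω).UpdateTimeLE tu ∧
      ∑ x, ∑ s, ∑ t, (askProbes (D ω) φ x s t : ℝ) ≤
        tq * (Fintype.card (Inputs ℓ B M) * (Fintype.card (Terminal ℓ B)) ^ 2) := by
  set f : Inputs ℓ B M → Terminal ℓ B → Terminal ℓ B → Ω → ℝ≥0∞ :=
    fun x s t ω => (askProbes (D ω) φ x s t : ℝ≥0∞) with hf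
  have hmeas : ∀ x s t, AEMeasurable (f x s t) μ := fun x s t =>
    h.aemeasurable_queryTime _ (validInsertions_history φ x ℓ) (φ (src s), φ (snk t))
  have hint : ∀ x s t, ∫⁻ ω, f x s t ω ∂μ ≤ tq := fun x s t =>
    h.queryTime _ (validInsertions_history φ x ℓ) (φ (src s), φ (snk t))
  have hgood : ∀ᵐ ω ∂μ, (D ω).Correct ∧ (D ω).UpdateTimeLE tu := h.correct.and h.updateTime
  obtain ⟨ω, hω, hle⟩ := exists_notMem_null_le_lintegral
    (f := fun ω => ∑ x, ∑ s, ∑ t, f x s t ω) (μ := μ)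
    (Finset.aemeasurable_fun_sum _ fun x _ => Finset.aemeasurable_fun_sum _ fun s _ =>
      Finset.aemeasurable_fun_sum _ fun t _ => hmeas x s t) (ae_iff.1 hgood)
  simp only [Set.mem_ofPred_eq, not_not] at hω
  refine ⟨ω, hω.1, hω.2, ?_⟩
  have h1 : ∫⁻ ω, ∑ x, ∑ s, ∑ t, f x s t ω ∂μ ≤
      ∑ _x : Inputs ℓ B M, ∑ _s : Terminal ℓ B, ∑ _t : Terminal ℓ B, (tq : ℝ≥0∞) := by
    rw [lintegral_finsetSum' _ fun x _ => Finset.aemeasurable_fun_sum _ fun s _ =>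
      Finset.aemeasurable_fun_sum _ fun t _ => hmeas x s t]
    refine Finset.sum_le_sum fun x _ => ?_
    rw [lintegral_finsetSum' _ fun s _ => Finset.aemeasurable_fun_sum _ fun t _ => hmeas x s t]
    refine Finset.sum_le_sum fun s _ => ?_
    rw [lintegral_finsetSum' _ fun t _ => hmeas x s t]
    exact Finset.sum_le_sum fun t _ => hint x s t
  have h2 := hle.trans h1
  simp only [hf] at h2
  have h3 : ∑ x, ∑ s, ∑ t, (askProbes (D ω) φ x s t : ℝ≥0) ≤
      ∑ _x : Inputs ℓ B M, ∑ _s : Terminal ℓ B, ∑ _t : Terminal ℓ B, tq := by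
    exact_mod_cast h2
  have h4 : ∑ x, ∑ s, ∑ t, (askProbes (D ω) φ x s t : ℝ) ≤
      ∑ _x : Inputs ℓ B M, ∑ _s : Terminal ℓ B, ∑ _t : Terminal ℓ B, (tq : ℝ) := by
    exact_mod_cast h3
  refine h4.trans (le_of_eq ?_)
  simp only [Finset.sum_const, Finset.card_univ, nsmul_eq_mul]
  ring

theorem validInsertions_nil : ValidInsertions ([] : List (Fin n × Fin n)) := by
  refine ⟨List.nodup_nil, fun v hv => ?_⟩
  obtain ⟨c, -, h⟩ := Relation.TransGen.tail'_iff.1 hv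
  simp [Edge] at h

/-- A query that probes nothing would give the same answer before and after the edge is inserted.
The resulting bound `1 ≤ tq` covers the range where `lg n / lg (tu * w)` is bounded. -/
theorem one_le_queryTime {D : ReachabilityDS n w} (hD : D.Correct) (hn : 2 ≤ n) :
    1 ≤ D.queryTime [] (⟨0, by omega⟩, ⟨1, by omega⟩) := by
  set a : Fin n := ⟨0, by omega⟩ with ha
  set b : Fin n := ⟨1, by omega⟩ with hb
  have hab : a ≠ b := by simp [ha, hb, Fin.ext_iff]
  have hv1 : ValidInsertions [(a, b)] := by
    refine ⟨List.nodup_singleton _, fun v hv => ?_⟩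
    obtain ⟨c, -, h⟩ := Relation.TransGen.tail'_iff.1 hv
    obtain ⟨c', h', -⟩ := Relation.TransGen.head'_iff.1 hv
    simp only [Edge, List.mem_singleton, Prod.mk.injEq] at h h'
    exact hab (h'.1.symm.trans h.2)
  have h0 := hD [] validInsertions_nil a b
  have h1 := hD [(a, b)] hv1 a b
  have hr0 : ¬ Reaches ([] : List (Fin n × Fin n)) a b := by
    intro h
    rcases Relation.ReflTransGen.cases_tail h with h | ⟨c, -, h⟩
    · exact hab h.symm
    · simp [Edge] at h
  have hr1 : Reaches [(a, b)] a b := Relation.ReflTransGen.single (by simp [Edge])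
  cases hq : D.query (a, b) with
  | answer b' =>
    rw [hq] at h0 h1
    exact absurd (h0.1 (h1.2 hr1)) hr0
  | probe addr next =>
    rw [ReachabilityDS.queryTime, hq]
    exact Nat.le_add_left _ _

theorem one_le_of_isDynamicReachabilityDS (h : IsDynamicReachabilityDS μ D tu tq) (hn : 2 ≤ n) :
    1 ≤ (tq : ℝ) := by
  have h1 : ∫⁻ _ω, (1 : ℝ≥0∞) ∂μ ≤ tq := by
    refine le_trans (lintegral_mono_ae ?_) (h.queryTime [] validInsertions_nil (⟨0, by omega⟩, ⟨1, by omega⟩))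
    filter_upwards [h.correct] with ω hω
    exact_mod_cast one_le_queryTime hω hn
  rw [lintegral_one, measure_univ] at h1
  exact_mod_cast h1

/-- The lower bound for a given number of epochs. -/
theorem exists_epochs_lower_bound : ∃ ℓ₀ : ℕ, 1 ≤ ℓ₀ ∧ ∀ {n w : ℕ} {Ω : Type*} [MeasurableSpace Ω]
    {μ : Measure Ω} [IsProbabilityMeasure μ] {D : Ω → ReachabilityDS n w} {tu : ℕ} {tq : ℝ≥0},
    IsDynamicReachabilityDS μ D tu tq → ∀ ℓ a : ℕ, ℓ₀ ≤ ℓ → a = tu * w → 8 ≤ a → 4 * ℓ ≤ a ^ 2 →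
      a ^ (64 * (2 * ℓ + 1)) ≤ n → 1 / 10000 * (ℓ * √ℓ) < (tq : ℝ) := by
  obtain ⟨ℓ₀, h1, hℓ₀⟩ := exists_thresholds
  refine ⟨ℓ₀, h1, ?_⟩
  intro n w Ω _ μ _ D tu tq h ℓ a hℓ haw ha hℓa hn
  by_contra! hcon
  have hℓ1 : 1 ≤ ℓ := h1.trans hℓ
  obtain ⟨K, u, z, hu, huz, hz, hMz, hzK, hK, hTK, hTu, hlast⟩ := hℓ₀ ℓ hℓ tq tq.2 hcon
  have : NeZero (4 * ℓ) := ⟨by omega⟩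
  have hfit : 2 + ℓ * ((2 * ℓ + 1) * (4 * ℓ)) ≤ a ^ 64 := by
    calc 2 + ℓ * ((2 * ℓ + 1) * (4 * ℓ)) ≤ a ^ 2 + a ^ 2 * (a ^ 2 * a ^ 2) := by
          gcongr
          · nlinarith
          · omega
          · omega
      _ ≤ a * a ^ 6 := by nlinarith [Nat.pow_le_pow_right (show 0 < a by omega) (show 2 ≤ 6 by norm_num)]
      _ = a ^ 7 := by ring
      _ ≤ a ^ 64 := Nat.pow_le_pow_right (by omega) (by norm_num)
  have hcard : Fintype.card (GNode ℓ (a ^ 64) (4 * ℓ)) ≤ Fintype.card (Fin n) := by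
    rw [Fintype.card_fin]
    refine (card_gNode_le hℓ1 hfit).trans ?_
    rwa [← pow_mul]
  obtain ⟨φ⟩ := Function.Embedding.nonempty_of_card_le hcard
  obtain ⟨ω, hD, hU, hsum⟩ := exists_sum_askProbes_le h φ
  exact not_sum_askProbes_le hD hU hℓ1 haw ha hℓa rfl rfl tq.2 hu huz hz hMz hzK hK hTK hTu hlast
    hsum

end Randomized

end CellProbe

/-! ### The number of epochs as a function of `n`. -/

theorem theorem1 :
    ∀ c : ℝ, 0 < c → ∃ C : ℝ, 0 < C ∧ ∃ n₀ : ℕ, ∀ n : ℕ, n₀ ≤ n →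
      ∀ w : ℕ, c * Real.logb 2 (n : ℝ) ≤ (w : ℝ) →
      ∀ (Ω : Type*) [MeasurableSpace Ω] (μ : Measure Ω) [IsProbabilityMeasure μ]
        (D : Ω → CellProbe.ReachabilityDS n w) (tu : ℕ) (tq : ℝ≥0),
        CellProbe.IsDynamicReachabilityDS μ D tu tq →
        C * (Real.logb 2 (n : ℝ) ^ (3 / 2 : ℝ) / Real.logb 2 ((tu : ℝ) * (w : ℝ)) ^ 2)
          ≤ (tq : ℝ) := by
  intro c hc
  obtain ⟨ℓ₀, hℓ₀, hbound⟩ := CellProbe.exists_epochs_lower_bound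
  -- For `X / Z ≤ R` the bound `1 ≤ tq` suffices; beyond that, `⌊X / Z / 256⌋₊` epochs are at least
  -- `ℓ₀`.
  set R : ℝ := 256 * (ℓ₀ + 1) with hR
  have hR0 : 0 < R := by positivity
  have hR1 : 512 ≤ R := by
    have : (1 : ℝ) ≤ ℓ₀ := by exact_mod_cast hℓ₀
    linarith
  -- The threshold for `n` gives `8 + 4 / c ≤ w`: the `8` is needed for `8 ≤ a`, the `4 / c` for `4
  -- * ℓ ≤ a ^ 2`.
  refine ⟨1 / (10000 * (R * √R)), by positivity, ⌈(2 : ℝ) ^ ((8 + 4 / c) / c)⌉₊ + 2, ?_⟩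
  intro n hn w hw Ω _ μ _ D tu tq h
  have hn2 : 2 ≤ n := by omega
  have hn0 : (0 : ℝ) < n := by
    have : 0 < n := by omega
    exact_mod_cast this
  set X := Real.logb 2 (n : ℝ) with hX
  have hXlow : (8 + 4 / c) / c ≤ X := by
    rw [hX, Real.le_logb_iff_rpow_le (by norm_num) hn0]
    refine (Nat.le_ceil _).trans ?_
    exact_mod_cast (by omega : ⌈(2 : ℝ) ^ ((8 + 4 / c) / c)⌉₊ ≤ n)
  have hX0 : 0 < X := lt_of_lt_of_le (by positivity) hXlow
  have hwlow : 8 + 4 / c ≤ w := by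
    rw [div_le_iff₀ hc] at hXlow
    linarith
  rcases Nat.eq_zero_or_pos tu with h0 | htu
  -- The logarithm of `0` and the quotient by `0` are both `0` by convention, so the left side
  -- vanishes.
  · simp [h0]
  set a := tu * w with ha
  have hwa : (w : ℝ) ≤ a := by
    have : w ≤ a := Nat.le_mul_of_pos_left _ htu
    exact_mod_cast this
  have ha8 : 8 + 4 / c ≤ (a : ℝ) := hwlow.trans hwa
  have hc4 : 0 < 4 / c := by positivity
  have ha8' : 8 ≤ a := by
    have : (8 : ℝ) ≤ a := by linarith
    exact_mod_cast this
  have ha0 : (0 : ℝ) < a := by linarith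
  have hcast : (tu : ℝ) * (w : ℝ) = a := by rw [ha]; push_cast; rfl
  rw [hcast]
  set Z := Real.logb 2 (a : ℝ) with hZ
  have hZ1 : 1 ≤ Z := by
    rw [hZ, Real.le_logb_iff_rpow_le (by norm_num) ha0, Real.rpow_one]
    linarith
  set y := X / Z with hy
  have hy0 : 0 < y := by positivity
  have hyX : y ≤ X := div_le_self hX0.le hZ1
  -- The construction gives the larger bound `(X / Z) ^ (3 / 2)`; as `1 ≤ Z`, the exponent of `Z`
  -- may be raised to `2`.
  have hmain : X ^ (3 / 2 : ℝ) / Z ^ 2 ≤ y * √y := by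
    have h1 : X ^ (3 / 2 : ℝ) = X * √X := by
      rw [show (3 / 2 : ℝ) = 1 + 1 / 2 by norm_num, Real.rpow_add hX0, Real.rpow_one,
        ← Real.sqrt_eq_rpow]
    have h2 : √Z ≤ Z := by
      rw [Real.sqrt_le_left (by linarith)]
      nlinarith
    have h3 : 0 < √Z := Real.sqrt_pos.2 (by linarith)
    rw [h1, hy, Real.sqrt_div hX0.le, div_mul_div_comm]
    refine div_le_div_of_nonneg_left (by positivity) (by positivity) ?_
    nlinarith
  have hgoal : y * √y ≤ tq * (10000 * (R * √R)) →
      1 / (10000 * (R * √R)) * (X ^ (3 / 2 : ℝ) / Z ^ 2) ≤ tq := by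
    intro h1
    rw [one_div, inv_mul_le_iff₀ (by positivity)]
    linarith
  apply hgoal
  have hsR : 0 < √R := Real.sqrt_pos.2 hR0
  by_cases hyR : y ≤ R
  · have h1 := CellProbe.one_le_of_isDynamicReachabilityDS h hn2
    have h2 : y * √y ≤ R * √R := mul_le_mul hyR (Real.sqrt_le_sqrt hyR) (by positivity) hR0.le
    have h3 : 0 < R * √R := by positivity
    nlinarith
  · push Not at hyR
    -- The graph needs `a ^ (64 * (2 * ℓ + 1))` nodes, and `64 * (2 * ℓ + 1) ≤ 256 * ℓ ≤ y` for `1 ≤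
    -- ℓ`.
    set ℓ := ⌊y / 256⌋₊ with hℓ
    have hℓ1 : (ℓ : ℝ) ≤ y / 256 := Nat.floor_le (by positivity)
    have hℓ2 : y / 256 < ℓ + 1 := Nat.lt_floor_add_one _
    have hℓ3 : ℓ₀ ≤ ℓ := by
      refine Nat.le_floor ?_
      rw [hR] at hyR
      linarith
    have hℓ4 : (1 : ℝ) ≤ ℓ := by exact_mod_cast hℓ₀.trans hℓ3
    have hy1 : y ≤ R * ℓ := by nlinarith
    -- From `ℓ ≤ X ≤ w / c ≤ a / c` and `4 / c ≤ a`.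
    have hℓa : 4 * ℓ ≤ a ^ 2 := by
      have h1 : (ℓ : ℝ) ≤ a / c := by
        rw [le_div_iff₀ hc]
        nlinarith
      have h2 : (4 * ℓ : ℝ) ≤ (a : ℝ) ^ 2 := by
        have h3 : (4 : ℝ) * (a / c) = 4 / c * a := by ring
        nlinarith
      exact_mod_cast h2
    have hfit : a ^ (64 * (2 * ℓ + 1)) ≤ n := by
      have h1 : ((64 * (2 * ℓ + 1) : ℕ) : ℝ) ≤ y := by
        push_cast
        linarith
      have h2 : (a : ℝ) ^ (64 * (2 * ℓ + 1)) ≤ n := by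
        rw [← Real.logb_le_logb (b := 2) (by norm_num) (by positivity) hn0, Real.logb_pow]
        calc _ ≤ y * Z := mul_le_mul_of_nonneg_right h1 (by linarith)
          _ = X := div_mul_cancel₀ _ (by linarith)
      exact_mod_cast h2
    have h1 := hbound h ℓ a hℓ3 ha ha8' hℓa hfit
    have h2 : y * √y ≤ (R * ℓ) * (√R * √ℓ) := by
      rw [← Real.sqrt_mul hR0.le]
      exact mul_le_mul hy1 (Real.sqrt_le_sqrt hy1) (by positivity) (by positivity)
    have h3 : 0 < R * √R := by positivity
    calc y * √y ≤ (R * ℓ) * (√R * √ℓ) := h2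
      _ = (1 / 10000 * (ℓ * √ℓ)) * (10000 * (R * √R)) := by ring
      _ ≤ tq * (10000 * (R * √R)) := by gcongr
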